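/- Let $m\ge 2$, let $M$ be a closed (compact, without boundary) connected smooth manifold of dimension $m+1$, and let $t_0<t_1<T$ be real numbers. Let $(g(t),p(t))$, $t\in[t_0,t_1]$, be a solution of the conformal Ricci flow on $M$ that is smooth on $M\times[t_0,t_1]$, that is, a family of Riemannian metrics $g(t)$ and functions $p(t)$ on $M$ with $$\partial_t g=-2\big(\mathrm{Ric}+(m+p)g\big),\qquad -\Delta p+(m+1)p=\tfrac1m\,|\mathrm{Ric}+m g|^2,\qquad R_{g(t)}=-m(m+1),$$ where $\mathrm{Ric}$, $R_{g(t)}$, $\Delta$, $\nabla$, $|\cdot|$ and the volume element $d\mu$ are those of $g(t)$. Put $\bar p(t)=\max_{x\in M}p(x,t)$. Let $f$ be a smooth function on $M\times[t_0,t_1]$ such that $H=(4\pi(T-t))^{-\frac{m+1}{2}}e^{-f}$ solves the conjugate heat equation $\partial_tH=-\Delta H+(m+1)pH$, and put $dV=H\,d\mu$. Let $h>0$ and $k$ be smooth functions on $[t_0,t_1]$ such that, on $M\times[t_0,t_1]$, $$\mathrm{Ric}+\mathrm{Hess}\,f\le\Big(\frac{k(t)}{2h(t)}+\frac{R_{g(t)}}{m+1}\Big)g(t).$$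 Let $v$ be a smooth function on $M\times[t_0,t_1]$ with $$|(\partial_t-\Delta)v|\le\bar p(t)\big(|v|+|\nabla v|\big)\quad\text{on }M\times[t_0,t_1].$$ Put $I(t)=\int_Mv^2\,dV$, $E(t)=h(t)\int_M|\nabla v|^2\,dV$, $\theta(t)=\int_{t_0}^t\big(2\bar p(s)+\frac{h'(s)+k(s)}{h(s)}\big)ds$ and $Q(t)=\frac{E(t)}{I(t)}e^{-\theta(t)}$, and let $P=\sup_{t\in[t_0,t_1]}\bar p(t)$. Then $$I(t_1)\ \ge\ I(t_0)\exp\Big\{-3(t_1-t_0)P-(2+P)\big(Q(t_0)+h(t_0)\big)\,e^{\int_{t_0}^{t_1}\bar p(t)^2dt}\int_{t_0}^{t_1}\frac{e^{\theta(t)}}{h(t)}\,dt\Big\}$$ (if $I(t_0)=0$, the right-hand side is read as $0$). Moreover, if $v(\cdot,t_1)=0$, then $v(\cdot,t)\equiv0$ for all $t\in[t_0,t_1]$. -/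

import Mathlib

open scoped Manifold ContDiff Topology

noncomputable section

namespace ConformalRicci

/-! ### Riemannian geometry of a metric given by its coefficients in coordinates -/

section Coordinates

variable {n : ℕ}

/-- The partial derivative `∂_i F` of a function on `ℝⁿ`. -/
def pderiv (i : Fin n) (F : EuclideanSpace ℝ (Fin n) → ℝ) (y : EuclideanSpace ℝ (Fin n)) : ℝ :=
  fderiv ℝ F y (EuclideanSpace.single i 1)

/-- The Christoffel symbol
`Γ^k_{ij} = ½ ∑_l G^{kl} (∂_i G_{jl} + ∂_j G_{il} - ∂_l G_{ij})`
of the metric with coefficients `G`. -/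
def christoffel (G : EuclideanSpace ℝ (Fin n) → Matrix (Fin n) (Fin n) ℝ) (k i j : Fin n)
    (y : EuclideanSpace ℝ (Fin n)) : ℝ :=
  (1 / 2) * ∑ l, (G y)⁻¹ k l *
    (pderiv i (fun z => G z j l) y + pderiv j (fun z => G z i l) y
      - pderiv l (fun z => G z i j) y)

/-- The Ricci tensor
`R_{ij} = ∑_k (∂_k Γ^k_{ij} - ∂_i Γ^k_{kj}) + ∑_{k,l} (Γ^k_{kl} Γ^l_{ij} - Γ^k_{il} Γ^l_{kj})`
(positive on round spheres). -/
def ricciCoord (G : EuclideanSpace ℝ (Fin n) → Matrix (Fin n) (Fin n) ℝ) (i j : Fin n)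
    (y : EuclideanSpace ℝ (Fin n)) : ℝ :=
  (∑ k, (pderiv k (christoffel G k i j) y - pderiv i (christoffel G k k j) y))
    + ∑ k, ∑ l, (christoffel G k k l y * christoffel G l i j y
        - christoffel G k i l y * christoffel G l k j y)

/-- The Hessian `∇_i ∇_j F = ∂_i ∂_j F - ∑_k Γ^k_{ij} ∂_k F`. -/
def hessCoord (G : EuclideanSpace ℝ (Fin n) → Matrix (Fin n) (Fin n) ℝ)
    (F : EuclideanSpace ℝ (Fin n) → ℝ) (i j : Fin n) (y : EuclideanSpace ℝ (Fin n)) : ℝ :=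
  pderiv i (pderiv j F) y - ∑ k, christoffel G k i j y * pderiv k F y

end Coordinates

/-! ### Riemannian geometry on a manifold -/

/-- Smooth Riemannian metrics on the `n`-dimensional manifold `M`. -/
abbrev SmoothMetric (n : ℕ) (M : Type*) [TopologicalSpace M]
    [ChartedSpace (EuclideanSpace ℝ (Fin n)) M] [IsManifold (𝓡 n) ∞ M] :=
  Bundle.ContMDiffRiemannianMetric (𝓡 n) ∞ (EuclideanSpace ℝ (Fin n))
    (fun x : M => TangentSpace (𝓡 n) x)

section Manifold

variable {n : ℕ} {M : Type*} [TopologicalSpace M] [ChartedSpace (EuclideanSpace ℝ (Fin n)) M]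

/-- The coordinate vector field `∂_i` of the chart around `c`, at the point with coordinates `y`. -/
def coordVec (c : M) (i : Fin n) (y : EuclideanSpace ℝ (Fin n)) :
    TangentSpace (𝓡 n) ((extChartAt (𝓡 n) c).symm y) :=
  mfderiv 𝓘(ℝ, EuclideanSpace ℝ (Fin n)) (𝓡 n) (extChartAt (𝓡 n) c).symm y
    (EuclideanSpace.single i (1 : ℝ) : EuclideanSpace ℝ (Fin n))

/-- The function `u` read in the chart around `c`. -/
def inChart (u : M → ℝ) (c : M) : EuclideanSpace ℝ (Fin n) → ℝ :=
  fun y => u ((extChartAt (𝓡 n) c).symm y)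

variable [IsManifold (𝓡 n) ∞ M]

/-- The coefficients `g_{ij} = g(∂_i, ∂_j)` in the chart around `c`. -/
def coeff (g : SmoothMetric n M) (c : M) (y : EuclideanSpace ℝ (Fin n)) : Matrix (Fin n) (Fin n) ℝ :=
  Matrix.of fun i j => g.inner ((extChartAt (𝓡 n) c).symm y) (coordVec c i y) (coordVec c j y)

/-- The inverse matrix `g^{ij}` at `x`, in the chart around `x`. -/
def invCoeffAt (g : SmoothMetric n M) (x : M) : Matrix (Fin n) (Fin n) ℝ :=
  (coeff g x (extChartAt (𝓡 n) x x))⁻¹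

/-- The components `R_{ij}` of the Ricci tensor at `x`, in the chart around `x`. -/
def ricciAt (g : SmoothMetric n M) (x : M) : Matrix (Fin n) (Fin n) ℝ :=
  Matrix.of fun i j => ricciCoord (coeff g x) i j (extChartAt (𝓡 n) x x)

/-- The components `∇_i ∇_j u` of the Hessian at `x`, in the chart around `x`. -/
def hessAt (g : SmoothMetric n M) (u : M → ℝ) (x : M) : Matrix (Fin n) (Fin n) ℝ :=
  Matrix.of fun i j => hessCoord (coeff g x) (inChart u x) i j (extChartAt (𝓡 n) x x)

/-- The components of `X ∈ T_x M` with respect to the coordinate fields of the chart around `x`: in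
Mathlib the tangent space `T_x M` is `ℝⁿ` by means of that chart. -/
def components (x : M) (X : TangentSpace (𝓡 n) x) : EuclideanSpace ℝ (Fin n) := X

/-- The bilinear form on `T_x M` with components `A` in the chart around `x`. -/
def formAt (x : M) (A : Matrix (Fin n) (Fin n) ℝ) (X Y : TangentSpace (𝓡 n) x) : ℝ :=
  ∑ i, ∑ j, A i j * components x X i * components x Y j

/-- The Ricci tensor `Ric(X, Y)`. -/
def Ric (g : SmoothMetric n M) (x : M) (X Y : TangentSpace (𝓡 n) x) : ℝ :=
  formAt x (ricciAt g x) X Y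

/-- The Hessian `(Hess u)(X, Y)`. -/
def Hess (g : SmoothMetric n M) (u : M → ℝ) (x : M) (X Y : TangentSpace (𝓡 n) x) : ℝ :=
  formAt x (hessAt g u x) X Y

/-- The Bakry–Émery Ricci tensor `Ric_f = Ric + Hess f`. -/
def bakryEmery (g : SmoothMetric n M) (f : M → ℝ) (x : M) (X Y : TangentSpace (𝓡 n) x) : ℝ :=
  Ric g x X Y + Hess g f x X Y

/-- The scalar curvature `R = g^{ij} R_{ij}`. -/
def scalarCurvature (g : SmoothMetric n M) (x : M) : ℝ :=
  ∑ i, ∑ j, invCoeffAt g x i j * ricciAt g x i j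

/-- The Laplace–Beltrami operator `Δ u = g^{ij} ∇_i ∇_j u`. -/
def laplacian (g : SmoothMetric n M) (u : M → ℝ) (x : M) : ℝ :=
  ∑ i, ∑ j, invCoeffAt g x i j * hessAt g u x i j

/-- `|∇u|² = g^{ij} ∂_i u ∂_j u`. -/
def gradSq (g : SmoothMetric n M) (u : M → ℝ) (x : M) : ℝ :=
  ∑ i, ∑ j, invCoeffAt g x i j * pderiv i (inChart u x) (extChartAt (𝓡 n) x x)
    * pderiv j (inChart u x) (extChartAt (𝓡 n) x x)

/-- `|Ric + a g|² = g^{ik} g^{jl} (R_{ij} + a g_{ij}) (R_{kl} + a g_{kl})`. -/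
def ricAddNormSq (g : SmoothMetric n M) (a : ℝ) (x : M) : ℝ :=
  ∑ i, ∑ j, ∑ k, ∑ l, invCoeffAt g x i k * invCoeffAt g x j l
    * (ricciAt g x i j + a * coeff g x (extChartAt (𝓡 n) x x) i j)
    * (ricciAt g x k l + a * coeff g x (extChartAt (𝓡 n) x x) k l)

/-- A smooth partition of unity on `M` subordinate to the domains of the charts. -/
def chartPartition (n : ℕ) (M : Type*) [TopologicalSpace M]
    [ChartedSpace (EuclideanSpace ℝ (Fin n)) M] [IsManifold (𝓡 n) ∞ M] [SigmaCompactSpace M]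
    [T2Space M] : SmoothPartitionOfUnity M (𝓡 n) M Set.univ :=
  (SmoothPartitionOfUnity.exists_isSubordinate_chartAt_source (𝓡 n) M).choose

/-- The Riemannian volume measure `dμ_g`, which is `√(det g_{ij}) dx¹ ⋯ dxⁿ` in every chart, glued
by the partition of unity. -/
def volumeMeasure [SigmaCompactSpace M] [T2Space M] [MeasurableSpace M] (g : SmoothMetric n M) :
    MeasureTheory.Measure M :=
  MeasureTheory.Measure.sum fun c : M =>
    (((MeasureTheory.volume : MeasureTheory.Measure (EuclideanSpace ℝ (Fin n))).restrict
        (extChartAt (𝓡 n) c).target).withDensity fun y =>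
          ENNReal.ofReal (chartPartition n M c ((extChartAt (𝓡 n) c).symm y)
            * Real.sqrt (coeff g c y).det)).map (extChartAt (𝓡 n) c).symm

end Manifold

/-! ### The conformal Ricci flow and the frequency functional

The dimension of the manifold is `m + 1` throughout. -/

section Flow

variable {m : ℕ} {M : Type*} [TopologicalSpace M]
  [ChartedSpace (EuclideanSpace ℝ (Fin (m + 1))) M]

/-- `u(x, t)` is smooth on `M × [t₀, t₁]`. -/
def SmoothOn (m : ℕ) {M : Type*} [TopologicalSpace M]
    [ChartedSpace (EuclideanSpace ℝ (Fin (m + 1))) M] (t₀ t₁ : ℝ) (u : ℝ → M → ℝ) : Prop :=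
  ContMDiffOn (𝓘(ℝ, ℝ).prod (𝓡 (m + 1))) 𝓘(ℝ, ℝ) ∞ (fun q : ℝ × M => u q.1 q.2)
    (Set.Icc t₀ t₁ ×ˢ Set.univ)

/-- The time derivative `∂_t u`, one-sided at the ends of `[t₀, t₁]`. -/
def timeDeriv {M : Type*} (t₀ t₁ : ℝ) (u : ℝ → M → ℝ) (t : ℝ) (x : M) : ℝ :=
  derivWithin (fun s => u s x) (Set.Icc t₀ t₁) t

/-- `p̄(t) = max_{x ∈ M} p(x, t)`. -/
def pbar {M : Type*} (p : ℝ → M → ℝ) (t : ℝ) : ℝ := ⨆ x, p t x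

/-- The weight `H = (4π(T - t))^{-(m+1)/2} e^{-f}`. -/
def weight (m : ℕ) {M : Type*} (T : ℝ) (f : ℝ → M → ℝ) (t : ℝ) (x : M) : ℝ :=
  (4 * Real.pi * (T - t)) ^ (-(((m : ℝ) + 1) / 2)) * Real.exp (-f t x)

/-- The exponent `∫_{t₀}^t (2 p̄ + (h' + k) / h) ds`. -/
def exponent {M : Type*} (p : ℝ → M → ℝ) (h k : ℝ → ℝ) (t₀ t₁ t : ℝ) : ℝ :=
  ∫ s in t₀..t, (2 * pbar p s + (derivWithin h (Set.Icc t₀ t₁) s + k s) / h s)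

variable [IsManifold (𝓡 (m + 1)) ∞ M]

/-- `(g(t), p(t))` is a smooth solution, on `M × [t₀, t₁]`, of the conformal Ricci flow
`∂_t g = -2 (Ric + (m + p) g)`, `-Δp + (m + 1) p = |Ric + m g|² / m`,
with scalar curvature `-m (m + 1)`. -/
structure IsConformalRicciFlow (g : ℝ → SmoothMetric (m + 1) M) (p : ℝ → M → ℝ) (t₀ t₁ : ℝ) :
    Prop where
  smooth_metric : ∀ c : M, ContDiffOn ℝ ∞
    (fun q : ℝ × EuclideanSpace ℝ (Fin (m + 1)) => fun i j => coeff (g q.1) c q.2 i j)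
    (Set.Icc t₀ t₁ ×ˢ (extChartAt (𝓡 (m + 1)) c).target)
  smooth_pressure : SmoothOn m t₀ t₁ p
  evolution : ∀ t ∈ Set.Icc t₀ t₁, ∀ (x : M) (X Y : TangentSpace (𝓡 (m + 1)) x),
    HasDerivWithinAt (fun s => (g s).inner x X Y)
      (-2 * (Ric (g t) x X Y + ((m : ℝ) + p t x) * (g t).inner x X Y)) (Set.Icc t₀ t₁) t
  pressure : ∀ t ∈ Set.Icc t₀ t₁, ∀ x : M,
    -laplacian (g t) (p t) x + ((m : ℝ) + 1) * p t x = (1 / (m : ℝ)) * ricAddNormSq (g t) (m : ℝ) x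
  scalar : ∀ t ∈ Set.Icc t₀ t₁, ∀ x : M, scalarCurvature (g t) x = -((m : ℝ) * ((m : ℝ) + 1))

/-- The weight `H` determined by `f` solves the conjugate heat equation
`∂_t H = -ΔH + (m + 1) p H` on `M × [t₀, t₁]`. -/
def IsConjugateHeatSolution (g : ℝ → SmoothMetric (m + 1) M) (p : ℝ → M → ℝ) (T : ℝ) (f : ℝ → M → ℝ)
    (t₀ t₁ : ℝ) : Prop :=
  ∀ t ∈ Set.Icc t₀ t₁, ∀ x : M,
    timeDeriv t₀ t₁ (weight m T f) t x
      = -laplacian (g t) (weight m T f t) x + ((m : ℝ) + 1) * p t x * weight m T f t x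

variable [SigmaCompactSpace M] [T2Space M] [MeasurableSpace M]

/-- `I(t) = ∫ v² dV` with the weighted measure `dV = H dμ_{g(t)}`. -/
def energyI (g : ℝ → SmoothMetric (m + 1) M) (T : ℝ) (f v : ℝ → M → ℝ) (t : ℝ) : ℝ :=
  ∫ x, v t x ^ 2 * weight m T f t x ∂(volumeMeasure (g t))

/-- `E(t) = h(t) ∫ |∇v|² dV`. -/
def energyE (g : ℝ → SmoothMetric (m + 1) M) (T : ℝ) (f v : ℝ → M → ℝ) (h : ℝ → ℝ) (t : ℝ) : ℝ :=
  h t * ∫ x, gradSq (g t) (v t) x * weight m T f t x ∂(volumeMeasure (g t))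

/-- The parabolic frequency `Q(t) = (E(t) / I(t)) exp (-∫_{t₀}^t (2 p̄ + (h' + k) / h) ds)`. -/
def frequency (g : ℝ → SmoothMetric (m + 1) M) (p : ℝ → M → ℝ) (T : ℝ) (f v : ℝ → M → ℝ)
    (h k : ℝ → ℝ) (t₀ t₁ t : ℝ) : ℝ :=
  energyE g T f v h t / energyI g T f v t * Real.exp (-exponent p h k t₀ t₁ t)

end Flow

end ConformalRicci

end

open scoped Manifold ContDiff Topology

noncomputable section

/-! Let D = ∫|∇v|² dV, so that E = hD. Since R = -m(m+1), the volume element satisfies ∂_t dμ =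
-(m+1)p dμ. The zeroth-order term of the conjugate heat equation compensates exactly this, and ∇H =
-H∇f, whence d/dt ∫u dV = ∫(u_t - ⟨∇f,∇u⟩) dV for every smooth u. Put φ = v_t - ⟨∇f,∇v⟩ and ψ = Δv -
⟨∇f,∇v⟩. Then I' = 2∫vφ dV, D = -∫vψ dV by weighted integration by parts, and D' ≤ (k/h + 2p̄)D -
2∫φψ dV. In the last formula the derivative of g⁻¹ produces 2Ric(∇v,∇v), the drift along ∇f produces
2Hess f(∇v,∇v), and the upper bound on Ric + Hess f applies to their sum; Bochner's formula is not
used.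

The hypothesis on v says |φ - ψ| ≤ p̄(|v| + |∇v|). With a = (φ+ψ)/2 and w = φ - ψ, Cauchy–Schwarz
for ∫va dV gives D'I - DI' ≤ ((k/h + 2p̄)D + p̄²(I + D))I, and I' ≥ -(2+p̄)D - 3p̄I
(`energy_inequalities`). The exponent θ is designed to cancel the linear terms, leaving Q' ≤ p̄²(Q +
h e^{-θ}).

Two signs are needed and are not hypotheses. Integrating the pressure equation gives p̄ ≥ 0
(`pbar_nonneg`); integrating the trace of the curvature bound gives k ≥ 0
(`nonneg_of_bakryEmery_le`). Hence h e^{-θ} is nonincreasing, and Gronwall's inequality bounds Q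
(`FrequencyData.frequency_le`). Inserted in (log I)' ≥ -(2+p̄)D/I - 3p̄, this bounds the decay of I
as long as I > 0. The bound is uniform up to a hypothetical first zero, so I never reaches zero once
it is positive; this is the backward uniqueness.

The geometry is done in coordinates. The Hessian is determined by inner products of gradients
(`IsMetricOn.two_mul_hessCoord_gradVec`), which yields its invariance under changes of charts
without the transformation law of the Christoffel symbols. Green's formula follows from the
divergence form of the Laplacian and a partition of unity. The measures of the metrics g(t) are
compared with the fixed measure of g(t₀), so that integrals can be differentiated under the integral
sign. -/

namespace ConformalRicci

/-! ### Derivatives of determinants and inverse matrices -/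

section MatrixCalculus

open Matrix

variable {n : ℕ}

/-- Jacobi's formula. -/
theorem hasDerivAt_det {A : ℝ → Matrix (Fin n) (Fin n) ℝ} {A' : Matrix (Fin n) (Fin n) ℝ} {s : ℝ}
    (hA : ∀ i j, HasDerivAt (fun r => A r i j) (A' i j) s) (hdet : (A s).det ≠ 0) :
    HasDerivAt (fun r => (A r).det) ((A s).det * ((A s)⁻¹ * A').trace) s := by
  have h1 : HasDerivAt (fun r => (A r).det)
      (∑ σ : Equiv.Perm (Fin n), ((Equiv.Perm.sign σ : ℤ) : ℝ) *
        ∑ i, (∏ j ∈ Finset.univ.erase i, A s (σ j) j) • A' (σ i) i) s := by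
    simp only [det_apply']
    refine HasDerivAt.fun_sum fun σ _ => ?_
    exact (HasDerivAt.fun_finsetProd fun i _ => hA (σ i) i).const_mul _
  have h2 : (A s).det * ((A s)⁻¹ * A').trace = ((A s).adjugate * A').trace := by
    rw [Matrix.inv_def, Matrix.smul_mul, Matrix.trace_smul, smul_eq_mul, ← mul_assoc,
      Ring.inverse_eq_inv', mul_inv_cancel₀ hdet, one_mul]
  -- Cramer's rule: the i-th diagonal entry of adj(A)A' is the determinant of A with its i-th column
  -- replaced by that of A'. Its Leibniz expansion is the i-th part of the sum in `h1`.
  have h3 : ((A s).adjugate * A').trace = ∑ i, ((A s).updateCol i (fun k => A' k i)).det := by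
    simp only [Matrix.trace, Matrix.diag_apply]
    refine Finset.sum_congr rfl fun i _ => ?_
    rw [← cramer_apply, cramer_eq_adjugate_mulVec]
    rfl
  rw [h2, h3]
  convert h1 using 1
  simp only [det_apply', Finset.mul_sum]
  rw [Finset.sum_comm]
  refine Finset.sum_congr rfl fun σ _ => Finset.sum_congr rfl fun i _ => ?_
  rw [← Finset.mul_prod_erase Finset.univ _ (Finset.mem_univ i)]
  have : ∏ x ∈ Finset.univ.erase i, (A s).updateCol i (fun k => A' k i) (σ x) x
      = ∏ j ∈ Finset.univ.erase i, A s (σ j) j := by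
    refine Finset.prod_congr rfl fun j hj => ?_
    rw [updateCol_ne (Finset.ne_of_mem_erase hj)]
  rw [this, updateCol_self, smul_eq_mul]
  ring

attribute [local instance] Matrix.linftyOpNormedRing Matrix.linftyOpNormedAlgebra

/-- The entry of a matrix, as a continuous linear functional. -/
def entryCLM (i j : Fin n) : Matrix (Fin n) (Fin n) ℝ →L[ℝ] ℝ :=
  LinearMap.toContinuousLinearMap (Matrix.entryLinearMap ℝ ℝ i j)

theorem eq_sum_smul_single (A : Matrix (Fin n) (Fin n) ℝ) :
    A = ∑ i, ∑ j, A i j • Matrix.single i j (1 : ℝ) := by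
  conv_lhs => rw [matrix_eq_sum_single A]
  simp

/-- Inversion in a complete normed algebra has derivative X ↦ -A⁻¹XA⁻¹. The norm on matrices is only
an auxiliary choice, since hypotheses and conclusion are about entries. -/
theorem hasDerivAt_inv_apply {A : ℝ → Matrix (Fin n) (Fin n) ℝ} {A' : Matrix (Fin n) (Fin n) ℝ}
    {s : ℝ} (hA : ∀ i j, HasDerivAt (fun r => A r i j) (A' i j) s) (hdet : (A s).det ≠ 0)
    (i j : Fin n) :
    HasDerivAt (fun r => (A r)⁻¹ i j) (-((A s)⁻¹ * A' * (A s)⁻¹) i j) s := by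
  have h1 : HasDerivAt A A' s := by
    have : HasDerivAt (fun r => ∑ i, ∑ j, A r i j • Matrix.single i j (1 : ℝ))
        (∑ i, ∑ j, A' i j • Matrix.single i j (1 : ℝ)) s :=
      HasDerivAt.fun_sum fun i _ => HasDerivAt.fun_sum fun j _ => (hA i j).smul_const _
    simpa only [← eq_sum_smul_single] using this
  obtain ⟨u, hu⟩ := (Matrix.isUnit_iff_isUnit_det (A s)).2 (isUnit_iff_ne_zero.2 hdet)
  have h2 := hasFDerivAt_ringInverse (𝕜 := ℝ) u
  rw [hu] at h2
  have h4 : ((u⁻¹ : (Matrix (Fin n) (Fin n) ℝ)ˣ) : Matrix (Fin n) (Fin n) ℝ) = (A s)⁻¹ := by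
    rw [← hu, Matrix.coe_units_inv]
  have h3 : HasDerivAt (fun r => (A r)⁻¹) (-((A s)⁻¹ * A' * (A s)⁻¹)) s := by
    have h5 := h2.comp_hasDerivAt s h1
    rw [_root_.neg_apply, ContinuousLinearMap.mulLeftRight_apply, h4] at h5
    refine h5.congr_of_eventuallyEq (Filter.Eventually.of_forall fun r => ?_)
    exact Matrix.nonsing_inv_eq_ringInverse (A r)
  exact (entryCLM i j).hasFDerivAt.comp_hasDerivAt s h3

theorem contDiffWithinAt_inv_apply {X : Type*} [NormedAddCommGroup X] [NormedSpace ℝ X]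
    {A : X → Matrix (Fin n) (Fin n) ℝ} {S : Set X} {x : X}
    (hA : ∀ i j, ContDiffWithinAt ℝ ∞ (fun r => A r i j) S x) (hdet : (A x).det ≠ 0)
    (i j : Fin n) : ContDiffWithinAt ℝ ∞ (fun r => (A r)⁻¹ i j) S x := by
  have h1 : ContDiffWithinAt ℝ ∞ A S x := by
    have : ContDiffWithinAt ℝ ∞ (fun r => ∑ i, ∑ j, A r i j • Matrix.single i j (1 : ℝ)) S x :=
      ContDiffWithinAt.sum fun i _ => ContDiffWithinAt.sum fun j _ =>
        (hA i j).smul contDiffWithinAt_const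
    simpa only [← eq_sum_smul_single] using this
  obtain ⟨u, hu⟩ := (Matrix.isUnit_iff_isUnit_det (A x)).2 (isUnit_iff_ne_zero.2 hdet)
  have h2 := contDiffAt_ringInverse (n := ∞) ℝ u
  rw [hu] at h2
  have h3 := ((entryCLM i j).contDiff.contDiffAt.comp _ h2).comp_contDiffWithinAt x h1
  refine h3.congr_of_eventuallyEq (Filter.Eventually.of_forall fun r => ?_) ?_
  · exact congrFun (congrFun (Matrix.nonsing_inv_eq_ringInverse (A r)) i) j
  · exact congrFun (congrFun (Matrix.nonsing_inv_eq_ringInverse (A x)) i) j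

theorem contDiffWithinAt_det {X : Type*} [NormedAddCommGroup X] [NormedSpace ℝ X]
    {A : X → Matrix (Fin n) (Fin n) ℝ} {S : Set X} {x : X}
    (hA : ∀ i j, ContDiffWithinAt ℝ ∞ (fun r => A r i j) S x) :
    ContDiffWithinAt ℝ ∞ (fun r => (A r).det) S x := by
  simp only [det_apply']
  exact ContDiffWithinAt.sum fun σ _ => contDiffWithinAt_const.mul
    (contDiffWithinAt_prod fun i _ => hA _ _)

/-- The derivative of `α ⬝ A⁻¹ β` along a curve of symmetric invertible matrices. -/
theorem hasDerivAt_dotProduct_inv_mulVec {A : ℝ → Matrix (Fin n) (Fin n) ℝ}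
    {A' : Matrix (Fin n) (Fin n) ℝ} {α β : ℝ → Fin n → ℝ} {α' β' : Fin n → ℝ} {s : ℝ}
    (hA : ∀ i j, HasDerivAt (fun r => A r i j) (A' i j) s) (hdet : (A s).det ≠ 0)
    (hsymm : (A s).IsSymm)
    (hα : ∀ i, HasDerivAt (fun r => α r i) (α' i) s)
    (hβ : ∀ i, HasDerivAt (fun r => β r i) (β' i) s) :
    HasDerivAt (fun r => α r ⬝ᵥ ((A r)⁻¹ *ᵥ β r))
      (α' ⬝ᵥ ((A s)⁻¹ *ᵥ β s) + ((A s)⁻¹ *ᵥ α s) ⬝ᵥ β'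
        - ((A s)⁻¹ *ᵥ α s) ⬝ᵥ (A' *ᵥ ((A s)⁻¹ *ᵥ β s))) s := by
  have hs : ((A s)⁻¹)ᵀ = (A s)⁻¹ := by rw [Matrix.transpose_nonsing_inv, hsymm]
  have h1 : ∀ x : Fin n → ℝ, ((A s)⁻¹ *ᵥ α s) ⬝ᵥ x = α s ⬝ᵥ ((A s)⁻¹ *ᵥ x) := by
    intro x
    rw [Matrix.dotProduct_mulVec, ← Matrix.mulVec_transpose, hs]
  have h : HasDerivAt (fun r => ∑ i, α r i * ∑ j, (A r)⁻¹ i j * β r j)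
      (∑ i, (α' i * (∑ j, (A s)⁻¹ i j * β s j) + α s i *
        ∑ j, (-((A s)⁻¹ * A' * (A s)⁻¹) i j * β s j + (A s)⁻¹ i j * β' j))) s :=
    HasDerivAt.fun_sum fun i _ => (hα i).mul
      (HasDerivAt.fun_sum fun j _ => (hasDerivAt_inv_apply hA hdet i j).mul (hβ j))
  refine h.congr_deriv ?_
  rw [h1, h1, Matrix.mulVec_mulVec, Matrix.mulVec_mulVec]
  simp only [dotProduct, mulVec, ← Finset.sum_add_distrib, ← Finset.sum_sub_distrib]
  refine Finset.sum_congr rfl fun i _ => ?_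
  rw [Finset.sum_add_distrib]
  simp only [neg_mul, Finset.sum_neg_distrib]
  ring

/-- The derivative of `A⁻¹ β` along a curve of invertible matrices. -/
theorem hasDerivAt_inv_mulVec {A : ℝ → Matrix (Fin n) (Fin n) ℝ}
    {A' : Matrix (Fin n) (Fin n) ℝ} {β : ℝ → Fin n → ℝ} {β' : Fin n → ℝ} {s : ℝ}
    (hA : ∀ i j, HasDerivAt (fun r => A r i j) (A' i j) s) (hdet : (A s).det ≠ 0)
    (hβ : ∀ i, HasDerivAt (fun r => β r i) (β' i) s) (i : Fin n) :
    HasDerivAt (fun r => ((A r)⁻¹ *ᵥ β r) i)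
      (((A s)⁻¹ *ᵥ (β' - A' *ᵥ ((A s)⁻¹ *ᵥ β s))) i) s := by
  have h : HasDerivAt (fun r => ∑ j, (A r)⁻¹ i j * β r j)
      (∑ j, (-((A s)⁻¹ * A' * (A s)⁻¹) i j * β s j + (A s)⁻¹ i j * β' j)) s :=
    HasDerivAt.fun_sum fun j _ => (hasDerivAt_inv_apply hA hdet i j).mul (hβ j)
  refine h.congr_deriv ?_
  rw [Matrix.mulVec_sub, Matrix.mulVec_mulVec, Matrix.mulVec_mulVec]
  simp only [mulVec, Pi.sub_apply, dotProduct, Finset.sum_add_distrib, neg_mul,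
    Finset.sum_neg_distrib]
  ring

end MatrixCalculus

/-! ### Calculus of a metric in coordinates -/

section CoordinateCalculus

open Matrix

variable {n : ℕ}

/-- `G` is a smooth field of positive definite matrices on the open set `U`. -/
structure IsMetricOn (G : EuclideanSpace ℝ (Fin n) → Matrix (Fin n) (Fin n) ℝ)
    (U : Set (EuclideanSpace ℝ (Fin n))) : Prop where
  isOpen : IsOpen U
  smooth : ∀ i j, ContDiffOn ℝ ∞ (fun z => G z i j) U
  posDef : ∀ z ∈ U, (G z).PosDef

/-- The vector of partial derivatives of `F`. -/
def dvec (F : EuclideanSpace ℝ (Fin n) → ℝ) (y : EuclideanSpace ℝ (Fin n)) : Fin n → ℝ :=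
  fun i => pderiv i F y

/-- The components of the gradient of `F`. -/
def gradVec (G : EuclideanSpace ℝ (Fin n) → Matrix (Fin n) (Fin n) ℝ)
    (F : EuclideanSpace ℝ (Fin n) → ℝ) (y : EuclideanSpace ℝ (Fin n)) : Fin n → ℝ :=
  (G y)⁻¹ *ᵥ dvec F y

/-- The inner product of the gradients of `A` and `B`. -/
def coGrad (G : EuclideanSpace ℝ (Fin n) → Matrix (Fin n) (Fin n) ℝ)
    (A B : EuclideanSpace ℝ (Fin n) → ℝ) (y : EuclideanSpace ℝ (Fin n)) : ℝ :=
  dvec A y ⬝ᵥ ((G y)⁻¹ *ᵥ dvec B y)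

variable {U : Set (EuclideanSpace ℝ (Fin n))} {y : EuclideanSpace ℝ (Fin n)}

theorem contDiffOn_pderiv {F : EuclideanSpace ℝ (Fin n) → ℝ} (hU : IsOpen U)
    (hF : ContDiffOn ℝ ∞ F U) (i : Fin n) : ContDiffOn ℝ ∞ (pderiv i F) U :=
  (hF.fderiv_of_isOpen hU (by simp)).clm_apply contDiffOn_const

theorem differentiableAt_of_contDiffOn {F : EuclideanSpace ℝ (Fin n) → ℝ} (hU : IsOpen U)
    (hF : ContDiffOn ℝ ∞ F U) (hy : y ∈ U) : DifferentiableAt ℝ F y :=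
  (hF.contDiffAt (hU.mem_nhds hy)).differentiableAt (by simp)

theorem pderiv_congr {F F' : EuclideanSpace ℝ (Fin n) → ℝ} (h : F =ᶠ[𝓝 y] F') (i : Fin n) :
    pderiv i F y = pderiv i F' y := by
  rw [pderiv, pderiv, h.fderiv_eq]

theorem pderiv_congr_on {F F' : EuclideanSpace ℝ (Fin n) → ℝ} (hU : IsOpen U)
    (h : Set.EqOn F F' U) (i : Fin n) : Set.EqOn (pderiv i F) (pderiv i F') U :=
  fun _ hz => pderiv_congr (h.eventuallyEq_of_mem (hU.mem_nhds hz)) i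

theorem pderiv_mul {F F' : EuclideanSpace ℝ (Fin n) → ℝ} (hF : DifferentiableAt ℝ F y)
    (hF' : DifferentiableAt ℝ F' y) (i : Fin n) :
    pderiv i (fun z => F z * F' z) y = F y * pderiv i F' y + F' y * pderiv i F y := by
  simp [pderiv, fderiv_fun_mul hF hF']

theorem pderiv_add {F F' : EuclideanSpace ℝ (Fin n) → ℝ} (hF : DifferentiableAt ℝ F y)
    (hF' : DifferentiableAt ℝ F' y) (i : Fin n) :
    pderiv i (fun z => F z + F' z) y = pderiv i F y + pderiv i F' y := by
  simp [pderiv, fderiv_fun_add hF hF']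

theorem pderiv_comm {F : EuclideanSpace ℝ (Fin n) → ℝ} (hU : IsOpen U)
    (hF : ContDiffOn ℝ ∞ F U) (hy : y ∈ U) (i j : Fin n) :
    pderiv i (pderiv j F) y = pderiv j (pderiv i F) y := by
  have hc := hF.contDiffAt (hU.mem_nhds hy)
  have hs := hc.isSymmSndFDerivAt (by
    rw [minSmoothness_of_isRCLikeNormedField]
    exact WithTop.coe_le_coe.2 le_top)
  have hd : DifferentiableAt ℝ (fderiv ℝ F) y :=
    (hc.fderiv_right (m := 1) (WithTop.coe_le_coe.2 le_top)).differentiableAt (by simp)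
  have key : ∀ k l : Fin n, pderiv k (pderiv l F) y
      = fderiv ℝ (fderiv ℝ F) y (EuclideanSpace.single k 1) (EuclideanSpace.single l 1) := by
    intro k l
    have : pderiv l F = fun z => fderiv ℝ F z (EuclideanSpace.single l 1) := rfl
    rw [this, pderiv, fderiv_clm_apply hd (differentiableAt_const _)]
    simp
  rw [key, key, hs]

/-- The matrix formulas above concern curves. Restricting to a coordinate line makes them available
for partial derivatives as well. -/
theorem hasDerivAt_line {F : EuclideanSpace ℝ (Fin n) → ℝ} (hF : DifferentiableAt ℝ F y)
    (i : Fin n) :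
    HasDerivAt (fun s : ℝ => F (y + s • EuclideanSpace.single i (1 : ℝ))) (pderiv i F y) 0 := by
  have h1 : HasDerivAt (fun s : ℝ => y + s • EuclideanSpace.single i (1 : ℝ))
      (EuclideanSpace.single i (1 : ℝ)) 0 := by
    simpa using ((hasDerivAt_id (0 : ℝ)).smul_const (EuclideanSpace.single i (1 : ℝ))).const_add y
  have h2 : HasFDerivAt F (fderiv ℝ F y) (y + (0 : ℝ) • EuclideanSpace.single i (1 : ℝ)) := by
    simpa using hF.hasFDerivAt
  exact h2.comp_hasDerivAt 0 h1

theorem eq_pderiv_of_hasDerivAt_line {F : EuclideanSpace ℝ (Fin n) → ℝ}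
    (hF : DifferentiableAt ℝ F y) {i : Fin n} {a : ℝ}
    (h : HasDerivAt (fun s : ℝ => F (y + s • EuclideanSpace.single i (1 : ℝ))) a 0) :
    pderiv i F y = a :=
  (hasDerivAt_line hF i).unique h

namespace IsMetricOn

variable {G : EuclideanSpace ℝ (Fin n) → Matrix (Fin n) (Fin n) ℝ}

theorem mono (hG : IsMetricOn G U) {V : Set (EuclideanSpace ℝ (Fin n))} (hV : IsOpen V)
    (hVU : V ⊆ U) : IsMetricOn G V :=
  ⟨hV, fun i j => (hG.smooth i j).mono hVU, fun z hz => hG.posDef z (hVU hz)⟩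

theorem det_pos (hG : IsMetricOn G U) (hy : y ∈ U) : 0 < (G y).det := (hG.posDef y hy).det_pos

theorem det_ne (hG : IsMetricOn G U) (hy : y ∈ U) : (G y).det ≠ 0 := (hG.det_pos hy).ne'

theorem isSymm (hG : IsMetricOn G U) (hy : y ∈ U) : (G y).IsSymm := by
  have := (hG.posDef y hy).isHermitian
  rwa [Matrix.IsHermitian, Matrix.conjTranspose_eq_transpose_of_trivial] at this

theorem isSymm_inv (hG : IsMetricOn G U) (hy : y ∈ U) : ((G y)⁻¹).IsSymm := by
  rw [Matrix.IsSymm, Matrix.transpose_nonsing_inv, hG.isSymm hy]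

theorem contDiffOn_inv (hG : IsMetricOn G U) (i j : Fin n) :
    ContDiffOn ℝ ∞ (fun z => (G z)⁻¹ i j) U :=
  fun z hz => contDiffWithinAt_inv_apply (fun i j => hG.smooth i j z hz) (hG.det_ne hz) i j

theorem contDiffOn_sqrt_det (hG : IsMetricOn G U) :
    ContDiffOn ℝ ∞ (fun z => Real.sqrt (G z).det) U :=
  ContDiffOn.sqrt (fun z hz => contDiffWithinAt_det fun i j => hG.smooth i j z hz)
    fun _ hz => hG.det_ne hz

theorem contDiffOn_gradVec (hG : IsMetricOn G U) {F : EuclideanSpace ℝ (Fin n) → ℝ}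
    (hF : ContDiffOn ℝ ∞ F U) (i : Fin n) : ContDiffOn ℝ ∞ (fun z => gradVec G F z i) U := by
  simp only [gradVec, mulVec, dotProduct, dvec]
  exact ContDiffOn.sum fun j _ => (hG.contDiffOn_inv i j).mul (contDiffOn_pderiv hG.isOpen hF j)

theorem contDiffOn_coGrad (hG : IsMetricOn G U) {A B : EuclideanSpace ℝ (Fin n) → ℝ}
    (hA : ContDiffOn ℝ ∞ A U) (hB : ContDiffOn ℝ ∞ B U) : ContDiffOn ℝ ∞ (coGrad G A B) U := by
  change ContDiffOn ℝ ∞ (fun z => ∑ i, pderiv i A z * gradVec G B z i) U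
  exact ContDiffOn.sum fun i _ => (contDiffOn_pderiv hG.isOpen hA i).mul (hG.contDiffOn_gradVec hB i)

theorem dotProduct_gradVec (hG : IsMetricOn G U) (hy : y ∈ U)
    (A : EuclideanSpace ℝ (Fin n) → ℝ) (x : Fin n → ℝ) :
    gradVec G A y ⬝ᵥ x = dvec A y ⬝ᵥ ((G y)⁻¹ *ᵥ x) := by
  rw [gradVec, Matrix.dotProduct_mulVec, ← Matrix.mulVec_transpose, hG.isSymm_inv hy]

theorem coGrad_eq (hG : IsMetricOn G U) (hy : y ∈ U) (A B : EuclideanSpace ℝ (Fin n) → ℝ) :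
    coGrad G A B y = gradVec G A y ⬝ᵥ dvec B y := by
  rw [hG.dotProduct_gradVec hy, coGrad]

theorem coGrad_comm (hG : IsMetricOn G U) (hy : y ∈ U) (A B : EuclideanSpace ℝ (Fin n) → ℝ) :
    coGrad G A B y = coGrad G B A y := by
  rw [hG.coGrad_eq hy, dotProduct_comm]
  rfl

/-- The matrix of second partial derivatives contracted with the gradient. -/
theorem pderiv_coGrad (hG : IsMetricOn G U) (hy : y ∈ U) {A B : EuclideanSpace ℝ (Fin n) → ℝ}
    (hA : ContDiffOn ℝ ∞ A U) (hB : ContDiffOn ℝ ∞ B U) (k : Fin n) :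
    pderiv k (coGrad G A B) y
      = ∑ i, pderiv k (pderiv i A) y * gradVec G B y i
        + ∑ i, gradVec G A y i * pderiv k (pderiv i B) y
        - ∑ i, ∑ j, gradVec G A y i * gradVec G B y j * pderiv k (fun z => G z i j) y := by
  have hd : ∀ {F : EuclideanSpace ℝ (Fin n) → ℝ}, ContDiffOn ℝ ∞ F U → DifferentiableAt ℝ F y :=
    fun h => differentiableAt_of_contDiffOn hG.isOpen h hy
  refine eq_pderiv_of_hasDerivAt_line (hd (hG.contDiffOn_coGrad hA hB)) ?_
  have h := hasDerivAt_dotProduct_inv_mulVec (s := 0)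
    (A := fun s => G (y + s • EuclideanSpace.single k (1 : ℝ)))
    (A' := Matrix.of fun i j => pderiv k (fun z => G z i j) y)
    (α := fun s => dvec A (y + s • EuclideanSpace.single k (1 : ℝ)))
    (β := fun s => dvec B (y + s • EuclideanSpace.single k (1 : ℝ)))
    (α' := fun i => pderiv k (pderiv i A) y) (β' := fun i => pderiv k (pderiv i B) y)
    (fun i j => hasDerivAt_line (hd (hG.smooth i j)) k)
    (by simpa using hG.det_ne hy) (by simpa using hG.isSymm hy)
    (fun i => hasDerivAt_line (hd (contDiffOn_pderiv hG.isOpen hA i)) k)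
    (fun i => hasDerivAt_line (hd (contDiffOn_pderiv hG.isOpen hB i)) k)
  refine h.congr_deriv ?_
  simp only [zero_smul, add_zero]
  change _ ⬝ᵥ gradVec G B y + gradVec G A y ⬝ᵥ _ - gradVec G A y ⬝ᵥ (_ *ᵥ gradVec G B y) = _
  simp only [dotProduct, mulVec, Finset.mul_sum, Matrix.of_apply]
  congr 1
  refine Finset.sum_congr rfl fun i _ => Finset.sum_congr rfl fun j _ => ?_
  ring

theorem pderiv_symm (hG : IsMetricOn G U) (hy : y ∈ U) (k i j : Fin n) :
    pderiv k (fun z => G z i j) y = pderiv k (fun z => G z j i) y := by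
  refine pderiv_congr_on hG.isOpen (fun z hz => ?_) k hy
  exact congrFun (congrFun (hG.isSymm hz) j) i

/-- The inverse metric in Γ is absorbed in the gradient of F. What remains is first derivatives of G
contracted with vectors, the form in which the next two computations are made. -/
theorem sum_christoffel (hG : IsMetricOn G U) (hy : y ∈ U) (F : EuclideanSpace ℝ (Fin n) → ℝ)
    (i j : Fin n) :
    ∑ k, christoffel G k i j y * pderiv k F y
      = (1 / 2) * ∑ l, gradVec G F y l * (pderiv i (fun z => G z j l) y
        + pderiv j (fun z => G z i l) y - pderiv l (fun z => G z i j) y) := by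
  have hs : ∀ k l, (G y)⁻¹ k l = (G y)⁻¹ l k := fun k l =>
    congrFun (congrFun (hG.isSymm_inv hy) l) k
  simp only [christoffel, gradVec, mulVec, dotProduct, dvec, Finset.mul_sum, Finset.sum_mul]
  rw [Finset.sum_comm]
  refine Finset.sum_congr rfl fun l _ => Finset.sum_congr rfl fun k _ => ?_
  rw [hs k l]
  ring

/-- The Hessian is determined by the inner products of gradients. -/
theorem two_mul_hessCoord_gradVec (hG : IsMetricOn G U) (hy : y ∈ U)
    {F A B : EuclideanSpace ℝ (Fin n) → ℝ} (hF : ContDiffOn ℝ ∞ F U)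
    (hA : ContDiffOn ℝ ∞ A U) (hB : ContDiffOn ℝ ∞ B U) :
    2 * ∑ i, ∑ j, hessCoord G F i j y * gradVec G A y i * gradVec G B y j
      = coGrad G A (coGrad G F B) y + coGrad G B (coGrad G F A) y
        - coGrad G F (coGrad G A B) y := by
  have hcomm := fun {F : EuclideanSpace ℝ (Fin n) → ℝ} (hF : ContDiffOn ℝ ∞ F U) i j =>
    pderiv_comm hG.isOpen hF hy i j
  rw [hG.coGrad_eq hy, hG.coGrad_eq hy, hG.coGrad_eq hy]
  simp only [dotProduct, dvec, hG.pderiv_coGrad hy hF hB, hG.pderiv_coGrad hy hF hA,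
    hG.pderiv_coGrad hy hA hB, hessCoord, hG.sum_christoffel hy]
  set a := gradVec G A y
  set b := gradVec G B y
  set f := gradVec G F y
  set dG : Fin n → Fin n → Fin n → ℝ := fun k i j => pderiv k (fun z => G z i j) y with hdG
  have hdGs : ∀ k i j, dG k i j = dG k j i := fun k i j => hG.pderiv_symm hy k i j
  -- After expansion every term is a value of S (first derivatives of the metric, symmetric in the
  -- last two arguments) or of H (second partial derivatives, symmetric). The identity is then
  -- linear in these values.
  set S : (Fin n → ℝ) → (Fin n → ℝ) → (Fin n → ℝ) → ℝ := fun x u w =>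
    ∑ k, ∑ i, ∑ j, x k * u i * w j * dG k i j with hS
  set H : (EuclideanSpace ℝ (Fin n) → ℝ) → (Fin n → ℝ) → (Fin n → ℝ) → ℝ := fun F x u =>
    ∑ k, ∑ i, x k * u i * pderiv k (pderiv i F) y with hH
  have hSs : ∀ x u w, S x u w = S x w u := by
    intro x u w
    simp only [hS]
    refine Finset.sum_congr rfl fun k _ => ?_
    rw [Finset.sum_comm]
    refine Finset.sum_congr rfl fun i _ => Finset.sum_congr rfl fun j _ => ?_
    rw [hdGs]; ring
  have hHs : ∀ {F : EuclideanSpace ℝ (Fin n) → ℝ}, ContDiffOn ℝ ∞ F U → ∀ x u,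
      H F x u = H F u x := by
    intro F hF x u
    simp only [hH]
    rw [Finset.sum_comm]
    refine Finset.sum_congr rfl fun i _ => Finset.sum_congr rfl fun j _ => ?_
    rw [hcomm hF]; ring
  have hR : ∀ (F B : EuclideanSpace ℝ (Fin n) → ℝ) (x u w : Fin n → ℝ),
      ∑ k, x k * (∑ i, pderiv k (pderiv i F) y * u i + ∑ i, w i * pderiv k (pderiv i B) y
        - ∑ i, ∑ j, w i * u j * pderiv k (fun z => G z i j) y) = H F x u + H B x w - S x w u := by
    intro F B x u w
    simp only [hH, hS, hdG]
    rw [← Finset.sum_add_distrib, ← Finset.sum_sub_distrib]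
    refine Finset.sum_congr rfl fun k _ => ?_
    rw [mul_sub, mul_add, Finset.mul_sum, Finset.mul_sum, Finset.mul_sum]
    congr 1
    · congr 1 <;> exact Finset.sum_congr rfl fun i _ => by ring
    · refine Finset.sum_congr rfl fun i _ => ?_
      rw [Finset.mul_sum]
      exact Finset.sum_congr rfl fun j _ => by ring
  have hL : ∑ i, ∑ j, (pderiv i (pderiv j F) y - 1 / 2 * ∑ l, f l * (pderiv i (fun z => G z j l) y
        + pderiv j (fun z => G z i l) y - pderiv l (fun z => G z i j) y)) * a i * b j
      = H F a b - 1 / 2 * (S a b f + S b a f - S f a b) := by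
    have e1 : S b a f = ∑ i, ∑ j, ∑ l, b j * a i * f l * dG j i l := Finset.sum_comm
    have e2 : S f a b = ∑ i, ∑ j, ∑ l, f l * a i * b j * dG l i j := by
      simp only [hS]
      rw [Finset.sum_comm]
      exact Finset.sum_congr rfl fun i _ => Finset.sum_comm
    rw [e1, e2]
    simp only [hH, hS, mul_sub, mul_add, Finset.mul_sum, ← Finset.sum_add_distrib,
      ← Finset.sum_sub_distrib]
    refine Finset.sum_congr rfl fun i _ => Finset.sum_congr rfl fun j _ => ?_
    rw [sub_mul, sub_mul, Finset.sum_mul, Finset.sum_mul]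
    congr 1
    · ring
    · exact Finset.sum_congr rfl fun l _ => by simp only [hdG]; ring
  rw [hL, hR, hR, hR, hHs hB f a, hHs hA f b, hHs hF b a, hSs a f b, hSs b f a]
  ring

/-- The divergence form of the Laplacian. -/
theorem sum_pderiv_sqrt_det_mul_gradVec (hG : IsMetricOn G U) (hy : y ∈ U)
    {F : EuclideanSpace ℝ (Fin n) → ℝ} (hF : ContDiffOn ℝ ∞ F U) :
    ∑ i, pderiv i (fun z => Real.sqrt (G z).det * gradVec G F z i) y
      = Real.sqrt (G y).det * ∑ i, ∑ j, (G y)⁻¹ i j * hessCoord G F i j y := by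
  have hd : ∀ {F : EuclideanSpace ℝ (Fin n) → ℝ}, ContDiffOn ℝ ∞ F U → DifferentiableAt ℝ F y :=
    fun h => differentiableAt_of_contDiffOn hG.isOpen h hy
  have hs : ∀ k l, (G y)⁻¹ k l = (G y)⁻¹ l k := fun k l =>
    congrFun (congrFun (hG.isSymm_inv hy) l) k
  set f := gradVec G F y with hf
  set dG : Fin n → Matrix (Fin n) (Fin n) ℝ := fun k =>
    Matrix.of fun i j => pderiv k (fun z => G z i j) y with hdG
  have hdGs : ∀ k i j, dG k i j = dG k j i := fun k i j => hG.pderiv_symm hy k i j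
  -- By Jacobi's formula the logarithmic derivative of √det G is half the trace of G⁻¹∂_iG.
  have h1 : ∀ i, pderiv i (fun z => Real.sqrt (G z).det) y
      = Real.sqrt (G y).det * (1 / 2 * ∑ a, ∑ b, (G y)⁻¹ a b * dG i b a) := by
    intro i
    refine eq_pderiv_of_hasDerivAt_line (hd hG.contDiffOn_sqrt_det) ?_
    have h := (hasDerivAt_det (s := 0) (A := fun s => G (y + s • EuclideanSpace.single i (1 : ℝ)))
      (A' := dG i) (fun a b => hasDerivAt_line (hd (hG.smooth a b)) i)
      (by simpa using hG.det_ne hy)).sqrt (by simpa using hG.det_ne hy)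
    refine h.congr_deriv ?_
    simp only [zero_smul, add_zero, Matrix.trace, Matrix.diag_apply, Matrix.mul_apply]
    have hp := hG.det_pos hy
    have h0 : Real.sqrt (G y).det ≠ 0 := (Real.sqrt_pos.2 hp).ne'
    field_simp
    rw [Real.sq_sqrt hp.le, mul_comm]
  have h2 : ∀ i, pderiv i (fun z => gradVec G F z i) y
      = ∑ j, (G y)⁻¹ i j * (pderiv i (pderiv j F) y - ∑ l, dG i j l * f l) := by
    intro i
    refine eq_pderiv_of_hasDerivAt_line (hd (hG.contDiffOn_gradVec hF i)) ?_
    have h := hasDerivAt_inv_mulVec (s := 0)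
      (A := fun s => G (y + s • EuclideanSpace.single i (1 : ℝ))) (A' := dG i)
      (β := fun s => dvec F (y + s • EuclideanSpace.single i (1 : ℝ)))
      (β' := fun j => pderiv i (pderiv j F) y)
      (fun a b => hasDerivAt_line (hd (hG.smooth a b)) i) (by simpa using hG.det_ne hy)
      (fun j => hasDerivAt_line (hd (contDiffOn_pderiv hG.isOpen hF j)) i) i
    refine h.congr_deriv ?_
    simp only [zero_smul, add_zero]
    rfl
  have h3 : ∀ i, pderiv i (fun z => Real.sqrt (G z).det * gradVec G F z i) y
      = Real.sqrt (G y).det * (∑ j, (G y)⁻¹ i j * (pderiv i (pderiv j F) y - ∑ l, dG i j l * f l)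
        + f i * (1 / 2 * ∑ a, ∑ b, (G y)⁻¹ a b * dG i b a)) := by
    intro i
    rw [pderiv_mul (hd hG.contDiffOn_sqrt_det) (hd (hG.contDiffOn_gradVec hF i)), h1, h2]
    ring
  simp only [h3, ← Finset.mul_sum, hessCoord, hG.sum_christoffel hy]
  congr 1
  rw [Finset.sum_add_distrib]
  -- Both sides, divided by √det G, equal T1 - T2 + T3/2. On the left -T2 comes from differentiating
  -- G⁻¹ and T3/2 from the density; on the right both come from the Christoffel symbols.
  set T1 : ℝ := ∑ i, ∑ j, (G y)⁻¹ i j * pderiv i (pderiv j F) y with hT1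
  set T2 : ℝ := ∑ i, ∑ j, ∑ l, (G y)⁻¹ i j * dG i j l * f l with hT2
  set T3 : ℝ := ∑ i, ∑ j, ∑ l, (G y)⁻¹ i j * dG l i j * f l with hT3
  have e1 : ∑ i, ∑ j, (G y)⁻¹ i j * (pderiv i (pderiv j F) y - ∑ l, dG i j l * f l) = T1 - T2 := by
    simp only [hT1, hT2, ← Finset.sum_sub_distrib]
    refine Finset.sum_congr rfl fun i _ => Finset.sum_congr rfl fun j _ => ?_
    rw [mul_sub, Finset.mul_sum]
    congr 1
    exact Finset.sum_congr rfl fun l _ => by ring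
  have e2 : ∑ i, f i * (1 / 2 * ∑ a, ∑ b, (G y)⁻¹ a b * dG i b a) = 1 / 2 * T3 := by
    simp only [hT3, Finset.mul_sum]
    rw [Finset.sum_comm]
    refine Finset.sum_congr rfl fun i _ => ?_
    rw [Finset.sum_comm]
    refine Finset.sum_congr rfl fun j _ => Finset.sum_congr rfl fun l _ => ?_
    rw [hdGs]; ring
  have e3 : ∑ i, ∑ j, ∑ l, (G y)⁻¹ i j * dG j i l * f l = T2 := by
    rw [hT2, Finset.sum_comm]
    refine Finset.sum_congr rfl fun i _ => Finset.sum_congr rfl fun j _ => ?_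
    exact Finset.sum_congr rfl fun l _ => by rw [hs]
  have e4 : ∑ i, ∑ j, (G y)⁻¹ i j * (pderiv i (pderiv j F) y - 1 / 2 * ∑ l, f l *
      (pderiv i (fun z => G z j l) y + pderiv j (fun z => G z i l) y
        - pderiv l (fun z => G z i j) y)) = T1 - 1 / 2 * (T2 + T2 - T3) := by
    conv_rhs => arg 2; arg 2; arg 1; arg 2; rw [← e3]
    simp only [hT1, hT2, hT3, mul_sub, mul_add, Finset.mul_sum, ← Finset.sum_add_distrib,
      ← Finset.sum_sub_distrib]
    refine Finset.sum_congr rfl fun i _ => Finset.sum_congr rfl fun j _ => ?_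
    congr 1
    exact Finset.sum_congr rfl fun l _ => by simp only [hdG, Matrix.of_apply]; ring
  rw [e1, e2, e4]
  ring

end IsMetricOn

end CoordinateCalculus

/-! ### Isometric changes of coordinates -/

section CoordinateChange

open Matrix

variable {n : ℕ}

/-- The Jacobian matrix of a map. -/
def jacobian (τ : EuclideanSpace ℝ (Fin n) → EuclideanSpace ℝ (Fin n))
    (y : EuclideanSpace ℝ (Fin n)) : Matrix (Fin n) (Fin n) ℝ :=
  Matrix.of fun k i => fderiv ℝ τ y (EuclideanSpace.single i 1) k

theorem fderiv_apply_eq_jacobian_mulVec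
    (τ : EuclideanSpace ℝ (Fin n) → EuclideanSpace ℝ (Fin n)) (y v : EuclideanSpace ℝ (Fin n))
    (k : Fin n) : fderiv ℝ τ y v k = (jacobian τ y *ᵥ v.ofLp) k := by
  have hv : v = ∑ i, v i • EuclideanSpace.single i (1 : ℝ) := by
    ext j
    simp [Finset.sum_apply, Pi.single_apply]
  conv_lhs => rw [hv]
  simp only [map_sum, map_smul, jacobian, mulVec, dotProduct, Matrix.of_apply]
  simp [Finset.sum_apply, mul_comm]

/-- Linear functions realize every covector. -/
theorem exists_dvec_eq (β : Fin n → ℝ) :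
    ∃ A : EuclideanSpace ℝ (Fin n) → ℝ, ContDiff ℝ ∞ A ∧ ∀ y, dvec A y = β := by
  let L : EuclideanSpace ℝ (Fin n) →L[ℝ] ℝ := ∑ i, β i • EuclideanSpace.proj i
  refine ⟨L, L.contDiff, fun y => funext fun i => ?_⟩
  simp [dvec, pderiv, L]

variable {G G' : EuclideanSpace ℝ (Fin n) → Matrix (Fin n) (Fin n) ℝ}
  {V V' : Set (EuclideanSpace ℝ (Fin n))}
  {τ : EuclideanSpace ℝ (Fin n) → EuclideanSpace ℝ (Fin n)} {y : EuclideanSpace ℝ (Fin n)}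

/-- `τ` is a smooth local isometry from `(V, G)` to `(V', G')`. -/
structure IsIsometryOn (G G' : EuclideanSpace ℝ (Fin n) → Matrix (Fin n) (Fin n) ℝ)
    (V V' : Set (EuclideanSpace ℝ (Fin n)))
    (τ : EuclideanSpace ℝ (Fin n) → EuclideanSpace ℝ (Fin n)) : Prop where
  metric : IsMetricOn G V
  metric' : IsMetricOn G' V'
  smooth : ContDiffOn ℝ ∞ τ V
  mapsTo : Set.MapsTo τ V V'
  isUnit : ∀ z ∈ V, IsUnit (jacobian τ z).det
  pullback : ∀ z ∈ V, G z = (jacobian τ z)ᵀ * G' (τ z) * jacobian τ z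

theorem dvec_comp {F : EuclideanSpace ℝ (Fin n) → ℝ} (hF : DifferentiableAt ℝ F (τ y))
    (hτ : DifferentiableAt ℝ τ y) : dvec (F ∘ τ) y = (jacobian τ y)ᵀ *ᵥ dvec F (τ y) := by
  funext i
  have h : fderiv ℝ (F ∘ τ) y = (fderiv ℝ F (τ y)).comp (fderiv ℝ τ y) := fderiv_comp y hF hτ
  simp only [dvec, pderiv, h, ContinuousLinearMap.comp_apply, mulVec, dotProduct, transpose_apply]
  have hv : ∀ v : EuclideanSpace ℝ (Fin n), v = ∑ i, v i • EuclideanSpace.single i (1 : ℝ) := by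
    intro v
    ext j
    simp [Finset.sum_apply, Pi.single_apply]
  conv_lhs => rw [hv (fderiv ℝ τ y (EuclideanSpace.single i 1))]
  simp [map_sum, jacobian]

/-- The contraction is the trace of A⁻¹Bᵀ, and the congruence by J conjugates this matrix by J. This
gives the invariance of the Laplacian. -/
theorem sum_inv_mul_of_congruence {A B J : Matrix (Fin n) (Fin n) ℝ} (hJ : IsUnit J.det) :
    ∑ i, ∑ j, (Jᵀ * A * J)⁻¹ i j * (Jᵀ * B * J) i j = ∑ i, ∑ j, A⁻¹ i j * B i j := by
  have h : ∀ X Y : Matrix (Fin n) (Fin n) ℝ, ∑ i, ∑ j, X i j * Y i j = (X * Yᵀ).trace := by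
    intro X Y
    simp [Matrix.trace, Matrix.mul_apply]
  have hJt : IsUnit (Jᵀ).det := by rwa [Matrix.det_transpose]
  rw [h, h, Matrix.mul_inv_rev, Matrix.mul_inv_rev, Matrix.transpose_mul, Matrix.transpose_mul,
    Matrix.transpose_transpose]
  have : J⁻¹ * (A⁻¹ * Jᵀ⁻¹) * (Jᵀ * (Bᵀ * J)) = J⁻¹ * (A⁻¹ * Bᵀ * J) := by
    rw [Matrix.mul_assoc, Matrix.mul_assoc A⁻¹, ← Matrix.mul_assoc Jᵀ⁻¹ Jᵀ,
      Matrix.nonsing_inv_mul _ hJt, Matrix.one_mul, Matrix.mul_assoc A⁻¹]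
  rw [this, Matrix.trace_mul_comm, Matrix.mul_assoc, Matrix.mul_nonsing_inv _ hJ, Matrix.mul_one]

namespace IsIsometryOn

/-- The differential contributes Jᵀ and the pulled back metric has inverse J⁻¹G'⁻¹(Jᵀ)⁻¹, so
applying J leaves G'⁻¹dF. -/
theorem gradVec_comp (h : IsIsometryOn G G' V V' τ) (hy : y ∈ V)
    {F : EuclideanSpace ℝ (Fin n) → ℝ} (hF : ContDiffOn ℝ ∞ F V') :
    jacobian τ y *ᵥ gradVec G (F ∘ τ) y = gradVec G' F (τ y) := by
  have hJt : IsUnit ((jacobian τ y)ᵀ).det := by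
    rw [Matrix.det_transpose]; exact h.isUnit y hy
  rw [gradVec, gradVec, dvec_comp
    (differentiableAt_of_contDiffOn h.metric'.isOpen hF (h.mapsTo hy))
    ((h.smooth.contDiffAt (h.metric.isOpen.mem_nhds hy)).differentiableAt (by simp)),
    h.pullback y hy, Matrix.mul_inv_rev, Matrix.mul_inv_rev, Matrix.mulVec_mulVec,
    Matrix.mulVec_mulVec, ← Matrix.mul_assoc, ← Matrix.mul_assoc,
    Matrix.mul_nonsing_inv _ (h.isUnit y hy), Matrix.one_mul, Matrix.mul_assoc,
    Matrix.nonsing_inv_mul _ hJt, Matrix.mul_one]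

theorem coGrad_comp (h : IsIsometryOn G G' V V' τ) (hy : y ∈ V)
    {A B : EuclideanSpace ℝ (Fin n) → ℝ} (hA : ContDiffOn ℝ ∞ A V') (hB : ContDiffOn ℝ ∞ B V') :
    coGrad G (A ∘ τ) (B ∘ τ) y = coGrad G' A B (τ y) := by
  change dvec (A ∘ τ) y ⬝ᵥ gradVec G (B ∘ τ) y = dvec A (τ y) ⬝ᵥ gradVec G' B (τ y)
  rw [← h.gradVec_comp hy hB, dvec_comp
    (differentiableAt_of_contDiffOn h.metric'.isOpen hA (h.mapsTo hy))
    ((h.smooth.contDiffAt (h.metric.isOpen.mem_nhds hy)).differentiableAt (by simp)),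
    Matrix.dotProduct_mulVec, Matrix.mulVec_transpose]

theorem coGrad_congr {A A' B B' : EuclideanSpace ℝ (Fin n) → ℝ} (hV : IsOpen V)
    (hA : Set.EqOn A A' V) (hB : Set.EqOn B B' V) (hy : y ∈ V) :
    coGrad G A B y = coGrad G A' B' y := by
  have h1 : dvec A y = dvec A' y := funext fun i => pderiv_congr_on hV hA i hy
  have h2 : dvec B y = dvec B' y := funext fun i => pderiv_congr_on hV hB i hy
  rw [coGrad, coGrad, h1, h2]

/-- On gradients the Hessian is a combination of iterated inner products of gradients, each of which
is invariant under isometries by `coGrad_comp`. At a given point every vector is the gradient of a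
linear function, so this determines the whole matrix. -/
theorem hessCoord_comp (h : IsIsometryOn G G' V V' τ) (hy : y ∈ V)
    {F : EuclideanSpace ℝ (Fin n) → ℝ} (hF : ContDiffOn ℝ ∞ F V') :
    (Matrix.of fun i j => hessCoord G (F ∘ τ) i j y)
      = (jacobian τ y)ᵀ * (Matrix.of fun i j => hessCoord G' F i j (τ y)) * jacobian τ y := by
  have hsm : ∀ {A : EuclideanSpace ℝ (Fin n) → ℝ}, ContDiffOn ℝ ∞ A V' →
      ContDiffOn ℝ ∞ (A ∘ τ) V := fun hA => hA.comp h.smooth h.mapsTo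
  have hform : ∀ (S : Matrix (Fin n) (Fin n) ℝ) (u w : Fin n → ℝ),
      ∑ i, ∑ j, S i j * u i * w j = u ⬝ᵥ (S *ᵥ w) := by
    intro S u w
    simp only [dotProduct, mulVec, Finset.mul_sum]
    exact Finset.sum_congr rfl fun i _ => Finset.sum_congr rfl fun j _ => by ring
  have key : ∀ u w : Fin n → ℝ,
      u ⬝ᵥ ((Matrix.of fun i j => hessCoord G (F ∘ τ) i j y) *ᵥ w)
        = (jacobian τ y *ᵥ u) ⬝ᵥ ((Matrix.of fun i j => hessCoord G' F i j (τ y)) *ᵥ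
          (jacobian τ y *ᵥ w)) := by
    intro u w
    have hdet' : IsUnit (G' (τ y)).det :=
      isUnit_iff_ne_zero.2 (h.metric'.det_ne (h.mapsTo hy))
    -- The covectors are those dual to Ju and Jw, so that A and B have gradients Ju and Jw at τ(y),
    -- and A∘τ and B∘τ have gradients u and w at y.
    obtain ⟨A, hA, hdA⟩ := exists_dvec_eq (G' (τ y) *ᵥ (jacobian τ y *ᵥ u))
    obtain ⟨B, hB, hdB⟩ := exists_dvec_eq (G' (τ y) *ᵥ (jacobian τ y *ᵥ w))
    have gA : gradVec G' A (τ y) = jacobian τ y *ᵥ u := by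
      rw [gradVec, hdA, Matrix.mulVec_mulVec, Matrix.nonsing_inv_mul _ hdet', Matrix.one_mulVec]
    have gB : gradVec G' B (τ y) = jacobian τ y *ᵥ w := by
      rw [gradVec, hdB, Matrix.mulVec_mulVec, Matrix.nonsing_inv_mul _ hdet', Matrix.one_mulVec]
    have hinj := Matrix.mulVec_injective_of_isUnit
      ((Matrix.isUnit_iff_isUnit_det _).2 (h.isUnit y hy))
    have gA' : gradVec G (A ∘ τ) y = u := hinj (by
      change jacobian τ y *ᵥ _ = jacobian τ y *ᵥ _
      rw [h.gradVec_comp hy hA.contDiffOn, gA])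
    have gB' : gradVec G (B ∘ τ) y = w := hinj (by
      change jacobian τ y *ᵥ _ = jacobian τ y *ᵥ _
      rw [h.gradVec_comp hy hB.contDiffOn, gB])
    have hA := hA.contDiffOn (s := V')
    have hB := hB.contDiffOn (s := V')
    have e1 := h.metric.two_mul_hessCoord_gradVec hy (hsm hF) (hsm hA) (hsm hB)
    have e2 := h.metric'.two_mul_hessCoord_gradVec (h.mapsTo hy) hF hA hB
    have e3 : ∀ {A B C : EuclideanSpace ℝ (Fin n) → ℝ}, ContDiffOn ℝ ∞ A V' →
        ContDiffOn ℝ ∞ B V' → ContDiffOn ℝ ∞ C V' →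
        coGrad G (A ∘ τ) (coGrad G (B ∘ τ) (C ∘ τ)) y = coGrad G' A (coGrad G' B C) (τ y) := by
      intro A B C hA hB hC
      rw [← h.coGrad_comp hy hA (h.metric'.contDiffOn_coGrad hB hC)]
      exact coGrad_congr h.metric.isOpen (fun _ _ => rfl) (fun z hz => h.coGrad_comp hz hB hC) hy
    rw [e3 hA hF hB, e3 hB hF hA, e3 hF hA hB, ← e2, gA, gB, gA', gB'] at e1
    have e4 := mul_left_cancel₀ (two_ne_zero) e1
    rw [← hform, ← hform]
    exact e4
  refine Matrix.ext_of_single_vecMul ?_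
  intro i
  refine dotProduct_eq _ _ fun w => ?_
  rw [← Matrix.dotProduct_mulVec, ← Matrix.dotProduct_mulVec, key, ← Matrix.mulVec_mulVec,
    ← Matrix.mulVec_mulVec, Matrix.dotProduct_mulVec _ (jacobian τ y)ᵀ, Matrix.vecMul_transpose]

theorem sum_inv_mul_hessCoord_comp (h : IsIsometryOn G G' V V' τ) (hy : y ∈ V)
    {F : EuclideanSpace ℝ (Fin n) → ℝ} (hF : ContDiffOn ℝ ∞ F V') :
    ∑ i, ∑ j, (G y)⁻¹ i j * hessCoord G (F ∘ τ) i j y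
      = ∑ i, ∑ j, (G' (τ y))⁻¹ i j * hessCoord G' F i j (τ y) := by
  have h1 := h.hessCoord_comp hy hF
  have h2 : ∀ i j, hessCoord G (F ∘ τ) i j y = ((jacobian τ y)ᵀ *
      (Matrix.of fun i j => hessCoord G' F i j (τ y)) * jacobian τ y) i j :=
    fun i j => congrFun (congrFun h1 i) j
  simp only [h2]
  rw [h.pullback y hy, sum_inv_mul_of_congruence (h.isUnit y hy)]
  rfl

end IsIsometryOn

end CoordinateChange

/-! ### Changes of charts -/

section Charts

set_option linter.unusedSectionVars false

open Matrix

variable {n : ℕ} {M : Type*} [TopologicalSpace M] [ChartedSpace (EuclideanSpace ℝ (Fin n)) M]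

/-- The change of coordinates from the chart around `c` to the chart around `c'`. -/
def transition (c c' : M) : EuclideanSpace ℝ (Fin n) → EuclideanSpace ℝ (Fin n) :=
  extChartAt (𝓡 n) c' ∘ (extChartAt (𝓡 n) c).symm

/-- The domain of `transition c c'`. -/
def overlap (c c' : M) : Set (EuclideanSpace ℝ (Fin n)) :=
  (extChartAt (𝓡 n) c).target ∩ (extChartAt (𝓡 n) c).symm ⁻¹' (extChartAt (𝓡 n) c').source

theorem isOpen_overlap (c c' : M) : IsOpen (overlap (n := n) c c') :=
  (continuousOn_extChartAt_symm c).isOpen_inter_preimage (isOpen_extChartAt_target c)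
    (isOpen_extChartAt_source c')

theorem overlap_subset (c c' : M) : overlap (n := n) c c' ⊆ (extChartAt (𝓡 n) c).target :=
  Set.inter_subset_left

variable {c c' c'' : M} {y : EuclideanSpace ℝ (Fin n)}

theorem symm_transition (hy : y ∈ overlap c c') :
    (extChartAt (𝓡 n) c').symm (transition c c' y) = (extChartAt (𝓡 n) c).symm y :=
  (extChartAt (𝓡 n) c').left_inv hy.2

theorem transition_mem_overlap (hy : y ∈ overlap c c') : transition c c' y ∈ overlap c' c := by
  refine ⟨(extChartAt (𝓡 n) c').map_source hy.2, ?_⟩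
  rw [Set.mem_preimage, symm_transition hy]
  exact (extChartAt (𝓡 n) c).map_target hy.1

theorem transition_transition (hy : y ∈ overlap c c') :
    transition c' c (transition c c' y) = y := by
  rw [transition, Function.comp_apply, symm_transition hy]
  exact (extChartAt (𝓡 n) c).right_inv hy.1

theorem transition_comp (hy : y ∈ overlap c c') :
    transition c' c'' (transition c c' y) = transition c c'' y := by
  rw [transition, Function.comp_apply, symm_transition hy]
  rfl

theorem extChartAt_mem_overlap {x : M} (hx : x ∈ (extChartAt (𝓡 n) c).source)
    (hx' : x ∈ (extChartAt (𝓡 n) c').source) : extChartAt (𝓡 n) c x ∈ overlap c c' := by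
  refine ⟨(extChartAt (𝓡 n) c).map_source hx, ?_⟩
  rw [Set.mem_preimage, (extChartAt (𝓡 n) c).left_inv hx]
  exact hx'

theorem transition_extChartAt {x : M} (hx : x ∈ (extChartAt (𝓡 n) c).source) :
    transition c c' (extChartAt (𝓡 n) c x) = extChartAt (𝓡 n) c' x := by
  rw [transition, Function.comp_apply, (extChartAt (𝓡 n) c).left_inv hx]

theorem inChart_eq_comp_transition (u : M → ℝ) :
    Set.EqOn (inChart u c) (inChart u c' ∘ transition c c') (overlap (n := n) c c') := by
  intro z hz
  simp only [inChart, Function.comp_apply]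
  rw [symm_transition hz]

variable [IsManifold (𝓡 n) ∞ M]

theorem contDiffOn_transition (c c' : M) :
    ContDiffOn ℝ ∞ (transition (n := n) c c') (overlap c c') := by
  have h := contDiffOn_ext_coord_change (I := 𝓡 n) (n := ∞) c' c
  rw [PartialEquiv.trans_source, PartialEquiv.symm_source] at h
  exact h

theorem differentiableAt_transition (hy : y ∈ overlap c c') :
    DifferentiableAt ℝ (transition c c') y :=
  ((contDiffOn_transition c c').contDiffAt ((isOpen_overlap c c').mem_nhds hy)).differentiableAt
    (by simp)

theorem jacobian_transition_comp (hy : y ∈ overlap c c') (hy'' : y ∈ overlap c c'') :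
    jacobian (transition c' c'') (transition c c' y) * jacobian (transition c c') y
      = jacobian (transition c c'') y := by
  have hy' : transition c c' y ∈ overlap c' c'' := by
    refine ⟨(transition_mem_overlap hy).1, ?_⟩
    rw [Set.mem_preimage, symm_transition hy]
    exact hy''.2
  have h1 : fderiv ℝ (transition c c'') y
      = (fderiv ℝ (transition c' c'') (transition c c' y)).comp (fderiv ℝ (transition c c') y) := by
    rw [← fderiv_comp y (differentiableAt_transition hy') (differentiableAt_transition hy)]
    refine Filter.EventuallyEq.fderiv_eq ?_
    filter_upwards [(isOpen_overlap c c').mem_nhds hy] with z hz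
    exact (transition_comp hz).symm
  ext k i
  rw [Matrix.mul_apply]
  conv_rhs => rw [jacobian, Matrix.of_apply, h1, ContinuousLinearMap.comp_apply,
    fderiv_apply_eq_jacobian_mulVec]
  rfl

theorem jacobian_transition_self (hy : y ∈ (extChartAt (𝓡 n) c).target) :
    jacobian (transition c c) y = 1 := by
  have h1 : fderiv ℝ (transition c c) y = ContinuousLinearMap.id ℝ _ := by
    rw [← fderiv_id (𝕜 := ℝ) (x := y)]
    refine Filter.EventuallyEq.fderiv_eq ?_
    filter_upwards [(isOpen_extChartAt_target c).mem_nhds hy] with z hz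
    exact (extChartAt (𝓡 n) c).right_inv hz
  ext k i
  simp [jacobian, h1, Matrix.one_apply]

/-- Going from c to c' and back is the identity near y, so the Jacobian has a left inverse. -/
theorem isUnit_det_jacobian_transition (hy : y ∈ overlap c c') :
    IsUnit (jacobian (transition c c') y).det := by
  have hself : y ∈ overlap c c := ⟨hy.1, (extChartAt (𝓡 n) c).map_target hy.1⟩
  have h := jacobian_transition_comp hy hself
  rw [jacobian_transition_self hy.1] at h
  have h2 := congrArg Matrix.det h
  rw [Matrix.det_mul, Matrix.det_one] at h2
  exact IsUnit.of_mul_eq_one_right _ h2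

/-- The metric at `x` as a bilinear form on the model space. -/
def bform (g : SmoothMetric n M) (x : M) :
    EuclideanSpace ℝ (Fin n) →L[ℝ] EuclideanSpace ℝ (Fin n) →L[ℝ] ℝ := g.inner x

/-- The coordinate vector field `∂_i` as a vector of the model space. -/
def modelVec (c : M) (i : Fin n) (y : EuclideanSpace ℝ (Fin n)) : EuclideanSpace ℝ (Fin n) :=
  coordVec c i y

/-- The tangent space at a point is the model space by means of the preferred chart around that
point. The manifold derivative of the inverse chart is therefore the ordinary derivative of the
change to a chart that itself depends on y. -/
theorem modelVec_eq (hy : y ∈ (extChartAt (𝓡 n) c).target) (i : Fin n) :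
    modelVec c i y
      = fderiv ℝ (transition c ((extChartAt (𝓡 n) c).symm y)) y (EuclideanSpace.single i 1) := by
  have hd : MDifferentiableAt 𝓘(ℝ, EuclideanSpace ℝ (Fin n)) (𝓡 n) (extChartAt (𝓡 n) c).symm y :=
    (((contMDiffOn_extChartAt_symm (n := ∞) c) y hy).contMDiffAt
      ((isOpen_extChartAt_target c).mem_nhds hy)).mdifferentiableAt (by simp)
  have h1 : mfderiv 𝓘(ℝ, EuclideanSpace ℝ (Fin n)) (𝓡 n) (extChartAt (𝓡 n) c).symm y
      = fderivWithin ℝ (transition c ((extChartAt (𝓡 n) c).symm y)) Set.univ y := by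
    simp only [mfderiv, writtenInExtChartAt, extChartAt_model_space_eq_id,
      PartialEquiv.refl_coe, PartialEquiv.refl_symm, modelWithCornersSelf_coe, Set.range_id]
    exact if_pos hd
  rw [fderivWithin_univ] at h1
  exact DFunLike.congr_fun h1 (EuclideanSpace.single i (1 : ℝ) : EuclideanSpace ℝ (Fin n))

theorem modelVec_apply (hy : y ∈ (extChartAt (𝓡 n) c).target) (i k : Fin n) :
    modelVec c i y k = jacobian (transition c ((extChartAt (𝓡 n) c).symm y)) y k i := by
  rw [modelVec_eq hy]
  rfl

theorem bform_eq_sum (g : SmoothMetric n M) (x : M) (u w : EuclideanSpace ℝ (Fin n)) :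
    bform g x u w = ∑ k, ∑ l, u k * bform g x (EuclideanSpace.single k 1)
      (EuclideanSpace.single l 1) * w l := by
  have hv : ∀ v : EuclideanSpace ℝ (Fin n), v = ∑ i, v i • EuclideanSpace.single i (1 : ℝ) := by
    intro v
    ext j
    simp [Finset.sum_apply, Pi.single_apply]
  conv_lhs => rw [hv u, hv w]
  simp only [map_sum, map_smul, FunLike.coe_sum, Finset.sum_apply,
    FunLike.coe_smul, Pi.smul_apply, smul_eq_mul, Finset.mul_sum]
  rw [Finset.sum_comm]
  exact Finset.sum_congr rfl fun k _ => Finset.sum_congr rfl fun l _ => by ring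

/-- The matrix of the metric at `x` in the standard basis of the model space. -/
def baseMatrix (g : SmoothMetric n M) (x : M) : Matrix (Fin n) (Fin n) ℝ :=
  Matrix.of fun k l => bform g x (EuclideanSpace.single k 1) (EuclideanSpace.single l 1)

/-- Since the preferred chart jumps from point to point, `baseMatrix` need not even be continuous in
x. It serves pointwise: positivity is read off from it, and eliminating it between two charts gives
`coeff_transition`. -/
theorem coeff_eq_base (g : SmoothMetric n M) (hy : y ∈ (extChartAt (𝓡 n) c).target) :
    coeff g c y = (jacobian (transition c ((extChartAt (𝓡 n) c).symm y)) y)ᵀ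
      * baseMatrix g ((extChartAt (𝓡 n) c).symm y)
      * jacobian (transition c ((extChartAt (𝓡 n) c).symm y)) y := by
  ext i j
  change bform g _ (modelVec c i y) (modelVec c j y) = _
  rw [bform_eq_sum]
  simp only [modelVec_apply hy, Matrix.mul_apply, Matrix.transpose_apply, Finset.sum_mul,
    baseMatrix, Matrix.of_apply]
  rw [Finset.sum_comm]

theorem coeff_self (g : SmoothMetric n M) (x : M) :
    coeff g x (extChartAt (𝓡 n) x x) = baseMatrix g x := by
  have hx : extChartAt (𝓡 n) x x ∈ (extChartAt (𝓡 n) x).target := mem_extChartAt_target x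
  rw [coeff_eq_base g hx, extChartAt_to_inv, jacobian_transition_self hx]
  simp

theorem baseMatrix_posDef (g : SmoothMetric n M) (x : M) : (baseMatrix g x).PosDef := by
  refine Matrix.PosDef.of_dotProduct_mulVec_pos ?_ ?_
  · ext k l
    exact g.symm x (EuclideanSpace.single l 1 : EuclideanSpace ℝ (Fin n))
      (EuclideanSpace.single k 1 : EuclideanSpace ℝ (Fin n))
  · intro u hu
    have h0 : (WithLp.toLp 2 u : EuclideanSpace ℝ (Fin n)) ≠ 0 := by
      intro h
      exact hu (by simpa using congrArg WithLp.ofLp h)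
    have h := g.pos x (WithLp.toLp 2 u : EuclideanSpace ℝ (Fin n)) h0
    change 0 < bform g x (WithLp.toLp 2 u) (WithLp.toLp 2 u) at h
    rw [bform_eq_sum] at h
    refine lt_of_lt_of_eq h ?_
    simp only [dotProduct, mulVec, Finset.mul_sum, baseMatrix, Matrix.of_apply, star_trivial]
    exact Finset.sum_congr rfl fun k _ => Finset.sum_congr rfl fun l _ => by ring

theorem coeff_posDef (g : SmoothMetric n M) (hy : y ∈ (extChartAt (𝓡 n) c).target) :
    (coeff g c y).PosDef := by
  rw [coeff_eq_base g hy, ← Matrix.conjTranspose_eq_transpose_of_trivial]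
  refine (baseMatrix_posDef g _).conjTranspose_mul_mul_same ?_
  refine Matrix.mulVec_injective_of_isUnit ((Matrix.isUnit_iff_isUnit_det _).2
    (isUnit_det_jacobian_transition ⟨hy, ?_⟩))
  exact mem_extChartAt_source _

theorem coeff_transition (g : SmoothMetric n M) (hy : y ∈ overlap c c') :
    coeff g c y = (jacobian (transition c c') y)ᵀ * coeff g c' (transition c c' y)
      * jacobian (transition c c') y := by
  have hy' := transition_mem_overlap hy
  rw [coeff_eq_base g hy.1, coeff_eq_base g hy'.1, symm_transition hy,
    ← jacobian_transition_comp (c'' := (extChartAt (𝓡 n) c).symm y) hy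
      ⟨hy.1, mem_extChartAt_source _⟩, Matrix.transpose_mul]
  simp only [Matrix.mul_assoc]

/-- The coefficients of the metric are smooth in every chart. -/
def HasSmoothCoeff (g : SmoothMetric n M) : Prop :=
  ∀ (c : M) (i j : Fin n), ContDiffOn ℝ ∞ (fun z => coeff g c z i j) (extChartAt (𝓡 n) c).target

/-- The function `u` is smooth in every chart. -/
def ChartSmooth (n : ℕ) {M : Type*} [TopologicalSpace M]
    [ChartedSpace (EuclideanSpace ℝ (Fin n)) M] (u : M → ℝ) : Prop :=
  ∀ c : M, ContDiffOn ℝ ∞ (inChart u c) (extChartAt (𝓡 n) c).target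

/-- The inner product of the gradients of two functions. -/
def gradInner (g : SmoothMetric n M) (u w : M → ℝ) (x : M) : ℝ :=
  coGrad (coeff g x) (inChart u x) (inChart w x) (extChartAt (𝓡 n) x x)

theorem gradSq_eq_gradInner (g : SmoothMetric n M) (u : M → ℝ) :
    gradSq g u = gradInner g u u := by
  funext x
  simp only [gradSq, gradInner, coGrad, dotProduct, mulVec, dvec, invCoeffAt, Finset.mul_sum]
  exact Finset.sum_congr rfl fun i _ => Finset.sum_congr rfl fun j _ => by ring

variable {g : SmoothMetric n M} {u w : M → ℝ}

theorem HasSmoothCoeff.isMetricOn (hg : HasSmoothCoeff g) (c : M) :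
    IsMetricOn (coeff g c) (extChartAt (𝓡 n) c).target :=
  ⟨isOpen_extChartAt_target c, hg c, fun _ hz => coeff_posDef g hz⟩

theorem HasSmoothCoeff.isIsometryOn (hg : HasSmoothCoeff g) (c c' : M) :
    IsIsometryOn (coeff g c) (coeff g c') (overlap c c') (extChartAt (𝓡 n) c').target
      (transition c c') where
  metric := (hg.isMetricOn c).mono (isOpen_overlap c c') (overlap_subset c c')
  metric' := hg.isMetricOn c'
  smooth := contDiffOn_transition c c'
  mapsTo := fun _ hz => (transition_mem_overlap hz).1
  isUnit := fun _ hz => isUnit_det_jacobian_transition hz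
  pullback := fun _ hz => coeff_transition g hz

/-- `gradInner` uses a different chart at each point. Computing it in one fixed chart is what makes
smoothness and integration accessible. -/
theorem HasSmoothCoeff.gradInner_eq (hg : HasSmoothCoeff g) (hu : ChartSmooth n u)
    (hw : ChartSmooth n w) {x : M} (hx : x ∈ (extChartAt (𝓡 n) c).source) :
    gradInner g u w x = coGrad (coeff g c) (inChart u c) (inChart w c) (extChartAt (𝓡 n) c x) := by
  have hxx := mem_extChartAt_source (I := 𝓡 n) x
  have ho := extChartAt_mem_overlap hxx hx
  rw [← transition_extChartAt (c := x) hxx, ← (hg.isIsometryOn x c).coGrad_comp ho (hu c) (hw c)]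
  exact IsIsometryOn.coGrad_congr (isOpen_overlap x c) (inChart_eq_comp_transition u)
    (inChart_eq_comp_transition w) ho

theorem HasSmoothCoeff.inChart_gradInner (hg : HasSmoothCoeff g) (hu : ChartSmooth n u)
    (hw : ChartSmooth n w) (c : M) :
    Set.EqOn (inChart (gradInner g u w) c) (coGrad (coeff g c) (inChart u c) (inChart w c))
      (extChartAt (𝓡 n) c).target := by
  intro z hz
  rw [inChart, hg.gradInner_eq hu hw ((extChartAt (𝓡 n) c).map_target hz),
    (extChartAt (𝓡 n) c).right_inv hz]

theorem HasSmoothCoeff.chartSmooth_gradInner (hg : HasSmoothCoeff g) (hu : ChartSmooth n u)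
    (hw : ChartSmooth n w) : ChartSmooth n (gradInner g u w) := fun c =>
  ((hg.isMetricOn c).contDiffOn_coGrad (hu c) (hw c)).congr (hg.inChart_gradInner hu hw c)

/-- The Laplacian in coordinates. -/
def coLap (G : EuclideanSpace ℝ (Fin n) → Matrix (Fin n) (Fin n) ℝ)
    (F : EuclideanSpace ℝ (Fin n) → ℝ) (y : EuclideanSpace ℝ (Fin n)) : ℝ :=
  ∑ i, ∑ j, (G y)⁻¹ i j * hessCoord G F i j y

theorem hessCoord_congr {G : EuclideanSpace ℝ (Fin n) → Matrix (Fin n) (Fin n) ℝ}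
    {F F' : EuclideanSpace ℝ (Fin n) → ℝ} {U : Set (EuclideanSpace ℝ (Fin n))} (hU : IsOpen U)
    (h : Set.EqOn F F' U) (hy : y ∈ U) (i j : Fin n) :
    hessCoord G F i j y = hessCoord G F' i j y := by
  rw [hessCoord, hessCoord, pderiv_congr_on hU (pderiv_congr_on hU h j) i hy]
  simp only [pderiv_congr_on hU h _ hy]

theorem HasSmoothCoeff.laplacian_eq (hg : HasSmoothCoeff g) (hu : ChartSmooth n u)
    {x : M} (hx : x ∈ (extChartAt (𝓡 n) c).source) :
    laplacian g u x = coLap (coeff g c) (inChart u c) (extChartAt (𝓡 n) c x) := by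
  have hxx := mem_extChartAt_source (I := 𝓡 n) x
  have ho := extChartAt_mem_overlap hxx hx
  rw [← transition_extChartAt (c := x) hxx, coLap,
    ← (hg.isIsometryOn x c).sum_inv_mul_hessCoord_comp ho (hu c)]
  simp only [laplacian, invCoeffAt, hessAt, Matrix.of_apply]
  simp only [hessCoord_congr (isOpen_overlap x c) (inChart_eq_comp_transition u) ho]

theorem HasSmoothCoeff.inChart_laplacian (hg : HasSmoothCoeff g) (hu : ChartSmooth n u) (c : M) :
    Set.EqOn (inChart (laplacian g u) c) (coLap (coeff g c) (inChart u c))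
      (extChartAt (𝓡 n) c).target := by
  intro z hz
  rw [inChart, hg.laplacian_eq hu ((extChartAt (𝓡 n) c).map_target hz),
    (extChartAt (𝓡 n) c).right_inv hz]

theorem IsMetricOn.contDiffOn_coLap {G : EuclideanSpace ℝ (Fin n) → Matrix (Fin n) (Fin n) ℝ}
    {F : EuclideanSpace ℝ (Fin n) → ℝ} {U : Set (EuclideanSpace ℝ (Fin n))}
    (hG : IsMetricOn G U) (hF : ContDiffOn ℝ ∞ F U) : ContDiffOn ℝ ∞ (coLap G F) U := by
  have h1 := fun i j k => contDiffOn_pderiv hG.isOpen (hG.smooth i j) k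
  have h2 := fun i => contDiffOn_pderiv hG.isOpen hF i
  refine ContDiffOn.sum fun i _ => ContDiffOn.sum fun j _ => (hG.contDiffOn_inv i j).mul ?_
  refine (contDiffOn_pderiv hG.isOpen (h2 j) i).sub (ContDiffOn.sum fun k _ => ?_)
  refine ContDiffOn.mul (contDiffOn_const.mul (ContDiffOn.sum fun l _ => ?_)) (h2 k)
  exact (hG.contDiffOn_inv k l).mul (((h1 j l i).add (h1 i l j)).sub (h1 i j l))

theorem HasSmoothCoeff.chartSmooth_laplacian (hg : HasSmoothCoeff g) (hu : ChartSmooth n u) :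
    ChartSmooth n (laplacian g u) := fun c =>
  ((hg.isMetricOn c).contDiffOn_coLap (hu c)).congr (hg.inChart_laplacian hu c)

theorem chartSmooth_const (a : ℝ) : ChartSmooth n (fun _ : M => a) := fun _ => contDiffOn_const

theorem ChartSmooth.mul (hu : ChartSmooth n u) (hw : ChartSmooth n w) :
    ChartSmooth n (fun x => u x * w x) := fun c => (hu c).mul (hw c)

theorem ChartSmooth.add (hu : ChartSmooth n u) (hw : ChartSmooth n w) :
    ChartSmooth n (fun x => u x + w x) := fun c => (hu c).add (hw c)

theorem ChartSmooth.sub (hu : ChartSmooth n u) (hw : ChartSmooth n w) :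
    ChartSmooth n (fun x => u x - w x) := fun c => (hu c).sub (hw c)

theorem ChartSmooth.continuous (hu : ChartSmooth n u) : Continuous u := by
  rw [continuous_iff_continuousAt]
  intro x
  have h1 : ContinuousAt (inChart u x) (extChartAt (𝓡 n) x x) :=
    (hu x).continuousOn.continuousAt (extChartAt_target_mem_nhds x)
  have h2 : ContinuousAt (inChart u x ∘ extChartAt (𝓡 n) x) x :=
    ContinuousAt.comp h1 (continuousAt_extChartAt x)
  refine h2.congr ?_
  filter_upwards [extChartAt_source_mem_nhds (I := 𝓡 n) x] with z hz
  simp only [inChart, Function.comp_apply, (extChartAt (𝓡 n) x).left_inv hz]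

theorem chartSmooth_of_contMDiff (hu : ContMDiff (𝓡 n) 𝓘(ℝ, ℝ) ∞ u) : ChartSmooth n u := by
  intro c
  have h := hu.comp_contMDiffOn (contMDiffOn_extChartAt_symm (n := ∞) c)
  exact contMDiffOn_iff_contDiffOn.1 h

theorem HasSmoothCoeff.gradInner_comm (hg : HasSmoothCoeff g) (u w : M → ℝ) (x : M) :
    gradInner g u w x = gradInner g w u x :=
  (hg.isMetricOn x).coGrad_comm (mem_extChartAt_target x) _ _

theorem ChartSmooth.differentiableAt (hu : ChartSmooth n u) (x : M) :
    DifferentiableAt ℝ (inChart u x) (extChartAt (𝓡 n) x x) :=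
  differentiableAt_of_contDiffOn (isOpen_extChartAt_target x) (hu x) (mem_extChartAt_target x)

theorem gradInner_mul_left (g : SmoothMetric n M) {a b : M → ℝ} (ha : ChartSmooth n a)
    (hb : ChartSmooth n b) (w : M → ℝ) (x : M) :
    gradInner g (fun x => a x * b x) w x = a x * gradInner g b w x + b x * gradInner g a w x := by
  have h : dvec (inChart (fun x => a x * b x) x) (extChartAt (𝓡 n) x x)
      = a x • dvec (inChart b x) (extChartAt (𝓡 n) x x)
        + b x • dvec (inChart a x) (extChartAt (𝓡 n) x x) := by
    funext i
    have := pderiv_mul (ha.differentiableAt x) (hb.differentiableAt x) i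
    rw [show inChart a x (extChartAt (𝓡 n) x x) = a x by rw [inChart, extChartAt_to_inv],
      show inChart b x (extChartAt (𝓡 n) x x) = b x by rw [inChart, extChartAt_to_inv]] at this
    exact this
  rw [gradInner, coGrad, h, add_dotProduct, smul_dotProduct, smul_dotProduct]
  rfl

theorem gradInner_add_left (g : SmoothMetric n M) {a b : M → ℝ} (ha : ChartSmooth n a)
    (hb : ChartSmooth n b) (w : M → ℝ) (x : M) :
    gradInner g (fun x => a x + b x) w x = gradInner g a w x + gradInner g b w x := by
  have h : dvec (inChart (fun x => a x + b x) x) (extChartAt (𝓡 n) x x)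
      = dvec (inChart a x) (extChartAt (𝓡 n) x x)
        + dvec (inChart b x) (extChartAt (𝓡 n) x x) := by
    funext i
    exact pderiv_add (ha.differentiableAt x) (hb.differentiableAt x) i
  rw [gradInner, coGrad, h, add_dotProduct]
  rfl

theorem gradInner_const_left (g : SmoothMetric n M) (a : ℝ) (w : M → ℝ) (x : M) :
    gradInner g (fun _ => a) w x = 0 := by
  have h : dvec (inChart (fun _ : M => a) x) (extChartAt (𝓡 n) x x) = 0 := by
    funext i
    change fderiv ℝ (fun _ => a) _ _ = 0
    simp
  rw [gradInner, coGrad, h, zero_dotProduct]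

theorem gradInner_finsetSum_left (g : SmoothMetric n M) {ι : Type*} (s : Finset ι) {u : ι → M → ℝ}
    (hu : ∀ i, ChartSmooth n (u i)) (w : M → ℝ) (x : M) :
    ChartSmooth n (fun x => ∑ i ∈ s, u i x) ∧
      gradInner g (fun x => ∑ i ∈ s, u i x) w x = ∑ i ∈ s, gradInner g (u i) w x := by
  classical
  induction s using Finset.induction_on with
  | empty =>
    simp only [Finset.sum_empty]
    exact ⟨chartSmooth_const 0, gradInner_const_left g 0 w x⟩
  | insert i s hi ih =>
    simp only [Finset.sum_insert hi]
    exact ⟨(hu i).add ih.1, by rw [gradInner_add_left g (hu i) ih.1, ih.2]⟩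

/-- The components of the gradient in the chart around the point. -/
def gradAt (g : SmoothMetric n M) (u : M → ℝ) (x : M) : EuclideanSpace ℝ (Fin n) :=
  WithLp.toLp 2 (gradVec (coeff g x) (inChart u x) (extChartAt (𝓡 n) x x))

/-- `Hess f (∇v, ∇v) = ⟨∇v, ∇⟨∇f, ∇v⟩⟩ - ½ ⟨∇f, ∇|∇v|²⟩`. -/
theorem HasSmoothCoeff.two_mul_hess_grad (hg : HasSmoothCoeff g) {f v : M → ℝ}
    (hf : ChartSmooth n f) (hv : ChartSmooth n v) (x : M) :
    2 * Hess g f x (gradAt g v x) (gradAt g v x)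
      = 2 * gradInner g v (gradInner g f v) x - gradInner g f (gradInner g v v) x := by
  have hx := mem_extChartAt_target (I := 𝓡 n) x
  have h := (hg.isMetricOn x).two_mul_hessCoord_gradVec hx (hf x) (hv x) (hv x)
  have e : ∀ a b c : M → ℝ, ChartSmooth n b → ChartSmooth n c →
      coGrad (coeff g x) (inChart a x) (coGrad (coeff g x) (inChart b x) (inChart c x))
        (extChartAt (𝓡 n) x x) = gradInner g a (gradInner g b c) x := by
    intro a b c hb hc
    exact IsIsometryOn.coGrad_congr (isOpen_extChartAt_target x) (fun _ _ => rfl)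
      (fun z hz => (hg.inChart_gradInner hb hc x hz).symm) hx
  rw [e v f v hf hv, e f v v hv hv] at h
  rw [two_mul (gradInner g v (gradInner g f v) x), ← h]
  rfl

end Charts

/-! ### The Riemannian volume in charts -/

section Volume

set_option linter.unusedSectionVars false

open MeasureTheory Matrix

variable {n : ℕ} {M : Type*} [TopologicalSpace M] [ChartedSpace (EuclideanSpace ℝ (Fin n)) M]
  [IsManifold (𝓡 n) ∞ M]

theorem setLIntegral_eq_of_subset {α : Type*} [MeasurableSpace α] {μ : Measure α} {s t : Set α}
    (hs : MeasurableSet s) (ht : MeasurableSet t) (hts : t ⊆ s) {F : α → ENNReal}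
    (hF : ∀ x ∈ s, x ∉ t → F x = 0) : ∫⁻ x in s, F x ∂μ = ∫⁻ x in t, F x ∂μ := by
  have h1 : ∫⁻ x in s, F x ∂μ = ∫⁻ x in s, t.indicator F x ∂μ := by
    refine setLIntegral_congr_fun hs fun x hx => ?_
    by_cases hxt : x ∈ t
    · simp [hxt]
    · simp [hxt, hF x hx hxt]
  rw [h1, setLIntegral_indicator ht, Set.inter_eq_left.2 hts]

theorem det_fderiv_eq_det_jacobian (τ : EuclideanSpace ℝ (Fin n) → EuclideanSpace ℝ (Fin n))
    (y : EuclideanSpace ℝ (Fin n)) : (fderiv ℝ τ y).det = (jacobian τ y).det := by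
  rw [ContinuousLinearMap.det, ← LinearMap.det_toMatrix (EuclideanSpace.basisFun (Fin n) ℝ).toBasis]
  congr 1

variable {g : SmoothMetric n M} {c c' : M}

/-- The Riemannian volume does not depend on the chart. -/
theorem setLIntegral_overlap (g : SmoothMetric n M) (c c' : M) (F : M → ENNReal) :
    ∫⁻ y in overlap (n := n) c' c, ENNReal.ofReal (Real.sqrt (coeff g c' y).det)
        * F ((extChartAt (𝓡 n) c').symm y)
      = ∫⁻ z in overlap (n := n) c c', ENNReal.ofReal (Real.sqrt (coeff g c z).det)
        * F ((extChartAt (𝓡 n) c).symm z) := by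
  have himg : transition c' c '' overlap (n := n) c' c = overlap c c' := by
    refine Set.Subset.antisymm ?_ ?_
    · rintro _ ⟨y, hy, rfl⟩
      exact transition_mem_overlap hy
    · intro z hz
      exact ⟨transition c c' z, transition_mem_overlap hz, transition_transition hz⟩
  have hinj : Set.InjOn (transition (n := n) c' c) (overlap c' c) := by
    intro y hy z hz h
    rw [← transition_transition hy, h, transition_transition hz]
  have hmeas : MeasurableSet (overlap (n := n) c' c) := (isOpen_overlap c' c).measurableSet
  rw [← himg, lintegral_image_eq_lintegral_abs_det_fderiv_mul volume hmeas
    (fun y hy => (differentiableAt_transition hy).hasFDerivAt.hasFDerivWithinAt) hinj]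
  refine setLIntegral_congr_fun hmeas fun y hy => ?_
  rw [symm_transition hy, ← mul_assoc, ← ENNReal.ofReal_mul (abs_nonneg _),
    det_fderiv_eq_det_jacobian]
  congr 2
  -- The determinant of the metric scales by (det J)², and its square root by the factor |det J| of
  -- the change of variables.
  rw [coeff_transition g hy, Matrix.det_mul, Matrix.det_mul, Matrix.det_transpose,
    show (jacobian (transition c' c) y).det * (coeff g c (transition c' c y)).det
      * (jacobian (transition c' c) y).det = (jacobian (transition c' c) y).det ^ 2
      * (coeff g c (transition c' c y)).det by ring,
    Real.sqrt_mul (sq_nonneg _), Real.sqrt_sq_eq_abs]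

theorem HasSmoothCoeff.aemeasurable_density (hg : HasSmoothCoeff g) (c : M) :
    AEMeasurable (fun y => ENNReal.ofReal (Real.sqrt (coeff g c y).det))
      (volume.restrict (extChartAt (𝓡 n) c).target) :=
  ENNReal.measurable_ofReal.comp_aemeasurable
    ((hg.isMetricOn c).contDiffOn_sqrt_det.continuousOn.aemeasurable
      (isOpen_extChartAt_target c).measurableSet)

variable [MeasurableSpace M] [BorelSpace M]

theorem aemeasurable_extChartAt_symm (c : M) :
    AEMeasurable (extChartAt (𝓡 n) c).symm (volume.restrict (extChartAt (𝓡 n) c).target) :=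
  (continuousOn_extChartAt_symm c).aemeasurable (isOpen_extChartAt_target c).measurableSet

/-- The volume measure of the chart around `c`. -/
def chartMeasure (g : SmoothMetric n M) (c : M) : Measure M :=
  ((volume.restrict (extChartAt (𝓡 n) c).target).withDensity fun y =>
    ENNReal.ofReal (Real.sqrt (coeff g c y).det)).map (extChartAt (𝓡 n) c).symm

theorem HasSmoothCoeff.lintegral_chartMeasure (hg : HasSmoothCoeff g) (c : M) {F : M → ENNReal}
    (hF : Measurable F) :
    ∫⁻ x, F x ∂(chartMeasure g c) = ∫⁻ y in (extChartAt (𝓡 n) c).target,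
      ENNReal.ofReal (Real.sqrt (coeff g c y).det) * F ((extChartAt (𝓡 n) c).symm y) := by
  rw [chartMeasure, lintegral_map' hF.aemeasurable
    ((aemeasurable_extChartAt_symm c).mono_ac (withDensity_absolutelyContinuous _ _)),
    lintegral_withDensity_eq_lintegral_mul₀ (hg.aemeasurable_density c)
      (g := fun y => F ((extChartAt (𝓡 n) c).symm y))
      (hF.comp_aemeasurable (aemeasurable_extChartAt_symm c))]
  rfl

variable [T2Space M] [CompactSpace M]

theorem chartPartition_eq_zero {x : M} (hx : x ∉ (extChartAt (𝓡 n) c).source) :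
    chartPartition n M c x = 0 := by
  by_contra h
  have hsub : (chartPartition n M).IsSubordinate _ :=
    (SmoothPartitionOfUnity.exists_isSubordinate_chartAt_source (𝓡 n) M).choose_spec
  refine hx ?_
  rw [extChartAt_source]
  exact hsub c (subset_tsupport _ h)

theorem tsupport_chartPartition_subset (c : M) :
    tsupport (chartPartition n M c) ⊆ (extChartAt (𝓡 n) c).source := by
  have hsub : (chartPartition n M).IsSubordinate _ :=
    (SmoothPartitionOfUnity.exists_isSubordinate_chartAt_source (𝓡 n) M).choose_spec
  rw [extChartAt_source]
  exact hsub c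

/-- The indices of the charts that contribute to the partition of unity. -/
def partitionIndex (n : ℕ) (M : Type*) [TopologicalSpace M]
    [ChartedSpace (EuclideanSpace ℝ (Fin n)) M] [IsManifold (𝓡 n) ∞ M] [T2Space M]
    [CompactSpace M] : Finset M :=
  ((chartPartition n M).locallyFinite.finite_nonempty_of_compact).toFinset

theorem chartPartition_eq_zero_of_notMem {c : M} (hc : c ∉ partitionIndex n M) (x : M) :
    chartPartition n M c x = 0 := by
  by_contra h
  refine hc ?_
  rw [partitionIndex, Set.Finite.mem_toFinset]
  exact ⟨x, h⟩

theorem sum_chartPartition (x : M) : ∑ c ∈ partitionIndex n M, chartPartition n M c x = 1 := by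
  rw [← (chartPartition n M).sum_eq_one (Set.mem_univ x)]
  refine (finsum_eq_sum_of_support_subset _ fun c hc => ?_).symm
  by_contra h
  exact hc (chartPartition_eq_zero_of_notMem h x)

theorem continuous_chartPartition (c : M) : Continuous (chartPartition n M c) :=
  (chartPartition n M c).contMDiff.continuous

/-- By local finiteness and compactness only finitely many functions of the partition are nonzero,
which reduces the sum over all points of M to a finite one. -/
theorem HasSmoothCoeff.lintegral_volumeMeasure (hg : HasSmoothCoeff g) {F : M → ENNReal}
    (hF : Measurable F) :
    ∫⁻ x, F x ∂(volumeMeasure g) = ∑ c ∈ partitionIndex n M,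
      ∫⁻ y in (extChartAt (𝓡 n) c).target, ENNReal.ofReal (Real.sqrt (coeff g c y).det)
        * (ENNReal.ofReal (chartPartition n M c ((extChartAt (𝓡 n) c).symm y))
          * F ((extChartAt (𝓡 n) c).symm y)) := by
  have h1 : ∀ c : M, ∫⁻ x, F x ∂(((volume : Measure (EuclideanSpace ℝ (Fin n))).restrict
        (extChartAt (𝓡 n) c).target).withDensity fun y =>
          ENNReal.ofReal (chartPartition n M c ((extChartAt (𝓡 n) c).symm y)
            * Real.sqrt (coeff g c y).det)).map (extChartAt (𝓡 n) c).symm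
      = ∫⁻ y in (extChartAt (𝓡 n) c).target, ENNReal.ofReal (Real.sqrt (coeff g c y).det)
        * (ENNReal.ofReal (chartPartition n M c ((extChartAt (𝓡 n) c).symm y))
          * F ((extChartAt (𝓡 n) c).symm y)) := by
    intro c
    have hm : AEMeasurable (fun y => ENNReal.ofReal
        (chartPartition n M c ((extChartAt (𝓡 n) c).symm y) * Real.sqrt (coeff g c y).det))
        (volume.restrict (extChartAt (𝓡 n) c).target) := by
      simp only [ENNReal.ofReal_mul ((chartPartition n M).nonneg c _)]
      exact (ENNReal.measurable_ofReal.comp_aemeasurable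
        ((continuous_chartPartition c).measurable.comp_aemeasurable
          (aemeasurable_extChartAt_symm c))).mul (hg.aemeasurable_density c)
    rw [lintegral_map' hF.aemeasurable
      ((aemeasurable_extChartAt_symm c).mono_ac (withDensity_absolutelyContinuous _ _)),
      lintegral_withDensity_eq_lintegral_mul₀ hm (g := fun y => F ((extChartAt (𝓡 n) c).symm y))
        (hF.comp_aemeasurable (aemeasurable_extChartAt_symm c))]
    refine lintegral_congr fun y => ?_
    rw [Pi.mul_apply, ENNReal.ofReal_mul ((chartPartition n M).nonneg c _)]
    ring
  rw [volumeMeasure, lintegral_sum_measure]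
  simp only [h1]
  refine tsum_eq_sum fun c hc => ?_
  simp [chartPartition_eq_zero_of_notMem hc]

/-- Each piece ρ_{c'}F is carried by the overlap of the two charts: outside it, F vanishes when read
in c', and ρ_{c'} vanishes when read in c. On the overlap the change of variables applies. Once all
pieces live in the chart c, the ρ_{c'} sum to 1 and the partition disappears. -/
theorem HasSmoothCoeff.lintegral_eq_chart (hg : HasSmoothCoeff g) (c : M) {F : M → ENNReal}
    (hF : Measurable F) (hsupp : ∀ x ∉ (extChartAt (𝓡 n) c).source, F x = 0) :
    ∫⁻ x, F x ∂(volumeMeasure g) = ∫⁻ x, F x ∂(chartMeasure g c) := by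
  have ho : ∀ c c' : M, MeasurableSet (overlap (n := n) c c') := fun c c' =>
    (isOpen_overlap c c').measurableSet
  have ht : ∀ c : M, MeasurableSet (extChartAt (𝓡 n) c).target := fun c =>
    (isOpen_extChartAt_target c).measurableSet
  rw [hg.lintegral_volumeMeasure hF, hg.lintegral_chartMeasure c hF]
  have h1 : ∀ c' : M, ∫⁻ y in (extChartAt (𝓡 n) c').target,
      ENNReal.ofReal (Real.sqrt (coeff g c' y).det)
        * (ENNReal.ofReal (chartPartition n M c' ((extChartAt (𝓡 n) c').symm y))
          * F ((extChartAt (𝓡 n) c').symm y))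
      = ∫⁻ y in (extChartAt (𝓡 n) c).target, ENNReal.ofReal (Real.sqrt (coeff g c y).det)
        * (ENNReal.ofReal (chartPartition n M c' ((extChartAt (𝓡 n) c).symm y))
          * F ((extChartAt (𝓡 n) c).symm y)) := by
    intro c'
    rw [setLIntegral_eq_of_subset (ht c') (ho c' c) (overlap_subset c' c),
      setLIntegral_eq_of_subset (ht c) (ho c c') (overlap_subset c c')]
    · exact setLIntegral_overlap g c c'
        (fun x => ENNReal.ofReal (chartPartition n M c' x) * F x)
    · intro y hy hy'
      rw [chartPartition_eq_zero fun h => hy' ⟨hy, h⟩]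
      simp
    · intro y hy hy'
      rw [hsupp _ fun h => hy' ⟨hy, h⟩]
      simp
  simp only [h1]
  rw [← lintegral_finsetSum']
  · refine lintegral_congr fun y => ?_
    rw [← Finset.mul_sum, ← Finset.sum_mul, ← ENNReal.ofReal_sum_of_nonneg
      (fun c' _ => (chartPartition n M).nonneg c' _), sum_chartPartition]
    simp
  · intro c' _
    exact (hg.aemeasurable_density c).mul ((ENNReal.measurable_ofReal.comp_aemeasurable
        ((continuous_chartPartition c').measurable.comp_aemeasurable
          (aemeasurable_extChartAt_symm c))).mul
          (hF.comp_aemeasurable (aemeasurable_extChartAt_symm c)))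

theorem HasSmoothCoeff.volumeMeasure_apply (hg : HasSmoothCoeff g) (c : M) {s : Set M}
    (hs : MeasurableSet s) (hsc : s ⊆ (extChartAt (𝓡 n) c).source) :
    volumeMeasure g s = chartMeasure g c s := by
  have h := hg.lintegral_eq_chart c (F := s.indicator 1)
    (measurable_one.indicator hs) fun x hx => Set.indicator_of_notMem (fun h => hx (hsc h)) _
  rwa [lintegral_indicator_one hs, lintegral_indicator_one hs] at h

theorem HasSmoothCoeff.chartMeasure_apply (hg : HasSmoothCoeff g) (c : M) {s : Set M}
    (hs : MeasurableSet s) :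
    chartMeasure g c s = ∫⁻ y in (extChartAt (𝓡 n) c).target,
      ENNReal.ofReal (Real.sqrt (coeff g c y).det)
        * s.indicator 1 ((extChartAt (𝓡 n) c).symm y) := by
  rw [← lintegral_indicator_one hs]
  exact hg.lintegral_chartMeasure c (measurable_one.indicator hs)

theorem HasSmoothCoeff.restrict_volumeMeasure (hg : HasSmoothCoeff g) (c : M) :
    (volumeMeasure g).restrict (extChartAt (𝓡 n) c).source
      = (chartMeasure g c).restrict (extChartAt (𝓡 n) c).source := by
  have hm : MeasurableSet (extChartAt (𝓡 n) c).source := (isOpen_extChartAt_source c).measurableSet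
  ext s hs
  rw [Measure.restrict_apply hs, Measure.restrict_apply hs,
    hg.volumeMeasure_apply c (hs.inter hm) Set.inter_subset_right]

theorem HasSmoothCoeff.integral_eq_chart (hg : HasSmoothCoeff g) (c : M) {F : M → ℝ}
    (hF : Continuous F) (hsupp : ∀ x ∉ (extChartAt (𝓡 n) c).source, F x = 0) :
    ∫ x, F x ∂(volumeMeasure g) = ∫ y in (extChartAt (𝓡 n) c).target,
      Real.sqrt (coeff g c y).det * inChart F c y := by
  rw [← setIntegral_eq_integral_of_forall_compl_eq_zero hsupp, hg.restrict_volumeMeasure c,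
    setIntegral_eq_integral_of_forall_compl_eq_zero hsupp, chartMeasure,
    integral_map ((aemeasurable_extChartAt_symm c).mono_ac (withDensity_absolutelyContinuous _ _))
      hF.aestronglyMeasurable,
    integral_withDensity_eq_integral_toReal_smul₀ (hg.aemeasurable_density c)
      (Filter.Eventually.of_forall fun _ => ENNReal.ofReal_lt_top)]
  simp only [ENNReal.toReal_ofReal (Real.sqrt_nonneg _), smul_eq_mul]
  rfl

/-- Every point has a neighbourhood whose coordinate image lies in a compact subset of the chart,
where the density is bounded. Compactness of M turns local finiteness into finiteness. -/
theorem HasSmoothCoeff.isFiniteMeasure (hg : HasSmoothCoeff g) :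
    IsFiniteMeasure (volumeMeasure g) := by
  have : IsLocallyFiniteMeasure (volumeMeasure g) := by
    refine ⟨fun x => ?_⟩
    obtain ⟨K, hK, hxK, hKt⟩ := exists_compact_subset (isOpen_extChartAt_target (I := 𝓡 n) x)
      (mem_extChartAt_target x)
    have hopen : IsOpen ((extChartAt (𝓡 n) x).source ∩ extChartAt (𝓡 n) x ⁻¹' interior K) :=
      (continuousOn_extChartAt x).isOpen_inter_preimage (isOpen_extChartAt_source x)
        isOpen_interior
    refine ⟨_, hopen.mem_nhds ⟨mem_extChartAt_source x, hxK⟩, ?_⟩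
    rw [hg.volumeMeasure_apply x hopen.measurableSet Set.inter_subset_left,
      hg.chartMeasure_apply x hopen.measurableSet]
    have hInt : IntegrableOn (fun y => Real.sqrt (coeff g x y).det) K volume :=
      ((hg.isMetricOn x).contDiffOn_sqrt_det.continuousOn.mono hKt).integrableOn_compact hK
    refine lt_of_le_of_lt ?_ hInt.lintegral_lt_top
    rw [setLIntegral_eq_of_subset (isOpen_extChartAt_target x).measurableSet hK.measurableSet hKt]
    · refine setLIntegral_mono_ae' hK.measurableSet (Filter.Eventually.of_forall fun y _ => ?_)
      refine mul_le_of_le_one_right' ?_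
      exact Set.indicator_le_self' (fun _ _ => zero_le_one) _ |>.trans le_rfl
    · intro y hy hyK
      rw [Set.indicator_of_notMem, mul_zero]
      rintro ⟨_, h⟩
      rw [Set.mem_preimage, (extChartAt (𝓡 n) x).right_inv hy] at h
      exact hyK (interior_subset h)
  infer_instance

/-- The density is positive in every chart. This serves twice: the total volume is positive, and a
continuous function vanishing almost everywhere vanishes. -/
theorem HasSmoothCoeff.isOpenPosMeasure (hg : HasSmoothCoeff g) :
    Measure.IsOpenPosMeasure (volumeMeasure g) := by
  refine ⟨fun V hV ⟨x, hx⟩ h0 => ?_⟩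
  have hW : IsOpen (V ∩ (extChartAt (𝓡 n) x).source) := hV.inter (isOpen_extChartAt_source x)
  have h1 : volumeMeasure g (V ∩ (extChartAt (𝓡 n) x).source) = 0 :=
    measure_mono_null Set.inter_subset_left h0
  have hs : MeasurableSet ((V ∩ (extChartAt (𝓡 n) x).source)) := hW.measurableSet
  rw [hg.volumeMeasure_apply x hs Set.inter_subset_right, hg.chartMeasure_apply x hs,
    lintegral_eq_zero_iff' (f := fun y => ENNReal.ofReal (Real.sqrt (coeff g x y).det) *
      (V ∩ (extChartAt (𝓡 n) x).source).indicator 1 ((extChartAt (𝓡 n) x).symm y))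
      ((hg.aemeasurable_density x).mul
      ((measurable_one.indicator hs).comp_aemeasurable (aemeasurable_extChartAt_symm x))),
    Filter.EventuallyEq, ae_restrict_iff' (isOpen_extChartAt_target x).measurableSet] at h1
  have hO : IsOpen ((extChartAt (𝓡 n) x).target ∩
      (extChartAt (𝓡 n) x).symm ⁻¹' (V ∩ (extChartAt (𝓡 n) x).source)) :=
    (continuousOn_extChartAt_symm x).isOpen_inter_preimage (isOpen_extChartAt_target x) hW
  have hne : ((extChartAt (𝓡 n) x).target ∩
      (extChartAt (𝓡 n) x).symm ⁻¹' (V ∩ (extChartAt (𝓡 n) x).source)).Nonempty := by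
    refine ⟨extChartAt (𝓡 n) x x, mem_extChartAt_target x, ?_⟩
    rw [Set.mem_preimage, extChartAt_to_inv]
    exact ⟨hx, mem_extChartAt_source x⟩
  refine (hO.measure_pos volume hne).ne' (measure_mono_null ?_ h1)
  rintro y ⟨hy, hy'⟩ h
  have h := h hy
  rw [Set.indicator_of_mem (Set.mem_preimage.1 hy')] at h
  have := Real.sqrt_pos.2 ((hg.isMetricOn x).det_pos hy)
  simp only [Pi.one_apply, mul_one, Pi.zero_apply, ENNReal.ofReal_eq_zero] at h
  linarith

theorem HasSmoothCoeff.integrable (hg : HasSmoothCoeff g) {F : M → ℝ} (hF : Continuous F) :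
    Integrable F (volumeMeasure g) := by
  have := hg.isFiniteMeasure
  exact hF.integrable_of_hasCompactSupport (HasCompactSupport.of_compactSpace F)

end Volume

/-! ### Integration by parts -/

section IntegrationByParts

open MeasureTheory Matrix

variable {n : ℕ}

theorem integral_pderiv_eq_zero {Φ : EuclideanSpace ℝ (Fin n) → ℝ} (hΦ : ContDiff ℝ ∞ Φ)
    (hsupp : HasCompactSupport Φ) (i : Fin n) : ∫ y, pderiv i Φ y = 0 := by
  have hc : Continuous (pderiv i Φ) :=
    (hΦ.continuous_fderiv (by simp)).clm_apply continuous_const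
  have hs : HasCompactSupport (pderiv i Φ) := hsupp.fderiv_apply (𝕜 := ℝ) _
  have h := integral_mul_fderiv_eq_neg_fderiv_mul_of_integrable
    (μ := (volume : Measure (EuclideanSpace ℝ (Fin n)))) (f := fun _ => (1 : ℝ)) (g := Φ)
    (v := EuclideanSpace.single i (1 : ℝ)) (by simp)
    (by simp only [one_mul]; exact hc.integrable_of_hasCompactSupport hs)
    (by simpa using hΦ.continuous.integrable_of_hasCompactSupport hsupp)
    (fun x _ => differentiableAt_const _) (fun x _ => hΦ.differentiable (by simp) x)
  simpa [pderiv] using h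

/-- The integral over `U` of the divergence of a smooth field supported in a compact subset `K`. -/
theorem setIntegral_sum_pderiv_eq_zero {U K : Set (EuclideanSpace ℝ (Fin n))} (hU : IsOpen U)
    (hK : IsCompact K) (hKU : K ⊆ U) {X : EuclideanSpace ℝ (Fin n) → Fin n → ℝ}
    (hX : ∀ i, ContDiffOn ℝ ∞ (fun z => X z i) U) (hX0 : ∀ z ∈ U, z ∉ K → X z = 0) :
    ∫ y in U, ∑ i, pderiv i (fun z => X z i) y = 0 := by
  classical
  -- The extension by zero is smooth on all of ℝⁿ: points of K have a neighbourhood in U, and near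
  -- any other point Φ is zero because K is closed.
  set Φ : Fin n → EuclideanSpace ℝ (Fin n) → ℝ := fun i => U.indicator fun z => X z i with hΦ
  have hzero : ∀ i, ∀ z ∉ K, Φ i z = 0 := by
    intro i z hz
    by_cases hzU : z ∈ U
    · simp [hΦ, hzU, hX0 z hzU hz]
    · simp [hΦ, hzU]
  have hsmooth : ∀ i, ContDiff ℝ ∞ (Φ i) := by
    intro i
    rw [contDiff_iff_contDiffAt]
    intro z
    by_cases hz : z ∈ K
    · have hzU := hU.mem_nhds (hKU hz)
      refine ((hX i).contDiffAt hzU).congr_of_eventuallyEq ?_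
      filter_upwards [hzU] with w hw
      simp [hΦ, hw]
    · refine (contDiffAt_const (c := (0 : ℝ))).congr_of_eventuallyEq ?_
      filter_upwards [hK.isClosed.isOpen_compl.mem_nhds hz] with w hw
      exact hzero i w hw
  have hsupp : ∀ i, HasCompactSupport (Φ i) := fun i =>
    HasCompactSupport.intro hK fun z hz => hzero i z hz
  have h1 : ∀ y ∈ U, ∑ i, pderiv i (fun z => X z i) y = ∑ i, pderiv i (Φ i) y := by
    intro y hy
    refine Finset.sum_congr rfl fun i _ => pderiv_congr ?_ i
    filter_upwards [hU.mem_nhds hy] with w hw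
    simp [hΦ, hw]
  rw [setIntegral_congr_fun hU.measurableSet h1, setIntegral_eq_integral_of_forall_compl_eq_zero]
  · rw [integral_finsetSum]
    · exact Finset.sum_eq_zero fun i _ => integral_pderiv_eq_zero (hsmooth i) (hsupp i) i
    · intro i _
      have hc : Continuous (pderiv i (Φ i)) :=
        ((hsmooth i).continuous_fderiv (by simp)).clm_apply continuous_const
      exact hc.integrable_of_hasCompactSupport ((hsupp i).fderiv_apply (𝕜 := ℝ) _)
  · intro y hy
    refine Finset.sum_eq_zero fun i _ => ?_
    have : Φ i =ᶠ[𝓝 y] fun _ => (0 : ℝ) := by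
      filter_upwards [hK.isClosed.isOpen_compl.mem_nhds fun h => hy (hKU h)] with w hw
      exact hzero i w hw
    rw [pderiv_congr this]
    simp [pderiv]

variable {M : Type*} [TopologicalSpace M] [ChartedSpace (EuclideanSpace ℝ (Fin n)) M]
  [IsManifold (𝓡 n) ∞ M] [MeasurableSpace M] [BorelSpace M] [T2Space M] [CompactSpace M]
  {g : SmoothMetric n M} {a b : M → ℝ}

/-- In the chart, √det G times the integrand is the Euclidean divergence of the field a√det G ∇b.
Localizing a alone makes this field compactly supported. -/
theorem HasSmoothCoeff.integral_gradInner_add_of_tsupport_subset (hg : HasSmoothCoeff g)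
    (ha : ChartSmooth n a) (hb : ChartSmooth n b) {c : M}
    (hsupp : tsupport a ⊆ (extChartAt (𝓡 n) c).source) :
    ∫ x, (gradInner g a b x + a x * laplacian g b x) ∂(volumeMeasure g) = 0 := by
  have hcont : Continuous fun x => gradInner g a b x + a x * laplacian g b x :=
    ((hg.chartSmooth_gradInner ha hb).add (ha.mul (hg.chartSmooth_laplacian hb))).continuous
  have hG := hg.isMetricOn c
  have hcoord : Set.EqOn (fun y => Real.sqrt (coeff g c y).det *
      inChart (fun x => gradInner g a b x + a x * laplacian g b x) c y)
      (fun y => ∑ i, pderiv i (fun z => inChart a c z *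
        (Real.sqrt (coeff g c z).det * gradVec (coeff g c) (inChart b c) z i)) y)
      (extChartAt (𝓡 n) c).target := by
    intro y hy
    have e1 := hg.inChart_gradInner ha hb c hy
    have e2 := hg.inChart_laplacian hb c hy
    have hd : ∀ i, DifferentiableAt ℝ (fun z => Real.sqrt (coeff g c z).det *
        gradVec (coeff g c) (inChart b c) z i) y := fun i =>
      differentiableAt_of_contDiffOn hG.isOpen
        (hG.contDiffOn_sqrt_det.mul (hG.contDiffOn_gradVec (hb c) i)) hy
    have hda := differentiableAt_of_contDiffOn hG.isOpen (ha c) hy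
    simp only [fun i => pderiv_mul hda (hd i) i]
    rw [Finset.sum_add_distrib, ← Finset.mul_sum, hG.sum_pderiv_sqrt_det_mul_gradVec hy (hb c)]
    change Real.sqrt (coeff g c y).det * (inChart (gradInner g a b) c y
      + inChart a c y * inChart (laplacian g b) c y) = _
    rw [e1, e2, coLap, coGrad]
    change _ * (dvec (inChart a c) y ⬝ᵥ gradVec (coeff g c) (inChart b c) y + _) = _
    simp only [dotProduct, dvec, mul_add, Finset.mul_sum]
    rw [add_comm]
    congr 1
    · refine Finset.sum_congr rfl fun i _ => Finset.sum_congr rfl fun j _ => by ring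
    · exact Finset.sum_congr rfl fun i _ => by ring
  rw [hg.integral_eq_chart c hcont, setIntegral_congr_fun hG.isOpen.measurableSet hcoord]
  · refine setIntegral_sum_pderiv_eq_zero hG.isOpen
      (K := extChartAt (𝓡 n) c '' tsupport a) (X := fun z i => inChart a c z *
        (Real.sqrt (coeff g c z).det * gradVec (coeff g c) (inChart b c) z i)) ?_ ?_ ?_ ?_
    · exact (isClosed_tsupport a).isCompact.image_of_continuousOn
        ((continuousOn_extChartAt c).mono hsupp)
    · rintro _ ⟨x, hx, rfl⟩
      exact (extChartAt (𝓡 n) c).map_source (hsupp hx)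
    · exact fun i => (ha c).mul (hG.contDiffOn_sqrt_det.mul (hG.contDiffOn_gradVec (hb c) i))
    · intro z hz hzK
      have : inChart a c z = 0 := by
        by_contra h
        exact hzK ⟨_, subset_tsupport a h, (extChartAt (𝓡 n) c).right_inv hz⟩
      funext i
      simp [this]
  -- It remains to see that the integrand vanishes outside the chart: there a is zero in a
  -- neighbourhood of x, hence so is its differential at x.
  · intro x hx
    have hx' : x ∉ tsupport a := fun h => hx (hsupp h)
    have h0 : a =ᶠ[𝓝 x] fun _ => (0 : ℝ) := notMem_tsupport_iff_eventuallyEq.1 hx'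
    have h1 : inChart a x =ᶠ[𝓝 (extChartAt (𝓡 n) x x)] fun _ => (0 : ℝ) := by
      have hc : Filter.Tendsto (extChartAt (𝓡 n) x).symm (𝓝 (extChartAt (𝓡 n) x x)) (𝓝 x) := by
        have := continuousAt_extChartAt_symm (I := 𝓡 n) x
        rwa [ContinuousAt, extChartAt_to_inv] at this
      exact hc.eventually h0
    have h2 : dvec (inChart a x) (extChartAt (𝓡 n) x x) = 0 := by
      funext i
      rw [dvec, pderiv_congr h1]
      simp [pderiv]
    rw [gradInner, coGrad, h2, zero_dotProduct, h0.eq_of_nhds, zero_mul, zero_add]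

/-- Green's formula on a closed manifold. -/
theorem HasSmoothCoeff.integral_gradInner (hg : HasSmoothCoeff g) (ha : ChartSmooth n a)
    (hb : ChartSmooth n b) :
    ∫ x, gradInner g a b x ∂(volumeMeasure g)
      = -∫ x, a x * laplacian g b x ∂(volumeMeasure g) := by
  have hρ : ∀ c : M, ChartSmooth n (chartPartition n M c) := fun c =>
    chartSmooth_of_contMDiff (chartPartition n M c).contMDiff
  have hρa : ∀ c : M, ChartSmooth n (fun x => chartPartition n M c x * a x) := fun c =>
    (hρ c).mul ha
  have hsum : a = fun x => ∑ c ∈ partitionIndex n M, chartPartition n M c x * a x := by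
    funext x
    rw [← Finset.sum_mul, sum_chartPartition, one_mul]
  -- The expression is linear in a, so only a is cut by the partition of unity; the gradients of the
  -- ρ_c add up correctly because it is ρ_c a that is differentiated.
  have hpt : ∀ x, gradInner g a b x + a x * laplacian g b x
      = ∑ c ∈ partitionIndex n M, (gradInner g (fun x => chartPartition n M c x * a x) b x
        + chartPartition n M c x * a x * laplacian g b x) := by
    intro x
    rw [Finset.sum_add_distrib, ← Finset.sum_mul, ← Finset.sum_mul, sum_chartPartition, one_mul,
      ← (gradInner_finsetSum_left g _ hρa b x).2, ← hsum]
  have hInt : ∀ {u : M → ℝ}, ChartSmooth n u → Integrable u (volumeMeasure g) :=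
    fun hu => hg.integrable hu.continuous
  have h0 : ∫ x, (gradInner g a b x + a x * laplacian g b x) ∂(volumeMeasure g) = 0 := by
    simp only [hpt]
    rw [integral_finsetSum]
    · refine Finset.sum_eq_zero fun c _ =>
        hg.integral_gradInner_add_of_tsupport_subset (hρa c) hb (c := c) ?_
      exact (closure_mono fun x hx => left_ne_zero_of_mul hx).trans
        (tsupport_chartPartition_subset c)
    · exact fun c _ => hInt ((hg.chartSmooth_gradInner (hρa c) hb).add
        ((hρa c).mul (hg.chartSmooth_laplacian hb)))
  rw [integral_add (hInt (hg.chartSmooth_gradInner ha hb))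
    (hInt (ha.mul (hg.chartSmooth_laplacian hb)))] at h0
  linarith

theorem HasSmoothCoeff.integral_laplacian (hg : HasSmoothCoeff g) (hb : ChartSmooth n b) :
    ∫ x, laplacian g b x ∂(volumeMeasure g) = 0 := by
  have h := hg.integral_gradInner (chartSmooth_const 1) hb
  simp only [gradInner_const_left, integral_zero, one_mul] at h
  linarith

end IntegrationByParts

/-! ### Functions depending smoothly on time -/

section TimeDependence

set_option linter.unusedSectionVars false

open MeasureTheory Matrix Set

variable {n : ℕ} {t₀ t₁ : ℝ}

/-! ### Slices in time and in space of a smooth function on a slab -/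

section Slices

variable {U : Set (EuclideanSpace ℝ (Fin n))} {F : ℝ × EuclideanSpace ℝ (Fin n) → ℝ} {t : ℝ}
  {y : EuclideanSpace ℝ (Fin n)}

theorem uniqueDiffOn_Icc_prod (ht : t₀ < t₁) (hU : IsOpen U) : UniqueDiffOn ℝ (Icc t₀ t₁ ×ˢ U) :=
  (uniqueDiffOn_Icc ht).prod hU.uniqueDiffOn

theorem contDiffOn_slice (hF : ContDiffOn ℝ ∞ F (Icc t₀ t₁ ×ˢ U)) (hts : t ∈ Icc t₀ t₁) :
    ContDiffOn ℝ ∞ (fun z => F (t, z)) U :=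
  hF.comp (contDiff_const.prodMk contDiff_id).contDiffOn fun _ hz => ⟨hts, hz⟩

/-- Expressed through the joint derivative within the slab, spatial derivatives of slices inherit
joint smoothness up to the end times, where time derivatives are only one-sided. -/
theorem pderiv_slice (hU : IsOpen U) (hF : ContDiffOn ℝ ∞ F (Icc t₀ t₁ ×ˢ U))
    (hts : t ∈ Icc t₀ t₁) (hy : y ∈ U) (i : Fin n) :
    pderiv i (fun z => F (t, z)) y
      = fderivWithin ℝ F (Icc t₀ t₁ ×ˢ U) (t, y) (0, EuclideanSpace.single i 1) := by
  have h1 : HasFDerivWithinAt F (fderivWithin ℝ F (Icc t₀ t₁ ×ˢ U) (t, y)) (Icc t₀ t₁ ×ˢ U)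
      (t, y) := ((hF.differentiableOn (by simp)) (t, y) ⟨hts, hy⟩).hasFDerivWithinAt
  have h2 : HasFDerivWithinAt (fun z : EuclideanSpace ℝ (Fin n) => (t, z))
      (ContinuousLinearMap.inr ℝ ℝ (EuclideanSpace ℝ (Fin n))) U y :=
    (hasFDerivAt_prodMk_right t y).hasFDerivWithinAt
  have h3 := (h1.comp y h2 fun z hz => ⟨hts, hz⟩).hasFDerivAt (hU.mem_nhds hy)
  have h4 : HasFDerivAt (fun z => F (t, z)) _ y := h3
  rw [pderiv, h4.fderiv]
  rfl

theorem hasDerivWithinAt_slice (hF : ContDiffOn ℝ ∞ F (Icc t₀ t₁ ×ˢ U))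
    (hts : t ∈ Icc t₀ t₁) (hy : y ∈ U) :
    HasDerivWithinAt (fun s => F (s, y))
      (fderivWithin ℝ F (Icc t₀ t₁ ×ˢ U) (t, y) (1, 0)) (Icc t₀ t₁) t := by
  have h1 : HasFDerivWithinAt F (fderivWithin ℝ F (Icc t₀ t₁ ×ˢ U) (t, y)) (Icc t₀ t₁ ×ˢ U)
      (t, y) := ((hF.differentiableOn (by simp)) (t, y) ⟨hts, hy⟩).hasFDerivWithinAt
  have h2 : HasDerivWithinAt (fun s : ℝ => (s, y)) ((1 : ℝ), (0 : EuclideanSpace ℝ (Fin n)))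
      (Icc t₀ t₁) t := (hasDerivWithinAt_id t _).prodMk (hasDerivWithinAt_const t _ y)
  exact h1.comp_hasDerivWithinAt t h2 fun s hs => mk_mem_prod hs hy

theorem contDiffOn_fderivWithin_apply (ht : t₀ < t₁) (hU : IsOpen U)
    (hF : ContDiffOn ℝ ∞ F (Icc t₀ t₁ ×ˢ U)) (w : ℝ × EuclideanSpace ℝ (Fin n)) :
    ContDiffOn ℝ ∞ (fun q => fderivWithin ℝ F (Icc t₀ t₁ ×ˢ U) q w) (Icc t₀ t₁ ×ˢ U) :=
  (hF.fderivWithin (uniqueDiffOn_Icc_prod ht hU) (by simp)).clm_apply contDiffOn_const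

theorem contDiffOn_pderiv_slice (ht : t₀ < t₁) (hU : IsOpen U)
    (hF : ContDiffOn ℝ ∞ F (Icc t₀ t₁ ×ˢ U)) (i : Fin n) :
    ContDiffOn ℝ ∞ (fun q : ℝ × EuclideanSpace ℝ (Fin n) => pderiv i (fun z => F (q.1, z)) q.2)
      (Icc t₀ t₁ ×ˢ U) :=
  (contDiffOn_fderivWithin_apply ht hU hF (0, EuclideanSpace.single i 1)).congr
    fun _ hq => pderiv_slice hU hF hq.1 hq.2 i

theorem derivWithin_slice (ht : t₀ < t₁) (hF : ContDiffOn ℝ ∞ F (Icc t₀ t₁ ×ˢ U))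
    (hts : t ∈ Icc t₀ t₁) (hy : y ∈ U) :
    derivWithin (fun s => F (s, y)) (Icc t₀ t₁) t
      = fderivWithin ℝ F (Icc t₀ t₁ ×ˢ U) (t, y) (1, 0) :=
  (hasDerivWithinAt_slice hF hts hy).derivWithin (uniqueDiffOn_Icc ht t hts)

theorem contDiffOn_derivWithin_slice (ht : t₀ < t₁) (hU : IsOpen U)
    (hF : ContDiffOn ℝ ∞ F (Icc t₀ t₁ ×ˢ U)) :
    ContDiffOn ℝ ∞ (fun q : ℝ × EuclideanSpace ℝ (Fin n) =>
      derivWithin (fun s => F (s, q.2)) (Icc t₀ t₁) q.1) (Icc t₀ t₁ ×ˢ U) :=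
  (contDiffOn_fderivWithin_apply ht hU hF (1, 0)).congr
    fun _ hq => derivWithin_slice ht hF hq.1 hq.2

/-- Time and space derivatives commute. -/
theorem hasDerivAt_pderiv_slice (ht : t₀ < t₁) (hU : IsOpen U)
    (hF : ContDiffOn ℝ ∞ F (Icc t₀ t₁ ×ˢ U)) (hts : t ∈ Ioo t₀ t₁) (hy : y ∈ U) (i : Fin n) :
    HasDerivAt (fun s => pderiv i (fun z => F (s, z)) y)
      (pderiv i (fun z => derivWithin (fun s => F (s, z)) (Icc t₀ t₁) t) y) t := by
  have hO : IsOpen (Ioo t₀ t₁ ×ˢ U) := isOpen_Ioo.prod hU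
  have hsub : Ioo t₀ t₁ ×ˢ U ⊆ Icc t₀ t₁ ×ˢ U := prod_mono Ioo_subset_Icc_self subset_rfl
  have hmem : (t, y) ∈ Ioo t₀ t₁ ×ˢ U := ⟨hts, hy⟩
  have hnhds : Icc t₀ t₁ ×ˢ U ∈ 𝓝 (t, y) := Filter.mem_of_superset (hO.mem_nhds hmem) hsub
  have hc : ContDiffAt ℝ ∞ F (t, y) := hF.contDiffAt hnhds
  have hd : DifferentiableAt ℝ (fderiv ℝ F) (t, y) :=
    (hc.fderiv_right (m := 1) (WithTop.coe_le_coe.2 le_top)).differentiableAt (by simp)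
  have hsymm := hc.isSymmSndFDerivAt (by
    rw [minSmoothness_of_isRCLikeNormedField]
    exact WithTop.coe_le_coe.2 le_top)
  -- At interior times the derivative within the slab is the full derivative, so the commutation is
  -- the symmetry of the second derivative.
  have hw : ∀ q ∈ Ioo t₀ t₁ ×ˢ U, fderivWithin ℝ F (Icc t₀ t₁ ×ˢ U) q = fderiv ℝ F q :=
    fun q hq => fderivWithin_of_mem_nhds (Filter.mem_of_superset (hO.mem_nhds hq) hsub)
  have h1 : HasDerivAt (fun s => fderiv ℝ F (s, y) (0, EuclideanSpace.single i 1))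
      (fderiv ℝ (fderiv ℝ F) (t, y) (1, 0) (0, EuclideanSpace.single i 1)) t := by
    have hp : HasDerivAt (fun s : ℝ => (s, y)) ((1 : ℝ), (0 : EuclideanSpace ℝ (Fin n))) t :=
      (hasDerivAt_id t).prodMk (hasDerivAt_const t y)
    have h := hd.hasFDerivAt.comp_hasDerivAt t hp
    have h' : HasDerivAt (fun s => fderiv ℝ F (s, y))
      (fderiv ℝ (fderiv ℝ F) (t, y) (1, 0)) t := h
    simpa using h'.clm_apply (hasDerivAt_const t ((0 : ℝ), EuclideanSpace.single i (1 : ℝ)))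
  have h2 : pderiv i (fun z => derivWithin (fun s => F (s, z)) (Icc t₀ t₁) t) y
      = fderiv ℝ (fderiv ℝ F) (t, y) (0, EuclideanSpace.single i 1) (1, 0) := by
    have hp : HasFDerivAt (fun z : EuclideanSpace ℝ (Fin n) => (t, z))
        (ContinuousLinearMap.inr ℝ ℝ (EuclideanSpace ℝ (Fin n))) y := hasFDerivAt_prodMk_right t y
    have h : HasFDerivAt (fun z => fderiv ℝ F (t, z))
        ((fderiv ℝ (fderiv ℝ F) (t, y)).comp
          (ContinuousLinearMap.inr ℝ ℝ (EuclideanSpace ℝ (Fin n)))) y :=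
      hd.hasFDerivAt.comp y hp
    have h' := h.clm_apply (hasFDerivAt_const ((1 : ℝ), (0 : EuclideanSpace ℝ (Fin n))) y)
    have hcongr : (fun z => derivWithin (fun s => F (s, z)) (Icc t₀ t₁) t)
        =ᶠ[𝓝 y] fun z => fderiv ℝ F (t, z) (1, 0) := by
      filter_upwards [hU.mem_nhds hy] with z hz
      rw [derivWithin_slice ht hF (Ioo_subset_Icc_self hts) hz, hw _ ⟨hts, hz⟩]
    rw [pderiv_congr hcongr, pderiv, h'.fderiv]
    simp
  rw [h2, hsymm]
  refine h1.congr_of_eventuallyEq ?_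
  filter_upwards [isOpen_Ioo.mem_nhds hts] with s hs
  rw [pderiv_slice hU hF (Ioo_subset_Icc_self hs) hy, hw _ ⟨hs, hy⟩]

end Slices

variable {M : Type*} [TopologicalSpace M] [ChartedSpace (EuclideanSpace ℝ (Fin n)) M]
  [IsManifold (𝓡 n) ∞ M]

/-- The function `u(t, x)` is smooth in time and space, in every chart. -/
def TimeSmooth (n : ℕ) {M : Type*} [TopologicalSpace M]
    [ChartedSpace (EuclideanSpace ℝ (Fin n)) M] (t₀ t₁ : ℝ) (u : ℝ → M → ℝ) : Prop :=
  ∀ c : M, ContDiffOn ℝ ∞ (fun q : ℝ × EuclideanSpace ℝ (Fin n) => inChart (u q.1) c q.2)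
    (Icc t₀ t₁ ×ˢ (extChartAt (𝓡 n) c).target)

namespace TimeSmooth

variable {u w : ℝ → M → ℝ} {t : ℝ}

theorem chartSmooth (hu : TimeSmooth n t₀ t₁ u) (ht : t ∈ Icc t₀ t₁) : ChartSmooth n (u t) :=
  fun c => contDiffOn_slice (hu c) ht

theorem mul (hu : TimeSmooth n t₀ t₁ u) (hw : TimeSmooth n t₀ t₁ w) :
    TimeSmooth n t₀ t₁ (fun t x => u t x * w t x) := fun c => (hu c).mul (hw c)

theorem timeDeriv (ht : t₀ < t₁) (hu : TimeSmooth n t₀ t₁ u) :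
    TimeSmooth n t₀ t₁ (timeDeriv t₀ t₁ u) :=
  fun c => contDiffOn_derivWithin_slice ht (isOpen_extChartAt_target c) (hu c)

theorem continuousOn (hu : TimeSmooth n t₀ t₁ u) :
    ContinuousOn (fun q : ℝ × M => u q.1 q.2) (Icc t₀ t₁ ×ˢ univ) := by
  rintro ⟨t, x⟩ ⟨ht, -⟩
  have h1 := (hu x).continuousOn (t, extChartAt (𝓡 n) x x) ⟨ht, mem_extChartAt_target x⟩
  have h2 : ContinuousWithinAt (fun q : ℝ × M => (q.1, extChartAt (𝓡 n) x q.2))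
      (Icc t₀ t₁ ×ˢ (extChartAt (𝓡 n) x).source) (t, x) :=
    (continuousAt_fst.prodMk (ContinuousAt.comp (f := Prod.snd) (x := (t, x))
      (continuousAt_extChartAt x) continuousAt_snd)).continuousWithinAt
  have h3 := ContinuousWithinAt.comp (x := (t, x)) h1 h2 fun q hq =>
    mk_mem_prod hq.1 ((extChartAt (𝓡 n) x).map_source hq.2)
  have h4 : ContinuousWithinAt (fun q : ℝ × M => u q.1 q.2)
      (Icc t₀ t₁ ×ˢ (extChartAt (𝓡 n) x).source) (t, x) := by
    refine h3.congr (fun q hq => ?_) ?_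
    · simp only [inChart, Function.comp_apply, (extChartAt (𝓡 n) x).left_inv hq.2]
    · simp only [inChart, Function.comp_apply, extChartAt_to_inv]
  refine h4.mono_of_mem_nhdsWithin ?_
  refine mem_nhdsWithin.2 ⟨univ ×ˢ (extChartAt (𝓡 n) x).source,
    isOpen_univ.prod (isOpen_extChartAt_source x), ⟨mem_univ _, mem_extChartAt_source x⟩, ?_⟩
  rintro ⟨s, z⟩ ⟨⟨-, hz⟩, ⟨hs, -⟩⟩
  exact ⟨hs, hz⟩

theorem continuousOn_time (hu : TimeSmooth n t₀ t₁ u) (x : M) :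
    ContinuousOn (fun s => u s x) (Icc t₀ t₁) :=
  hu.continuousOn.comp (continuous_id.prodMk continuous_const).continuousOn
    fun _ hs => ⟨hs, mem_univ _⟩

theorem hasDerivAt (hu : TimeSmooth n t₀ t₁ u) (ht : t ∈ Ioo t₀ t₁) (x : M) :
    HasDerivAt (fun s => u s x) (ConformalRicci.timeDeriv t₀ t₁ u t x) t := by
  have h := hasDerivWithinAt_slice (hu x) (Ioo_subset_Icc_self ht) (mem_extChartAt_target x)
  simp only [inChart, extChartAt_to_inv] at h
  exact (h.differentiableWithinAt.hasDerivWithinAt).hasDerivAt (Icc_mem_nhds ht.1 ht.2)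

theorem hasDerivAt_dvec (ht' : t₀ < t₁) (hu : TimeSmooth n t₀ t₁ u) (ht : t ∈ Ioo t₀ t₁) (x : M)
    (i : Fin n) :
    HasDerivAt (fun s => dvec (inChart (u s) x) (extChartAt (𝓡 n) x x) i)
      (dvec (inChart (ConformalRicci.timeDeriv t₀ t₁ u t) x) (extChartAt (𝓡 n) x x) i) t :=
  hasDerivAt_pderiv_slice ht' (isOpen_extChartAt_target x) (hu x) ht (mem_extChartAt_target x) i

theorem exists_bound [CompactSpace M] (hu : TimeSmooth n t₀ t₁ u) :
    ∃ C, ∀ t ∈ Icc t₀ t₁, ∀ x, ‖u t x‖ ≤ C := by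
  obtain ⟨C, hC⟩ := (isCompact_Icc.prod isCompact_univ).exists_bound_of_continuousOn hu.continuousOn
  exact ⟨C, fun t ht x => hC (t, x) ⟨ht, mem_univ _⟩⟩

variable [CompactSpace M] [MeasurableSpace M] [BorelSpace M] {μ : Measure M} [IsFiniteMeasure μ]

theorem continuousOn_integral (hu : TimeSmooth n t₀ t₁ u) :
    ContinuousOn (fun t => ∫ x, u t x ∂μ) (Icc t₀ t₁) := by
  obtain ⟨C, hC⟩ := hu.exists_bound
  intro t ht
  refine continuousWithinAt_of_dominated (bound := fun _ => C) ?_ ?_ (integrable_const C) ?_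
  · filter_upwards [self_mem_nhdsWithin] with s hs
    exact (hu.chartSmooth hs).continuous.aestronglyMeasurable
  · filter_upwards [self_mem_nhdsWithin] with s hs
    exact Filter.Eventually.of_forall fun x => hC s hs x
  · exact Filter.Eventually.of_forall fun x => hu.continuousOn_time x t ht

theorem hasDerivAt_integral (ht' : t₀ < t₁) (hu : TimeSmooth n t₀ t₁ u) (ht : t ∈ Ioo t₀ t₁) :
    HasDerivAt (fun t => ∫ x, u t x ∂μ) (∫ x, ConformalRicci.timeDeriv t₀ t₁ u t x ∂μ) t := by
  -- The time derivative is bounded on the compact set [t₀,t₁] × M; its bound is an integrable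
  -- dominating function because the measure is finite.
  obtain ⟨C, hC⟩ := (hu.timeDeriv ht').exists_bound
  have hmem := isOpen_Ioo.mem_nhds ht
  refine (hasDerivAt_integral_of_dominated_loc_of_deriv_le (bound := fun _ => C) hmem ?_ ?_ ?_ ?_
    (integrable_const C) ?_).2
  · filter_upwards [hmem] with s hs
    exact (hu.chartSmooth (Ioo_subset_Icc_self hs)).continuous.aestronglyMeasurable
  · exact (hu.chartSmooth (Ioo_subset_Icc_self ht)).continuous.integrable_of_hasCompactSupport
      (HasCompactSupport.of_compactSpace _)
  · exact ((hu.timeDeriv ht').chartSmooth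
      (Ioo_subset_Icc_self ht)).continuous.aestronglyMeasurable
  · exact Filter.Eventually.of_forall fun x s hs => hC s (Ioo_subset_Icc_self hs) x
  · exact Filter.Eventually.of_forall fun x s hs => hu.hasDerivAt hs x

end TimeSmooth

theorem timeSmooth_of_smoothOn {m : ℕ} {M : Type*} [TopologicalSpace M]
    [ChartedSpace (EuclideanSpace ℝ (Fin (m + 1))) M] [IsManifold (𝓡 (m + 1)) ∞ M] {u : ℝ → M → ℝ}
    (hu : SmoothOn m t₀ t₁ u) : TimeSmooth (m + 1) t₀ t₁ u := by
  intro c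
  have h1 : ContMDiffOn (𝓘(ℝ, ℝ).prod 𝓘(ℝ, EuclideanSpace ℝ (Fin (m + 1))))
      (𝓘(ℝ, ℝ).prod (𝓡 (m + 1))) ∞
      (Prod.map (id : ℝ → ℝ) (extChartAt (𝓡 (m + 1)) c).symm)
      (univ ×ˢ (extChartAt (𝓡 (m + 1)) c).target) :=
    contMDiffOn_id.prodMap (contMDiffOn_extChartAt_symm (n := ∞) c)
  have h2 := hu.comp (h1.mono (prod_mono (subset_univ (Icc t₀ t₁)) subset_rfl))
    fun q hq => ⟨hq.1, mem_univ _⟩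
  -- The product manifold structure on ℝ × ℝⁿ is its structure as a vector space, so manifold
  -- smoothness becomes ordinary smoothness.
  rw [← modelWithCornersSelf_prod, chartedSpaceSelf_prod] at h2
  exact contMDiffOn_iff_contDiffOn.1 h2

end TimeDependence

/-! ### Families of metrics -/

section MetricFamily

set_option linter.unusedSectionVars false

open MeasureTheory Matrix Set

variable {n : ℕ} {t₀ t₁ t : ℝ} {M : Type*} [TopologicalSpace M]
  [ChartedSpace (EuclideanSpace ℝ (Fin n)) M] [IsManifold (𝓡 n) ∞ M]

/-- The coefficients of the metrics `g(t)` are smooth in time and space. -/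
def IsSmoothFamily (t₀ t₁ : ℝ) (g : ℝ → SmoothMetric n M) : Prop :=
  ∀ (c : M) (i j : Fin n), ContDiffOn ℝ ∞
    (fun q : ℝ × EuclideanSpace ℝ (Fin n) => coeff (g q.1) c q.2 i j)
    (Icc t₀ t₁ ×ˢ (extChartAt (𝓡 n) c).target)

/-- The density of the volume of `g` with respect to the volume of `g'`. -/
def volRatio (g g' : SmoothMetric n M) (x : M) : ℝ :=
  Real.sqrt (baseMatrix g x).det / Real.sqrt (baseMatrix g' x).det

/-- Both determinants acquire the same factor (det J)², so the quotient of densities is the same in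
all charts and may be computed, and shown to be smooth, in any of them. -/
theorem inChart_volRatio (g g' : SmoothMetric n M) (c : M) {y : EuclideanSpace ℝ (Fin n)}
    (hy : y ∈ (extChartAt (𝓡 n) c).target) :
    inChart (volRatio g g') c y
      = Real.sqrt (coeff g c y).det / Real.sqrt (coeff g' c y).det := by
  have hJ : (jacobian (transition c ((extChartAt (𝓡 n) c).symm y)) y).det ≠ 0 :=
    (isUnit_det_jacobian_transition ⟨hy, mem_extChartAt_source _⟩).ne_zero
  set J := jacobian (transition c ((extChartAt (𝓡 n) c).symm y)) y
  have h : ∀ g : SmoothMetric n M, Real.sqrt (coeff g c y).det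
      = |J.det| * Real.sqrt (baseMatrix g ((extChartAt (𝓡 n) c).symm y)).det := by
    intro g
    rw [coeff_eq_base g hy, Matrix.det_mul, Matrix.det_mul, Matrix.det_transpose,
      show J.det * (baseMatrix g ((extChartAt (𝓡 n) c).symm y)).det * J.det
        = J.det ^ 2 * (baseMatrix g ((extChartAt (𝓡 n) c).symm y)).det by ring,
      Real.sqrt_mul (sq_nonneg _), Real.sqrt_sq_eq_abs]
  rw [h, h, mul_div_mul_left _ _ (abs_ne_zero.2 hJ)]
  rfl

theorem HasSmoothCoeff.chartSmooth_volRatio {g g' : SmoothMetric n M} (hg : HasSmoothCoeff g)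
    (hg' : HasSmoothCoeff g') : ChartSmooth n (volRatio g g') := fun c =>
  ((hg.isMetricOn c).contDiffOn_sqrt_det.div (hg'.isMetricOn c).contDiffOn_sqrt_det
    fun _ hz => (Real.sqrt_pos.2 ((hg'.isMetricOn c).det_pos hz)).ne').congr
      fun _ hz => inChart_volRatio g g' c hz

namespace IsSmoothFamily

variable {g : ℝ → SmoothMetric n M} {u w : ℝ → M → ℝ}

theorem hasSmoothCoeff (hg : IsSmoothFamily t₀ t₁ g) (ht : t ∈ Icc t₀ t₁) :
    HasSmoothCoeff (g t) := fun c i j =>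
  contDiffOn_slice (F := fun q => coeff (g q.1) c q.2 i j) (hg c i j) ht

theorem contDiffOn_sqrt_det (hg : IsSmoothFamily t₀ t₁ g) (c : M) :
    ContDiffOn ℝ ∞ (fun q : ℝ × EuclideanSpace ℝ (Fin n) => Real.sqrt (coeff (g q.1) c q.2).det)
      (Icc t₀ t₁ ×ˢ (extChartAt (𝓡 n) c).target) :=
  ContDiffOn.sqrt (fun q hq => contDiffWithinAt_det fun i j => hg c i j q hq)
    fun _ hq => (((hg.hasSmoothCoeff hq.1).isMetricOn c).det_ne hq.2)

theorem timeSmooth_gradInner (ht : t₀ < t₁) (hg : IsSmoothFamily t₀ t₁ g)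
    (hu : TimeSmooth n t₀ t₁ u) (hw : TimeSmooth n t₀ t₁ w) :
    TimeSmooth n t₀ t₁ (fun t => gradInner (g t) (u t) (w t)) := by
  intro c
  have hU := isOpen_extChartAt_target (I := 𝓡 n) c
  have h1 : ContDiffOn ℝ ∞ (fun q : ℝ × EuclideanSpace ℝ (Fin n) =>
      ∑ i, pderiv i (inChart (u q.1) c) q.2 * ∑ j, (coeff (g q.1) c q.2)⁻¹ i j *
        pderiv j (inChart (w q.1) c) q.2) (Icc t₀ t₁ ×ˢ (extChartAt (𝓡 n) c).target) := by
    refine ContDiffOn.sum fun i _ => (contDiffOn_pderiv_slice ht hU (hu c) i).mul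
      (ContDiffOn.sum fun j _ => ContDiffOn.mul ?_ (contDiffOn_pderiv_slice ht hU (hw c) j))
    exact fun q hq => contDiffWithinAt_inv_apply (fun i j => hg c i j q hq)
      (((hg.hasSmoothCoeff hq.1).isMetricOn c).det_ne hq.2) i j
  exact h1.congr fun q hq => (hg.hasSmoothCoeff hq.1).inChart_gradInner (hu.chartSmooth hq.1)
    (hw.chartSmooth hq.1) c hq.2

theorem timeSmooth_volRatio (hg : IsSmoothFamily t₀ t₁ g) {g' : SmoothMetric n M}
    (hg' : HasSmoothCoeff g') : TimeSmooth n t₀ t₁ (fun t => volRatio (g t) g') := by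
  intro c
  have h2 : ContDiffOn ℝ ∞ (fun q : ℝ × EuclideanSpace ℝ (Fin n) =>
      Real.sqrt (coeff g' c q.2).det) (Icc t₀ t₁ ×ˢ (extChartAt (𝓡 n) c).target) :=
    (hg'.isMetricOn c).contDiffOn_sqrt_det.comp contDiff_snd.contDiffOn fun q hq => hq.2
  refine ((hg.contDiffOn_sqrt_det c).div h2 fun q hq =>
    (Real.sqrt_pos.2 ((hg'.isMetricOn c).det_pos hq.2)).ne').congr fun q hq => ?_
  exact inChart_volRatio _ _ c hq.2

end IsSmoothFamily

variable [MeasurableSpace M] [BorelSpace M] [T2Space M] [CompactSpace M]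

/-- This moves the time dependence of the measure into the integrand, where differentiation under a
fixed integral is possible. -/
theorem HasSmoothCoeff.integral_eq_integral_volRatio {g g' : SmoothMetric n M}
    (hg : HasSmoothCoeff g) (hg' : HasSmoothCoeff g') {F : M → ℝ} (hF : Continuous F) :
    ∫ x, F x ∂(volumeMeasure g) = ∫ x, F x * volRatio g g' x ∂(volumeMeasure g') := by
  have hR := (hg.chartSmooth_volRatio hg').continuous
  have hρ := fun c : M => continuous_chartPartition (n := n) c
  have hsum : ∀ x, F x = ∑ c ∈ partitionIndex n M, chartPartition n M c x * F x := by
    intro x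
    rw [← Finset.sum_mul, sum_chartPartition, one_mul]
  have hsum' : ∀ x, F x * volRatio g g' x
      = ∑ c ∈ partitionIndex n M, chartPartition n M c x * F x * volRatio g g' x := by
    intro x
    rw [← Finset.sum_mul, ← hsum]
  rw [integral_congr_ae (Filter.Eventually.of_forall hsum),
    integral_congr_ae (Filter.Eventually.of_forall hsum'), integral_finsetSum, integral_finsetSum]
  · refine Finset.sum_congr rfl fun c _ => ?_
    rw [hg.integral_eq_chart c (F := fun x => chartPartition n M c x * F x) ((hρ c).mul hF)
        fun x hx => by rw [chartPartition_eq_zero hx, zero_mul],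
      hg'.integral_eq_chart c (F := fun x => chartPartition n M c x * F x * volRatio g g' x)
        (((hρ c).mul hF).mul hR) fun x hx => by
        rw [chartPartition_eq_zero hx, zero_mul, zero_mul]]
    refine setIntegral_congr_fun (isOpen_extChartAt_target c).measurableSet fun y hy => ?_
    have h1 := inChart_volRatio g g' c hy
    have h2 := Real.sqrt_pos.2 ((hg'.isMetricOn c).det_pos hy)
    change _ * (inChart (chartPartition n M c) c y * inChart F c y)
      = _ * (inChart (chartPartition n M c) c y * inChart F c y * inChart (volRatio g g') c y)
    rw [h1]
    field_simp
  · exact fun c _ => hg'.integrable (((hρ c).mul hF).mul hR)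
  · exact fun c _ => hg.integrable ((hρ c).mul hF)

theorem IsSmoothFamily.continuousOn_integral {g : ℝ → SmoothMetric n M}
    (ht : t₀ < t₁) (hg : IsSmoothFamily t₀ t₁ g) {F : ℝ → M → ℝ} (hF : TimeSmooth n t₀ t₁ F) :
    ContinuousOn (fun t => ∫ x, F t x ∂(volumeMeasure (g t))) (Icc t₀ t₁) := by
  have h0 := hg.hasSmoothCoeff (left_mem_Icc.2 ht.le)
  have := h0.isFiniteMeasure
  refine ((hF.mul (hg.timeSmooth_volRatio h0)).continuousOn_integral
    (μ := volumeMeasure (g t₀))).congr fun t ht' => ?_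
  exact (hg.hasSmoothCoeff ht').integral_eq_integral_volRatio h0 (hF.chartSmooth ht').continuous

end MetricFamily

/-! ### Evolution of volume, gradients and integrals under the conformal Ricci flow -/

section FlowEvolution

set_option linter.unusedSectionVars false

open MeasureTheory Matrix Set

variable {m : ℕ} {t₀ t₁ t : ℝ} {M : Type*} [TopologicalSpace M]
  [ChartedSpace (EuclideanSpace ℝ (Fin (m + 1))) M] [IsManifold (𝓡 (m + 1)) ∞ M]
  {g : ℝ → SmoothMetric (m + 1) M} {p : ℝ → M → ℝ}

namespace IsConformalRicciFlow

theorem isSmoothFamily (hflow : IsConformalRicciFlow g p t₀ t₁) : IsSmoothFamily t₀ t₁ g :=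
  fun c i j => contDiffOn_pi.1 (contDiffOn_pi.1 (hflow.smooth_metric c) i) j

theorem hasSmoothCoeff (hflow : IsConformalRicciFlow g p t₀ t₁) (ht : t ∈ Icc t₀ t₁) :
    HasSmoothCoeff (g t) := hflow.isSmoothFamily.hasSmoothCoeff ht

theorem hasDerivAt_baseMatrix (hflow : IsConformalRicciFlow g p t₀ t₁) (ht : t ∈ Ioo t₀ t₁)
    (x : M) (i j : Fin (m + 1)) :
    HasDerivAt (fun s => baseMatrix (g s) x i j)
      (((-2 : ℝ) • (ricciAt (g t) x + ((m : ℝ) + p t x) • baseMatrix (g t) x)) i j) t := by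
  have h := (hflow.evolution t (Ioo_subset_Icc_self ht) x
    (EuclideanSpace.single i (1 : ℝ) : EuclideanSpace ℝ (Fin (m + 1)))
    (EuclideanSpace.single j (1 : ℝ) : EuclideanSpace ℝ (Fin (m + 1)))).hasDerivAt
      (Icc_mem_nhds ht.1 ht.2)
  have hR : Ric (g t) x (EuclideanSpace.single i (1 : ℝ) : EuclideanSpace ℝ (Fin (m + 1)))
      (EuclideanSpace.single j (1 : ℝ) : EuclideanSpace ℝ (Fin (m + 1))) = ricciAt (g t) x i j := by
    change ∑ k, ∑ l, ricciAt (g t) x k l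
      * (EuclideanSpace.single i (1 : ℝ) : EuclideanSpace ℝ (Fin (m + 1))) k
      * (EuclideanSpace.single j (1 : ℝ) : EuclideanSpace ℝ (Fin (m + 1))) l = _
    simp
  rw [hR] at h
  exact h

/-- The logarithmic derivative of √det g is ½ tr(g⁻¹∂_tg) = -(R + (m+1)(m+p)), and R = -m(m+1)
leaves -(m+1)p. -/
theorem hasDerivAt_volRatio (hflow : IsConformalRicciFlow g p t₀ t₁) (ht : t ∈ Ioo t₀ t₁)
    (g' : SmoothMetric (m + 1) M) (x : M) :
    HasDerivAt (fun s => volRatio (g s) g' x)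
      (-(((m : ℝ) + 1) * p t x * volRatio (g t) g' x)) t := by
  have hG := baseMatrix_posDef (g t) x
  have hdet := hG.det_pos
  have hs : ∀ k l, (baseMatrix (g t) x)⁻¹ k l = (baseMatrix (g t) x)⁻¹ l k := by
    have h := hG.inv.isHermitian
    rw [Matrix.IsHermitian, Matrix.conjTranspose_eq_transpose_of_trivial] at h
    exact fun k l => congrFun (congrFun h l) k
  have h1 := ((hasDerivAt_det (hflow.hasDerivAt_baseMatrix ht x) hdet.ne').sqrt hdet.ne').div_const
    (Real.sqrt (baseMatrix g' x).det)
  refine h1.congr_deriv ?_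
  have hscal := hflow.scalar t (Ioo_subset_Icc_self ht) x
  have htr : ((baseMatrix (g t) x)⁻¹ * ricciAt (g t) x).trace = scalarCurvature (g t) x := by
    simp only [Matrix.trace, Matrix.diag_apply, Matrix.mul_apply, scalarCurvature, invCoeffAt,
      coeff_self]
    rw [Finset.sum_comm]
    exact Finset.sum_congr rfl fun i _ => Finset.sum_congr rfl fun j _ => by rw [hs]
  have htr' : ((baseMatrix (g t) x)⁻¹ * ((-2 : ℝ) • (ricciAt (g t) x
      + ((m : ℝ) + p t x) • baseMatrix (g t) x))).trace = -2 * (((m : ℝ) + 1) * p t x) := by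
    rw [Matrix.mul_smul, Matrix.mul_add, Matrix.mul_smul,
      Matrix.nonsing_inv_mul _ (isUnit_iff_ne_zero.2 hdet.ne'), Matrix.trace_smul,
      Matrix.trace_add, htr, hscal, Matrix.trace_smul, Matrix.trace_one]
    simp only [smul_eq_mul, Fintype.card_fin]
    push_cast
    ring
  rw [htr', volRatio]
  have h0 := Real.sqrt_pos.2 hdet
  have h0' := Real.sqrt_pos.2 (baseMatrix_posDef g' x).det_pos
  have hsq := Real.mul_self_sqrt hdet.le
  have hsq' : (baseMatrix (g t) x).det / Real.sqrt (baseMatrix (g t) x).det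
      = Real.sqrt (baseMatrix (g t) x).det := Real.div_sqrt
  calc _ = -(((m : ℝ) + 1) * p t x) * ((baseMatrix (g t) x).det
        / Real.sqrt (baseMatrix (g t) x).det) / Real.sqrt (baseMatrix g' x).det := by
        field_simp
    _ = _ := by rw [hsq']; ring

/-- The derivative of g⁻¹ is -g⁻¹(∂_tg)g⁻¹, so the curvature terms of the flow reappear with the
opposite sign, evaluated on ∇v. The last term comes from commuting ∂_t with the spatial derivatives.
-/
theorem hasDerivAt_gradInner (ht' : t₀ < t₁) (hflow : IsConformalRicciFlow g p t₀ t₁)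
    (ht : t ∈ Ioo t₀ t₁) {v : ℝ → M → ℝ} (hv : TimeSmooth (m + 1) t₀ t₁ v) (x : M) :
    HasDerivAt (fun s => gradInner (g s) (v s) (v s) x)
      (2 * Ric (g t) x (gradAt (g t) (v t) x) (gradAt (g t) (v t) x)
        + 2 * ((m : ℝ) + p t x) * gradInner (g t) (v t) (v t) x
        + 2 * gradInner (g t) (v t) (timeDeriv t₀ t₁ v t) x) t := by
  have hg := hflow.hasSmoothCoeff (Ioo_subset_Icc_self ht)
  have hG := baseMatrix_posDef (g t) x
  have hsymm : (baseMatrix (g t) x).IsSymm := by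
    have h := hG.isHermitian
    rwa [Matrix.IsHermitian, Matrix.conjTranspose_eq_transpose_of_trivial] at h
  have hd := hv.hasDerivAt_dvec ht' ht x
  have h := hasDerivAt_dotProduct_inv_mulVec (hflow.hasDerivAt_baseMatrix ht x) hG.det_pos.ne'
    hsymm hd hd
  have hfun : (fun s => gradInner (g s) (v s) (v s) x) = fun s =>
      dvec (inChart (v s) x) (extChartAt (𝓡 (m + 1)) x x) ⬝ᵥ
        ((baseMatrix (g s) x)⁻¹ *ᵥ dvec (inChart (v s) x) (extChartAt (𝓡 (m + 1)) x x)) := by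
    funext s
    rw [gradInner, coGrad, coeff_self]
  rw [hfun]
  refine h.congr_deriv ?_
  have ha : (baseMatrix (g t) x)⁻¹ *ᵥ dvec (inChart (v t) x) (extChartAt (𝓡 (m + 1)) x x)
      = (gradAt (g t) (v t) x).ofLp := by
    rw [gradAt, gradVec, coeff_self]
  have e1 : (baseMatrix (g t) x)⁻¹ *ᵥ dvec (inChart (v t) x) (extChartAt (𝓡 (m + 1)) x x) ⬝ᵥ
      dvec (inChart (timeDeriv t₀ t₁ v t) x) (extChartAt (𝓡 (m + 1)) x x)
      = gradInner (g t) (v t) (timeDeriv t₀ t₁ v t) x := by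
    rw [gradInner, (hg.isMetricOn x).coGrad_eq (mem_extChartAt_target x), gradVec, coeff_self]
  have e2 : Ric (g t) x (gradAt (g t) (v t) x) (gradAt (g t) (v t) x)
      = (gradAt (g t) (v t) x).ofLp ⬝ᵥ (ricciAt (g t) x *ᵥ (gradAt (g t) (v t) x).ofLp) := by
    simp only [dotProduct, mulVec, Finset.mul_sum]
    change ∑ k, ∑ l, ricciAt (g t) x k l * (gradAt (g t) (v t) x) k * (gradAt (g t) (v t) x) l = _
    exact Finset.sum_congr rfl fun i _ => Finset.sum_congr rfl fun j _ => by ring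
  have e3 : gradInner (g t) (v t) (v t) x
      = (gradAt (g t) (v t) x).ofLp ⬝ᵥ (baseMatrix (g t) x *ᵥ (gradAt (g t) (v t) x).ofLp) := by
    rw [gradInner, (hg.isMetricOn x).coGrad_eq (mem_extChartAt_target x), gradVec, coeff_self, ← ha,
      Matrix.mulVec_mulVec, Matrix.mul_nonsing_inv _ (isUnit_iff_ne_zero.2 hG.det_pos.ne'),
      Matrix.one_mulVec]
  rw [dotProduct_comm (dvec (inChart (timeDeriv t₀ t₁ v t) x) _), e1, ha, e2, e3,
    Matrix.smul_mulVec, Matrix.add_mulVec, Matrix.smul_mulVec, dotProduct_smul, dotProduct_add,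
    dotProduct_smul]
  simp only [smul_eq_mul]
  ring

variable [MeasurableSpace M] [BorelSpace M] [T2Space M] [CompactSpace M]

/-- The evolution of integrals under the conformal Ricci flow. -/
theorem hasDerivAt_integral (ht' : t₀ < t₁) (hflow : IsConformalRicciFlow g p t₀ t₁)
    (ht : t ∈ Ioo t₀ t₁) {F : ℝ → M → ℝ} (hF : TimeSmooth (m + 1) t₀ t₁ F) :
    HasDerivAt (fun s => ∫ x, F s x ∂(volumeMeasure (g s)))
      (∫ x, (timeDeriv t₀ t₁ F t x - ((m : ℝ) + 1) * p t x * F t x) ∂(volumeMeasure (g t))) t := by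
  have hg := hflow.isSmoothFamily
  have h0 := hg.hasSmoothCoeff (left_mem_Icc.2 ht'.le)
  have htm := Ioo_subset_Icc_self ht
  have := h0.isFiniteMeasure
  have hR := hg.timeSmooth_volRatio h0
  have hp := timeSmooth_of_smoothOn hflow.smooth_pressure
  have h1 := (hF.mul hR).hasDerivAt_integral (μ := volumeMeasure (g t₀)) ht' ht
  have hcont : Continuous fun x => timeDeriv t₀ t₁ F t x - ((m : ℝ) + 1) * p t x * F t x :=
    (((hF.timeDeriv ht').chartSmooth htm).sub
      (((chartSmooth_const ((m : ℝ) + 1)).mul (hp.chartSmooth htm)).mul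
        (hF.chartSmooth htm))).continuous
  rw [(hg.hasSmoothCoeff htm).integral_eq_integral_volRatio h0 hcont]
  have hder : ∀ x, timeDeriv t₀ t₁ (fun t x => F t x * volRatio (g t) (g t₀) x) t x
      = (timeDeriv t₀ t₁ F t x - ((m : ℝ) + 1) * p t x * F t x) * volRatio (g t) (g t₀) x := by
    intro x
    refine ((hF.mul hR).hasDerivAt ht x).unique ?_
    refine ((hF.hasDerivAt ht x).mul (hflow.hasDerivAt_volRatio ht (g t₀) x)).congr_deriv ?_
    ring
  simp only [hder] at h1
  refine h1.congr_of_eventuallyEq ?_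
  filter_upwards [isOpen_Ioo.mem_nhds ht] with s hs
  exact (hg.hasSmoothCoeff (Ioo_subset_Icc_self hs)).integral_eq_integral_volRatio h0
    (hF.chartSmooth (Ioo_subset_Icc_self hs)).continuous

end IsConformalRicciFlow

end FlowEvolution

/-! ### The weighted measure -/

section WeightedMeasure

set_option linter.unusedSectionVars false

open MeasureTheory Matrix Set

variable {m : ℕ} {t₀ t₁ T t : ℝ} {M : Type*} [TopologicalSpace M]
  [ChartedSpace (EuclideanSpace ℝ (Fin (m + 1))) M] [IsManifold (𝓡 (m + 1)) ∞ M]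
  {g : ℝ → SmoothMetric (m + 1) M} {p f v : ℝ → M → ℝ}

theorem weight_pos (hT : t < T) (f : ℝ → M → ℝ) (x : M) : 0 < weight m T f t x :=
  mul_pos (Real.rpow_pos_of_pos (mul_pos (by positivity) (sub_pos.2 hT)) _) (Real.exp_pos _)

theorem timeSmooth_weight (hT : t₁ < T) (hf : TimeSmooth (m + 1) t₀ t₁ f) :
    TimeSmooth (m + 1) t₀ t₁ (weight m T f) := by
  intro c
  refine ContDiffOn.mul ?_ (hf c).neg.exp
  refine ContDiffOn.rpow_const_of_ne ?_ fun q hq => ?_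
  · exact (contDiff_const.mul (contDiff_const.sub contDiff_fst)).contDiffOn
  · have : 0 < T - q.1 := sub_pos.2 (hq.1.2.trans_lt hT)
    positivity

/-- The power of T - t is constant in space, so ∇H = -H∇f. -/
theorem gradInner_weight (g : SmoothMetric (m + 1) M) (hf : ChartSmooth (m + 1) (f t))
    (w : M → ℝ) (x : M) :
    gradInner g (weight m T f t) w x = -(weight m T f t x * gradInner g (f t) w x) := by
  have h : dvec (inChart (weight m T f t) x) (extChartAt (𝓡 (m + 1)) x x)
      = (-weight m T f t x) • dvec (inChart (f t) x) (extChartAt (𝓡 (m + 1)) x x) := by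
    funext i
    have hd := (hf.differentiableAt x).hasFDerivAt
    have h1 := (hd.neg.exp).const_mul ((4 * Real.pi * (T - t)) ^ (-(((m : ℝ) + 1) / 2)))
    have h2 : HasFDerivAt (inChart (weight m T f t) x) _ (extChartAt (𝓡 (m + 1)) x x) := h1
    have h3 : inChart (f t) x (extChartAt (𝓡 (m + 1)) x x) = f t x := by
      rw [inChart, extChartAt_to_inv]
    simp only [dvec, pderiv, h2.fderiv, Pi.smul_apply, smul_eq_mul, weight]
    simp only [_root_.smul_apply, _root_.neg_apply, Pi.neg_apply, smul_eq_mul, h3]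
    ring
  rw [gradInner, coGrad, h, smul_dotProduct, smul_eq_mul, neg_mul]
  rfl

variable [MeasurableSpace M] [BorelSpace M] [T2Space M] [CompactSpace M]

/-- Green's formula for the weighted measure. -/
theorem integral_gradInner_mul_weight (hg : HasSmoothCoeff (g t)) (hf : ChartSmooth (m + 1) (f t))
    (hH : ChartSmooth (m + 1) (weight m T f t)) {a b : M → ℝ} (ha : ChartSmooth (m + 1) a)
    (hb : ChartSmooth (m + 1) b) :
    ∫ x, gradInner (g t) a b x * weight m T f t x ∂(volumeMeasure (g t))
      = -∫ x, a x * (laplacian (g t) b x - gradInner (g t) (f t) b x) * weight m T f t x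
        ∂(volumeMeasure (g t)) := by
  have h1 := hg.integral_gradInner (ha.mul hH) hb
  have hInt : ∀ {u : M → ℝ}, ChartSmooth (m + 1) u → Integrable u (volumeMeasure (g t)) :=
    fun hu => hg.integrable hu.continuous
  have hab := hg.chartSmooth_gradInner ha hb
  have hfb := hg.chartSmooth_gradInner hf hb
  have hΔ := hg.chartSmooth_laplacian hb
  have e1 : ∀ x, gradInner (g t) (fun x => a x * weight m T f t x) b x
      = gradInner (g t) a b x * weight m T f t x
        - a x * gradInner (g t) (f t) b x * weight m T f t x := by
    intro x
    rw [gradInner_mul_left (g t) ha hH, gradInner_weight (g t) hf]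
    ring
  have e2 : ∀ x, a x * (laplacian (g t) b x - gradInner (g t) (f t) b x) * weight m T f t x
      = a x * weight m T f t x * laplacian (g t) b x
        - a x * gradInner (g t) (f t) b x * weight m T f t x := by
    intro x
    ring
  simp only [e1] at h1
  simp only [e2]
  rw [integral_sub (hInt (hab.mul hH)) (hInt ((ha.mul hfb).mul hH))] at h1
  rw [integral_sub (hInt ((ha.mul hH).mul hΔ)) (hInt ((ha.mul hfb).mul hH))]
  linarith

/-- The evolution of integrals against the weighted measure. -/
theorem hasDerivAt_integral_mul_weight (ht' : t₀ < t₁) (hT : t₁ < T)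
    (hflow : IsConformalRicciFlow g p t₀ t₁) (hf : TimeSmooth (m + 1) t₀ t₁ f)
    (hH : IsConjugateHeatSolution g p T f t₀ t₁) (ht : t ∈ Ioo t₀ t₁) {u : ℝ → M → ℝ}
    (hu : TimeSmooth (m + 1) t₀ t₁ u) :
    HasDerivAt (fun s => ∫ x, u s x * weight m T f s x ∂(volumeMeasure (g s)))
      (∫ x, (timeDeriv t₀ t₁ u t x - gradInner (g t) (f t) (u t) x) * weight m T f t x
        ∂(volumeMeasure (g t))) t := by
  have htm := Ioo_subset_Icc_self ht
  have hg := hflow.hasSmoothCoeff htm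
  have hW := timeSmooth_weight hT hf
  have hWt := hW.chartSmooth htm
  have hut := hu.chartSmooth htm
  have hut' := (hu.timeDeriv ht').chartSmooth htm
  have hInt : ∀ {u : M → ℝ}, ChartSmooth (m + 1) u → Integrable u (volumeMeasure (g t)) :=
    fun hu => hg.integrable hu.continuous
  refine (hflow.hasDerivAt_integral ht' ht (hu.mul hW)).congr_deriv ?_
  -- The term (m+1)pH of the conjugate heat equation cancels the loss of volume. The remaining -uΔH
  -- is integrated by parts once, which gives ⟨∇u,∇H⟩ = -⟨∇f,∇u⟩H.
  have e1 : ∀ x, timeDeriv t₀ t₁ (fun t x => u t x * weight m T f t x) t x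
      - ((m : ℝ) + 1) * p t x * (u t x * weight m T f t x)
      = timeDeriv t₀ t₁ u t x * weight m T f t x
        - u t x * laplacian (g t) (weight m T f t) x := by
    intro x
    have h1 := ((hu.mul hW).hasDerivAt ht x).unique ((hu.hasDerivAt ht x).mul (hW.hasDerivAt ht x))
    rw [h1, hH t htm x]
    ring
  have e2 : ∀ x, gradInner (g t) (u t) (weight m T f t) x
      = -(gradInner (g t) (f t) (u t) x * weight m T f t x) := by
    intro x
    rw [hg.gradInner_comm, gradInner_weight (g t) (hf.chartSmooth htm)]
    ring
  have h2 := hg.integral_gradInner hut hWt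
  simp only [e2, integral_neg] at h2
  simp only [e1, sub_mul]
  rw [integral_sub (hInt (hut'.mul hWt)) (hInt (hut.mul (hg.chartSmooth_laplacian hWt))),
    integral_sub (hInt (hut'.mul hWt))
      (hInt ((hg.chartSmooth_gradInner (hf.chartSmooth htm) hut).mul hWt))]
  linarith

/-- The derivative of `∫ v² dV`. -/
theorem hasDerivAt_energyI (ht' : t₀ < t₁) (hT : t₁ < T)
    (hflow : IsConformalRicciFlow g p t₀ t₁) (hf : TimeSmooth (m + 1) t₀ t₁ f)
    (hH : IsConjugateHeatSolution g p T f t₀ t₁) (hv : TimeSmooth (m + 1) t₀ t₁ v)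
    (ht : t ∈ Ioo t₀ t₁) :
    HasDerivAt (energyI g T f v)
      (2 * ∫ x, v t x * (timeDeriv t₀ t₁ v t x - gradInner (g t) (f t) (v t) x)
        * weight m T f t x ∂(volumeMeasure (g t))) t := by
  have htm := Ioo_subset_Icc_self ht
  have hg := hflow.hasSmoothCoeff htm
  have hvt := hv.chartSmooth htm
  have h := hasDerivAt_integral_mul_weight ht' hT hflow hf hH ht (hv.mul hv)
  have hE : energyI g T f v
      = fun s => ∫ x, v s x * v s x * weight m T f s x ∂(volumeMeasure (g s)) := by
    funext s
    simp only [energyI, sq]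
  rw [hE]
  refine h.congr_deriv ?_
  rw [← integral_const_mul]
  refine integral_congr_ae (Filter.Eventually.of_forall fun x => ?_)
  have h1 := ((hv.mul hv).hasDerivAt ht x).unique ((hv.hasDerivAt ht x).mul (hv.hasDerivAt ht x))
  simp only
  rw [h1, hg.gradInner_comm (f t), gradInner_mul_left (g t) hvt hvt, hg.gradInner_comm (v t) (f t)]
  ring

theorem gradInner_self_nonneg (g : SmoothMetric (m + 1) M) (u : M → ℝ) (x : M) :
    0 ≤ gradInner g u u x := by
  rw [gradInner, coGrad, coeff_self]
  simpa using (baseMatrix_posDef g x).inv.posSemidef.dotProduct_mulVec_nonneg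
    (dvec (inChart u x) (extChartAt (𝓡 (m + 1)) x x))

theorem inner_gradAt (hg : HasSmoothCoeff (g t)) (u : M → ℝ) (x : M) :
    (g t).inner x (gradAt (g t) u x) (gradAt (g t) u x) = gradInner (g t) u u x := by
  change bform (g t) x (gradAt (g t) u x) (gradAt (g t) u x) = _
  have hG := baseMatrix_posDef (g t) x
  have e3 : gradInner (g t) u u x
      = (gradAt (g t) u x).ofLp ⬝ᵥ (baseMatrix (g t) x *ᵥ (gradAt (g t) u x).ofLp) := by
    rw [gradInner, (hg.isMetricOn x).coGrad_eq (mem_extChartAt_target x), gradAt, gradVec,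
      coeff_self, Matrix.mulVec_mulVec,
      Matrix.mul_nonsing_inv _ (isUnit_iff_ne_zero.2 hG.det_pos.ne'), Matrix.one_mulVec]
  rw [e3, bform_eq_sum]
  simp only [dotProduct, mulVec, Finset.mul_sum, baseMatrix, Matrix.of_apply]
  exact Finset.sum_congr rfl fun i _ => Finset.sum_congr rfl fun j _ => by ring

theorem le_pbar (hp : TimeSmooth (m + 1) t₀ t₁ p) (ht : t ∈ Icc t₀ t₁) (x : M) :
    p t x ≤ pbar p t :=
  le_ciSup (isCompact_range (hp.chartSmooth ht).continuous).bddAbove x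

/-- The derivative of `∫ |∇v|² dV`. -/
theorem exists_hasDerivAt_integral_gradSq (ht' : t₀ < t₁) (hT : t₁ < T)
    (hflow : IsConformalRicciFlow g p t₀ t₁) (hf : TimeSmooth (m + 1) t₀ t₁ f)
    (hH : IsConjugateHeatSolution g p T f t₀ t₁) (hv : TimeSmooth (m + 1) t₀ t₁ v)
    (ht : t ∈ Ioo t₀ t₁) {κ : ℝ}
    (hRic : ∀ (x : M) (X : TangentSpace (𝓡 (m + 1)) x),
      bakryEmery (g t) (f t) x X X
        ≤ (κ + scalarCurvature (g t) x / ((m : ℝ) + 1)) * (g t).inner x X X) :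
    ∃ D', HasDerivAt (fun s => ∫ x, gradInner (g s) (v s) (v s) x * weight m T f s x
        ∂(volumeMeasure (g s))) D' t ∧
      D' ≤ (2 * κ + 2 * pbar p t) * (∫ x, gradInner (g t) (v t) (v t) x * weight m T f t x
          ∂(volumeMeasure (g t)))
        - 2 * ∫ x, (timeDeriv t₀ t₁ v t x - gradInner (g t) (f t) (v t) x)
          * (laplacian (g t) (v t) x - gradInner (g t) (f t) (v t) x) * weight m T f t x
            ∂(volumeMeasure (g t)) := by
  have htm := Ioo_subset_Icc_self ht
  have hg := hflow.hasSmoothCoeff htm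
  have hvt := hv.chartSmooth htm
  have hft := hf.chartSmooth htm
  have hWt := (timeSmooth_weight hT hf).chartSmooth htm
  have hvt' := (hv.timeDeriv ht').chartSmooth htm
  have hfv := hg.chartSmooth_gradInner hft hvt
  have hvv := hg.chartSmooth_gradInner hvt hvt
  have hp := timeSmooth_of_smoothOn hflow.smooth_pressure
  have hΓ := hflow.isSmoothFamily.timeSmooth_gradInner ht' hv hv
  have hInt : ∀ {u : M → ℝ}, ChartSmooth (m + 1) u → Integrable u (volumeMeasure (g t)) :=
    fun hu => hg.integrable hu.continuous
  refine ⟨_, hasDerivAt_integral_mul_weight ht' hT hflow hf hH ht hΓ, ?_⟩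
  set φ : M → ℝ := fun x => timeDeriv t₀ t₁ v t x - gradInner (g t) (f t) (v t) x with hφ
  have hφs : ChartSmooth (m + 1) φ := hvt'.sub hfv
  -- Green's formula rewrites -∫φψ dV as ∫⟨∇φ,∇v⟩ dV. Then both sides are integrals of functions
  -- that can be compared pointwise.
  have hgreen := integral_gradInner_mul_weight hg hft hWt hφs hvt
  have hrhs : (2 * κ + 2 * pbar p t) * (∫ x, gradInner (g t) (v t) (v t) x * weight m T f t x
          ∂(volumeMeasure (g t)))
        - 2 * ∫ x, φ x * (laplacian (g t) (v t) x - gradInner (g t) (f t) (v t) x)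
          * weight m T f t x ∂(volumeMeasure (g t))
      = ∫ x, ((2 * κ + 2 * pbar p t) * (gradInner (g t) (v t) (v t) x * weight m T f t x)
          + 2 * (gradInner (g t) φ (v t) x * weight m T f t x)) ∂(volumeMeasure (g t)) := by
    rw [integral_add (hInt ((chartSmooth_const _).mul (hvv.mul hWt)))
      (hInt ((chartSmooth_const 2).mul ((hg.chartSmooth_gradInner hφs hvt).mul hWt))),
      integral_const_mul, integral_const_mul, hgreen]
    ring
  rw [hrhs]
  refine integral_mono (hInt ((((hΓ.timeDeriv ht').chartSmooth htm).sub
    (hg.chartSmooth_gradInner hft hvv)).mul hWt))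
    (hInt (((chartSmooth_const _).mul (hvv.mul hWt)).add
      ((chartSmooth_const 2).mul ((hg.chartSmooth_gradInner hφs hvt).mul hWt)))) fun x => ?_
  simp only
  have hW0 := weight_pos (htm.2.trans_lt hT) f x (m := m)
  have h1 := (hΓ.hasDerivAt ht x).unique (hflow.hasDerivAt_gradInner ht' ht hv x)
  -- The drift term -⟨∇f,∇|∇v|²⟩ equals 2Hess f(∇v,∇v) - 2⟨∇v,∇⟨∇f,∇v⟩⟩. The Hessian joins Ric to
  -- form the Bakry–Émery tensor, and the other term joins ∇v_t to form ∇φ.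
  have h2 := hg.two_mul_hess_grad hft hvt x
  have h3 : Ric (g t) x (gradAt (g t) (v t) x) (gradAt (g t) (v t) x)
      + Hess (g t) (f t) x (gradAt (g t) (v t) x) (gradAt (g t) (v t) x) ≤ _ :=
    hRic x (gradAt (g t) (v t) x)
  rw [inner_gradAt hg, hflow.scalar t htm x] at h3
  have h4 : gradInner (g t) φ (v t) x = gradInner (g t) (v t) (timeDeriv t₀ t₁ v t) x
      - gradInner (g t) (v t) (gradInner (g t) (f t) (v t)) x := by
    have h5 := gradInner_add_left (g t) hφs hfv (v t) x
    have h6 : (fun x => φ x + gradInner (g t) (f t) (v t) x) = timeDeriv t₀ t₁ v t := by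
      funext x
      simp [hφ]
    rw [h6] at h5
    rw [hg.gradInner_comm (v t) (timeDeriv t₀ t₁ v t),
      hg.gradInner_comm (v t) (gradInner (g t) (f t) (v t)), h5]
    ring
  rw [h1, h4]
  have h0 := gradInner_self_nonneg (g t) (v t) x
  have hm1 : ((m : ℝ) + 1) ≠ 0 := by positivity
  -- The constant scalar curvature turns R/(m+1) into -m, which cancels the m in the flow's m + p
  -- and leaves p ≤ p̄.
  have h7 : (κ + -((m : ℝ) * ((m : ℝ) + 1)) / ((m : ℝ) + 1)) = κ - m := by
    field_simp
    ring
  rw [h7] at h3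
  have h8 : p t x * gradInner (g t) (v t) (v t) x ≤ pbar p t * gradInner (g t) (v t) (v t) x :=
    mul_le_mul_of_nonneg_right (le_pbar hp htm x) h0
  have h9 : 2 * Ric (g t) x (gradAt (g t) (v t) x) (gradAt (g t) (v t) x)
        + 2 * ((m : ℝ) + p t x) * gradInner (g t) (v t) (v t) x
        + 2 * gradInner (g t) (v t) (timeDeriv t₀ t₁ v t) x
        - gradInner (g t) (f t) (gradInner (g t) (v t) (v t)) x
      ≤ (2 * κ + 2 * pbar p t) * gradInner (g t) (v t) (v t) x
        + 2 * (gradInner (g t) (v t) (timeDeriv t₀ t₁ v t) x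
          - gradInner (g t) (v t) (gradInner (g t) (f t) (v t)) x) := by
    linarith
  have h10 := mul_le_mul_of_nonneg_right h9 hW0.le
  linarith

end WeightedMeasure

/-! ### The differential inequality for the frequency -/

section FrequencyODE

open Set

theorem hasDerivAt_primitive {φ : ℝ → ℝ} {t₀ t₁ t : ℝ} (hφ : ContinuousOn φ (Icc t₀ t₁))
    (ht : t ∈ Ioo t₀ t₁) : HasDerivAt (fun r => ∫ s in t₀..r, φ s) (φ t) t := by
  have hsub : Icc t₀ t ⊆ Icc t₀ t₁ := Icc_subset_Icc_right ht.2.le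
  refine intervalIntegral.integral_hasDerivAt_right ?_ ?_ ?_
  · exact (hφ.mono (by rwa [uIcc_of_le ht.1.le])).intervalIntegrable
  · exact (hφ.mono Ioo_subset_Icc_self).stronglyMeasurableAtFilter isOpen_Ioo t ht
  · exact hφ.continuousAt (Icc_mem_nhds ht.1 ht.2)

theorem continuousOn_primitive {φ : ℝ → ℝ} {t₀ t₁ : ℝ} (ht : t₀ ≤ t₁)
    (hφ : ContinuousOn φ (Icc t₀ t₁)) :
    ContinuousOn (fun r => ∫ s in t₀..r, φ s) (Icc t₀ t₁) := by
  have h := intervalIntegral.continuousOn_primitive_interval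
    (μ := MeasureTheory.volume) (f := φ) (a := t₀) (b := t₁)
    (by rw [uIcc_of_le ht]; exact hφ.integrableOn_Icc)
  rwa [uIcc_of_le ht] at h

/-- The data of the differential inequalities satisfied by `I = ∫ v² dV` and `D = ∫ |∇v|² dV`. -/
structure FrequencyData (t₀ t₁ P : ℝ) (I D h k q θ A B : ℝ → ℝ) : Prop where
  contI : ContinuousOn I (Icc t₀ t₁)
  contD : ContinuousOn D (Icc t₀ t₁)
  conth : ContinuousOn h (Icc t₀ t₁)
  contθ : ContinuousOn θ (Icc t₀ t₁)
  contA : ContinuousOn A (Icc t₀ t₁)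
  contB : ContinuousOn B (Icc t₀ t₁)
  I_nonneg : ∀ t ∈ Icc t₀ t₁, 0 ≤ I t
  D_nonneg : ∀ t ∈ Icc t₀ t₁, 0 ≤ D t
  h_pos : ∀ t ∈ Icc t₀ t₁, 0 < h t
  k_nonneg : ∀ t ∈ Icc t₀ t₁, 0 ≤ k t
  q_nonneg : ∀ t ∈ Icc t₀ t₁, 0 ≤ q t
  q_le : ∀ t ∈ Icc t₀ t₁, q t ≤ P
  deriv_h : ∀ t ∈ Ioo t₀ t₁, ∃ h', HasDerivAt h h' t ∧
    HasDerivAt θ (2 * q t + (h' + k t) / h t) t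
  -- A and B are prescribed only up to additive constants; only their differences are used below.
  deriv_A : ∀ t ∈ Ioo t₀ t₁, HasDerivAt A (q t ^ 2) t
  deriv_B : ∀ t ∈ Ioo t₀ t₁, HasDerivAt B (1 / h t * Real.exp (θ t)) t
  deriv_I : ∀ t ∈ Ioo t₀ t₁, ∃ I' D', HasDerivAt I I' t ∧ HasDerivAt D D' t ∧
    -(2 + q t) * D t - 3 * q t * I t ≤ I' ∧
    D' * I t - D t * I' ≤ ((k t / h t + 2 * q t) * D t + q t ^ 2 * (I t + D t)) * I t

namespace FrequencyData

variable {t₀ t₁ P : ℝ} {I D h k q θ A B : ℝ → ℝ} {a b : ℝ}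

theorem antitoneOn_of_hasDerivAt {F : ℝ → ℝ} (hF : ContinuousOn F (Icc a b))
    (hd : ∀ t ∈ Ioo a b, ∃ F', HasDerivAt F F' t ∧ F' ≤ 0) : AntitoneOn F (Icc a b) := by
  refine antitoneOn_of_deriv_nonpos (convex_Icc a b) hF ?_ ?_
  · rw [interior_Icc]
    intro t ht
    obtain ⟨F', hF', -⟩ := hd t ht
    exact hF'.differentiableAt.differentiableWithinAt
  · rw [interior_Icc]
    intro t ht
    obtain ⟨F', hF', h0⟩ := hd t ht
    rwa [hF'.deriv]

/-- The derivative is -(2qh + k)e^{-θ}: the h' in θ' cancels the derivative of h. The signs of q and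
k enter here. -/
theorem antitoneOn_exp (hd : FrequencyData t₀ t₁ P I D h k q θ A B) :
    AntitoneOn (fun t => h t * Real.exp (-θ t)) (Icc t₀ t₁) := by
  refine antitoneOn_of_hasDerivAt (hd.conth.mul hd.contθ.neg.rexp) fun t ht => ?_
  have htm := Ioo_subset_Icc_self ht
  obtain ⟨h', hh', hθ'⟩ := hd.deriv_h t ht
  refine ⟨_, hh'.mul hθ'.neg.exp, ?_⟩
  have hp := hd.h_pos t htm
  have hq := hd.q_nonneg t htm
  have hk := hd.k_nonneg t htm
  have he := Real.exp_pos (-θ t)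
  have : h' * Real.exp (-θ t) + h t * (Real.exp (-θ t) * -(2 * q t + (h' + k t) / h t))
      = -(Real.exp (-θ t) * (2 * q t * h t + k t)) := by
    field_simp
    ring
  rw [Pi.neg_apply, this, neg_nonpos]
  positivity

/-- The frequency grows at most like `exp A`. -/
theorem frequency_le (hd : FrequencyData t₀ t₁ P I D h k q θ A B) (ha : a ∈ Icc t₀ t₁)
    (hb : b ∈ Icc a t₁) (hI : ∀ t ∈ Icc a b, 0 < I t) :
    h b * D b / I b * Real.exp (-θ b) ≤ (h a * D a / I a * Real.exp (-θ a)
      + h a * Real.exp (-θ a)) * Real.exp (A b - A a) := by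
  have hsub : Icc a b ⊆ Icc t₀ t₁ := Icc_subset_Icc ha.1 hb.2
  -- By `antitoneOn_exp`, z bounds h e^{-θ} at all later times. Hence Q' ≤ q²(Q + z), which is
  -- homogeneous in Q + z, and (Q + z)e^{-A} is nonincreasing.
  set z := h a * Real.exp (-θ a) with hz
  have hanti : AntitoneOn (fun t => (h t * D t / I t * Real.exp (-θ t) + z) * Real.exp (-A t))
      (Icc a b) := by
    refine antitoneOn_of_hasDerivAt ?_ fun t ht => ?_
    · exact (((((hd.conth.mono hsub).mul (hd.contD.mono hsub)).div (hd.contI.mono hsub)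
        fun t ht => (hI t ht).ne').mul (hd.contθ.mono hsub).neg.rexp).add continuousOn_const).mul
          (hd.contA.mono hsub).neg.rexp
    have htab := Ioo_subset_Icc_self ht
    have ht0 : t ∈ Ioo t₀ t₁ := ⟨ha.1.trans_lt ht.1, ht.2.trans_le hb.2⟩
    have htm := Ioo_subset_Icc_self ht0
    obtain ⟨h', hh', hθ'⟩ := hd.deriv_h t ht0
    obtain ⟨I', D', hI', hD', -, hineq⟩ := hd.deriv_I t ht0
    have hIt := hI t htab
    refine ⟨_, ((((hh'.mul hD').div hI' hIt.ne').mul hθ'.neg.exp).add_const z).mul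
      (hd.deriv_A t ht0).neg.exp, ?_⟩
    have hp := hd.h_pos t htm
    have hzt : h t * Real.exp (-θ t) ≤ z := hd.antitoneOn_exp ha htm htab.1
    have hE := Real.exp_pos (-θ t)
    have hEA := Real.exp_pos (-A t)
    -- This is Q' ≤ q²(Q + h e^{-θ}). The choice of θ' removes h'/h from the derivative of h, and
    -- k/h + 2q from the bound for D'I - DI'.
    have hcore : ((h' * D t + h t * D') * I t - h t * D t * I') / I t ^ 2 * Real.exp (-θ t)
          + h t * D t / I t * (Real.exp (-θ t) * -(2 * q t + (h' + k t) / h t))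
        ≤ q t ^ 2 * (h t * D t / I t * Real.exp (-θ t) + h t * Real.exp (-θ t)) := by
      have e1 : ((h' * D t + h t * D') * I t - h t * D t * I') / I t ^ 2 * Real.exp (-θ t)
          + h t * D t / I t * (Real.exp (-θ t) * -(2 * q t + (h' + k t) / h t))
          = Real.exp (-θ t) * h t / I t ^ 2 *
            ((D' * I t - D t * I') - (k t / h t + 2 * q t) * D t * I t) := by
        field_simp
        ring
      have e2 : q t ^ 2 * (h t * D t / I t * Real.exp (-θ t) + h t * Real.exp (-θ t))
          = Real.exp (-θ t) * h t / I t ^ 2 * (q t ^ 2 * (I t + D t) * I t) := by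
        field_simp
        ring
      rw [e1, e2]
      refine mul_le_mul_of_nonneg_left ?_ (by positivity)
      linarith
    have hq2 : q t ^ 2 * (h t * Real.exp (-θ t)) ≤ q t ^ 2 * z :=
      mul_le_mul_of_nonneg_left hzt (sq_nonneg _)
    simp only [Pi.mul_apply, Pi.div_apply, Pi.neg_apply]
    have hfin : ((h' * D t + h t * D') * I t - h t * D t * I') / I t ^ 2 * Real.exp (-θ t)
          + h t * D t / I t * (Real.exp (-θ t) * -(2 * q t + (h' + k t) / h t))
          - q t ^ 2 * (h t * D t / I t * Real.exp (-θ t) + z) ≤ 0 := by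
      linarith
    have := mul_nonpos_of_nonpos_of_nonneg hfin hEA.le
    linarith
  have h1 := hanti (left_mem_Icc.2 hb.1) (right_mem_Icc.2 hb.1) hb.1
  simp only at h1
  have hz0 : 0 < z := mul_pos (hd.h_pos a ha) (Real.exp_pos _)
  have h2 : (h b * D b / I b * Real.exp (-θ b) + z)
      ≤ (h a * D a / I a * Real.exp (-θ a) + z) * Real.exp (A b - A a) := by
    have h3 := mul_le_mul_of_nonneg_right h1 (Real.exp_pos (A b)).le
    rw [mul_assoc, mul_assoc, ← Real.exp_add, ← Real.exp_add] at h3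
    simpa [sub_eq_neg_add] using h3
  linarith

theorem monotoneOn_A (hd : FrequencyData t₀ t₁ P I D h k q θ A B) :
    MonotoneOn A (Icc t₀ t₁) := by
  have : AntitoneOn (fun t => -A t) (Icc t₀ t₁) :=
    antitoneOn_of_hasDerivAt hd.contA.neg fun t ht =>
      ⟨_, (hd.deriv_A t ht).neg, neg_nonpos.2 (sq_nonneg _)⟩
  exact fun x hx y hy hxy => neg_le_neg_iff.1 (this hx hy hxy)

/-- The exponent in the lower bound for `I`. -/
def lossExponent (P : ℝ) (I D h θ A B : ℝ → ℝ) (a t₁ b : ℝ) : ℝ :=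
  3 * (b - a) * P + (2 + P) * (h a * D a / I a * Real.exp (-θ a) + h a * Real.exp (-θ a))
    * Real.exp (A t₁ - A a) * (B b - B a)

/-- Where I is positive, (log I)' ≥ -(2+q)D/I - 3q, and the frequency bound gives D/I ≤ C e^θ/h. As
B' = e^θ/h and q ≤ P, the function log I + 3Pt + (2+P)CB is nondecreasing. -/
theorem lower_bound_of_pos (hd : FrequencyData t₀ t₁ P I D h k q θ A B) (ha : a ∈ Icc t₀ t₁)
    (hb : b ∈ Icc a t₁) (hI : ∀ t ∈ Icc a b, 0 < I t) :
    I a * Real.exp (-lossExponent P I D h θ A B a t₁ b) ≤ I b := by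
  have hsub : Icc a b ⊆ Icc t₀ t₁ := Icc_subset_Icc ha.1 hb.2
  set C := (h a * D a / I a * Real.exp (-θ a) + h a * Real.exp (-θ a))
    * Real.exp (A t₁ - A a) with hC
  have hC0 : 0 ≤ h a * D a / I a * Real.exp (-θ a) + h a * Real.exp (-θ a) := by
    have := hd.h_pos a ha
    have := hd.D_nonneg a ha
    have := hI a (left_mem_Icc.2 hb.1)
    positivity
  have hanti : AntitoneOn (fun t => -(Real.log (I t) + 3 * P * t + (2 + P) * C * B t))
      (Icc a b) := by
    refine antitoneOn_of_hasDerivAt ?_ fun t ht => ?_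
    · exact ((((hd.contI.mono hsub).log fun t ht => (hI t ht).ne').add
        (continuousOn_const.mul continuousOn_id)).add
          (continuousOn_const.mul (hd.contB.mono hsub))).neg
    have htab := Ioo_subset_Icc_self ht
    have ht0 : t ∈ Ioo t₀ t₁ := ⟨ha.1.trans_lt ht.1, ht.2.trans_le hb.2⟩
    have htm := Ioo_subset_Icc_self ht0
    obtain ⟨I', D', hI', -, hlow, -⟩ := hd.deriv_I t ht0
    have hIt := hI t htab
    refine ⟨_, (((hI'.log hIt.ne').add ((hasDerivAt_id t).const_mul (3 * P))).add
      ((hd.deriv_B t ht0).const_mul ((2 + P) * C))).neg, ?_⟩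
    have hp := hd.h_pos t htm
    have hq := hd.q_nonneg t htm
    have hqP := hd.q_le t htm
    have hDt := hd.D_nonneg t htm
    have hfreq := hd.frequency_le ha ⟨htab.1, ht0.2.le⟩
      fun s hs => hI s ⟨hs.1, hs.2.trans htab.2⟩
    -- Replacing A(t) by A(t₁) makes C independent of t and of b.
    have hAmono : A t ≤ A t₁ := hd.monotoneOn_A htm
      (right_mem_Icc.2 (htm.1.trans htm.2)) htm.2
    have hfreqC : h t * D t / I t * Real.exp (-θ t) ≤ C := by
      refine hfreq.trans (mul_le_mul_of_nonneg_left ?_ hC0)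
      exact Real.exp_le_exp.2 (by linarith)
    have hEθ := Real.exp_pos (θ t)
    have hDI : D t / I t ≤ C * (1 / h t * Real.exp (θ t)) := by
      have h3 := mul_le_mul_of_nonneg_right hfreqC
        (by positivity : 0 ≤ 1 / h t * Real.exp (θ t))
      have h4 : h t * D t / I t * Real.exp (-θ t) * (1 / h t * Real.exp (θ t)) = D t / I t := by
        rw [Real.exp_neg]
        field_simp
      rwa [h4] at h3
    have hIdiv : -(2 + q t) * (D t / I t) - 3 * q t ≤ I' / I t := by
      rw [le_div_iff₀ hIt]
      have : (-(2 + q t) * (D t / I t) - 3 * q t) * I t = -(2 + q t) * D t - 3 * q t * I t := by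
        field_simp
      rw [this]
      exact hlow
    have hDI0 : 0 ≤ D t / I t := by positivity
    have h5 : (2 + q t) * (D t / I t) ≤ (2 + P) * (C * (1 / h t * Real.exp (θ t))) := by
      refine mul_le_mul (by linarith) hDI hDI0 (by linarith)
    rw [neg_nonpos]
    linarith
  have h1 := hanti (left_mem_Icc.2 hb.1) (right_mem_Icc.2 hb.1) hb.1
  simp only at h1
  have hIa := hI a (left_mem_Icc.2 hb.1)
  have hIb := hI b (right_mem_Icc.2 hb.1)
  have h2 : Real.log (I a) - lossExponent P I D h θ A B a t₁ b ≤ Real.log (I b) := by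
    have : lossExponent P I D h θ A B a t₁ b = 3 * (b - a) * P + (2 + P) * C * (B b - B a) := by
      rw [lossExponent, hC]; ring
    rw [this]
    linarith
  calc I a * Real.exp (-lossExponent P I D h θ A B a t₁ b)
      = Real.exp (Real.log (I a) - lossExponent P I D h θ A B a t₁ b) := by
        rw [sub_eq_add_neg, Real.exp_add, Real.exp_log hIa]
    _ ≤ Real.exp (Real.log (I b)) := Real.exp_le_exp.2 h2
    _ = I b := Real.exp_log hIb

/-- Once positive, `I` stays positive. -/
theorem pos_of_pos (hd : FrequencyData t₀ t₁ P I D h k q θ A B) (ha : a ∈ Icc t₀ t₁)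
    (hIa : 0 < I a) : ∀ t ∈ Icc a t₁, 0 < I t := by
  by_contra! hcon
  obtain ⟨s, hs, hIs⟩ := hcon
  have hsub : Icc a t₁ ⊆ Icc t₀ t₁ := Icc_subset_Icc_left ha.1
  have hIcont := hd.contI.mono hsub
  have hclosed : IsClosed (Icc a t₁ ∩ I ⁻¹' Iic 0) :=
    hIcont.preimage_isClosed_of_isClosed isClosed_Icc isClosed_Iic
  have hcomp : IsCompact (Icc a t₁ ∩ I ⁻¹' Iic 0) :=
    isCompact_Icc.of_isClosed_subset hclosed inter_subset_left
  -- Let c be the first time after a at which I is not positive. The lower bound holds on [a,b] for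
  -- every b < c and is continuous in b.
  obtain ⟨c, ⟨hc, hIc⟩, hleast⟩ := hcomp.exists_isLeast ⟨s, hs, hIs⟩
  have hac : a < c := by
    refine lt_of_le_of_ne hc.1 ?_
    rintro rfl
    exact absurd hIa (not_lt.2 hIc)
  have hpos : ∀ b ∈ Ico a c, 0 < I b := by
    intro b hb
    by_contra! h0
    exact absurd (hleast ⟨⟨hb.1, hb.2.le.trans hc.2⟩, h0⟩) (not_le.2 hb.2)
  have hbound : ∀ b ∈ Ico a c, I a * Real.exp (-lossExponent P I D h θ A B a t₁ b) ≤ I b :=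
    fun b hb => hd.lower_bound_of_pos ha ⟨hb.1, hb.2.le.trans hc.2⟩
      fun t ht => hpos t ⟨ht.1, ht.2.trans_lt hb.2⟩
  have hcontL : ContinuousOn (fun b => I a * Real.exp (-lossExponent P I D h θ A B a t₁ b))
      (Icc a t₁) := by
    unfold lossExponent
    have hB := hd.contB.mono hsub
    fun_prop
  have hmono : 𝓝[Ico a c] c ≤ 𝓝[Icc a t₁] c :=
    nhdsWithin_mono c fun x hx => ⟨hx.1, hx.2.le.trans hc.2⟩
  have hne : (𝓝[Ico a c] c).NeBot := by
    rw [← mem_closure_iff_nhdsWithin_neBot, closure_Ico hac.ne]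
    exact right_mem_Icc.2 hac.le
  -- Letting b tend to c from the left bounds I(c) below by a positive number, contrary to the
  -- choice of c.
  have hlim := le_of_tendsto_of_tendsto ((hcontL c hc).mono_left hmono)
    ((hIcont c hc).mono_left hmono)
    (Filter.eventually_of_mem self_mem_nhdsWithin hbound)
  have : 0 < I a * Real.exp (-lossExponent P I D h θ A B a t₁ c) := by positivity
  exact absurd hIc (not_le.2 (this.trans_le hlim))

theorem lower_bound (hd : FrequencyData t₀ t₁ P I D h k q θ A B) (ha : a ∈ Icc t₀ t₁)
    (hIa : 0 < I a) : I a * Real.exp (-lossExponent P I D h θ A B a t₁ t₁) ≤ I t₁ :=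
  hd.lower_bound_of_pos ha (right_mem_Icc.2 ha.2) (hd.pos_of_pos ha hIa)

end FrequencyData

end FrequencyODE

/-! ### Signs and continuity of the coefficients -/

section Signs

set_option linter.unusedSectionVars false

open MeasureTheory Matrix Set

theorem exists_factorization {n : ℕ} {K : Matrix (Fin n) (Fin n) ℝ} (hK : K.PosSemidef) :
    ∃ B : Matrix (Fin n) (Fin n) ℝ, ∀ i j, K i j = ∑ r, B r i * B r j := by
  open scoped MatrixOrder Matrix.Norms.L2Operator in
  obtain ⟨B, rfl⟩ := CStarAlgebra.nonneg_iff_eq_star_mul_self.mp hK.nonneg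
  exact ⟨B, fun i j => by simp [Matrix.mul_apply, Matrix.star_apply]⟩

/-- With K = BᵀB the sum is the sum of the squares of the entries of BSBᵀ. No symmetry of S is
needed, so the symmetry of the Ricci matrix is never invoked. -/
theorem normSq_nonneg {n : ℕ} {K : Matrix (Fin n) (Fin n) ℝ} (hK : K.PosSemidef)
    (S : Matrix (Fin n) (Fin n) ℝ) :
    0 ≤ ∑ i, ∑ j, ∑ k, ∑ l, K i k * K j l * S i j * S k l := by
  obtain ⟨B, hB⟩ := exists_factorization hK
  have h : ∑ i, ∑ j, ∑ k, ∑ l, K i k * K j l * S i j * S k l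
      = ∑ r, ∑ s, (∑ i, ∑ j, B r i * B s j * S i j) ^ 2 := by
    have h1 : ∀ i j k l, K i k * K j l * S i j * S k l
        = ∑ r, ∑ s, (B r i * B s j * S i j) * (B r k * B s l * S k l) := by
      intro i j k l
      rw [hB, hB, Finset.sum_mul_sum, Finset.sum_mul, Finset.sum_mul]
      refine Finset.sum_congr rfl fun r _ => ?_
      rw [Finset.sum_mul, Finset.sum_mul]
      exact Finset.sum_congr rfl fun s _ => by ring
    have h2 : ∀ r s, (∑ i, ∑ j, B r i * B s j * S i j) ^ 2
        = ∑ i, ∑ j, ∑ k, ∑ l, (B r i * B s j * S i j) * (B r k * B s l * S k l) := by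
      intro r s
      rw [sq, Finset.sum_mul]
      refine Finset.sum_congr rfl fun i _ => ?_
      rw [Finset.sum_mul]
      refine Finset.sum_congr rfl fun j _ => ?_
      rw [Finset.mul_sum]
      exact Finset.sum_congr rfl fun k _ => Finset.mul_sum _ _ _
    simp only [h1, h2]
    have : ∀ F : Fin n → Fin n → Fin n → Fin n → Fin n → Fin n → ℝ,
        ∑ i, ∑ j, ∑ k, ∑ l, ∑ r, ∑ s, F i j k l r s
          = ∑ r, ∑ s, ∑ i, ∑ j, ∑ k, ∑ l, F i j k l r s := by
      intro F
      simp only [← Fintype.sum_prod_type']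
      exact Fintype.sum_equiv
        ⟨fun q => (q.2.2.2.2.1, q.2.2.2.2.2, q.1, q.2.1, q.2.2.1, q.2.2.2.1),
          fun q => (q.2.2.1, q.2.2.2.1, q.2.2.2.2.1, q.2.2.2.2.2, q.1, q.2.1),
          fun _ => rfl, fun _ => rfl⟩ _ _ fun _ => rfl
    exact this _
  rw [h]
  exact Finset.sum_nonneg fun r _ => Finset.sum_nonneg fun s _ => sq_nonneg _

/-- The trace of a form bounded by `a G`. -/
theorem trace_le_of_form_le {n : ℕ} {G : Matrix (Fin n) (Fin n) ℝ} (hG : G.PosDef)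
    (S : Matrix (Fin n) (Fin n) ℝ) {a : ℝ}
    (h : ∀ X : Fin n → ℝ, ∑ i, ∑ j, S i j * X i * X j ≤ a * ∑ i, ∑ j, G i j * X i * X j) :
    ∑ i, ∑ j, G⁻¹ i j * S i j ≤ a * n := by
  obtain ⟨B, hB⟩ := exists_factorization hG.inv.posSemidef
  -- With G⁻¹ = BᵀB, contraction with G⁻¹ is the sum of the values of the quadratic form on the rows
  -- of B, and the hypothesis is applied to each row.
  have e : ∀ A : Matrix (Fin n) (Fin n) ℝ, ∑ i, ∑ j, G⁻¹ i j * A i j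
      = ∑ r, ∑ i, ∑ j, A i j * B r i * B r j := by
    intro A
    simp only [hB, Finset.sum_mul]
    rw [Finset.sum_comm (γ := Fin n) (s := Finset.univ (α := Fin n)) (t := Finset.univ (α := Fin n))
      (f := fun r i => ∑ j, A i j * B r i * B r j)]
    refine Finset.sum_congr rfl fun i _ => ?_
    rw [Finset.sum_comm]
    exact Finset.sum_congr rfl fun r _ => Finset.sum_congr rfl fun j _ => by ring
  have htr : ∑ i, ∑ j, G⁻¹ i j * G i j = n := by
    have h1 : ∀ i, ∑ j, G⁻¹ i j * G i j = (G⁻¹ * G) i i := by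
      intro i
      rw [Matrix.mul_apply]
      refine Finset.sum_congr rfl fun j _ => ?_
      rw [← hG.1.apply i j]
      simp
    simp [h1, Matrix.nonsing_inv_mul _ (isUnit_iff_ne_zero.2 hG.det_pos.ne')]
  rw [← htr, e, e, Finset.mul_sum]
  exact Finset.sum_le_sum fun r _ => h (B r)

variable {m : ℕ} {t₀ t₁ T t : ℝ} {M : Type*} [TopologicalSpace M]
  [ChartedSpace (EuclideanSpace ℝ (Fin (m + 1))) M] [IsManifold (𝓡 (m + 1)) ∞ M]
  {g : ℝ → SmoothMetric (m + 1) M} {p f v : ℝ → M → ℝ}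

theorem ricAddNormSq_nonneg (g : SmoothMetric (m + 1) M) (a : ℝ) (x : M) :
    0 ≤ ricAddNormSq g a x := by
  have h := normSq_nonneg (baseMatrix_posDef g x).inv.posSemidef
    (ricciAt g x + a • baseMatrix g x)
  simp only [ricAddNormSq, invCoeffAt, coeff_self]
  exact h

/-- The trace of the curvature bound is R + Δf ≤ (m+1)κ + R, and the scalar curvature cancels. -/
theorem laplacian_le (g : SmoothMetric (m + 1) M) (f : M → ℝ) (x : M) {κ : ℝ}
    (hRic : ∀ X : TangentSpace (𝓡 (m + 1)) x, bakryEmery g f x X X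
      ≤ (κ + scalarCurvature g x / ((m : ℝ) + 1)) * g.inner x X X) :
    laplacian g f x ≤ κ * ((m : ℝ) + 1) := by
  have h := trace_le_of_form_le (baseMatrix_posDef g x) (ricciAt g x + hessAt g f x)
    (a := κ + scalarCurvature g x / ((m : ℝ) + 1)) fun X => by
      have h1 := hRic (WithLp.toLp 2 X : EuclideanSpace ℝ (Fin (m + 1)))
      have h2 : g.inner x (WithLp.toLp 2 X : EuclideanSpace ℝ (Fin (m + 1)))
          (WithLp.toLp 2 X : EuclideanSpace ℝ (Fin (m + 1)))
          = ∑ i, ∑ j, baseMatrix g x i j * X i * X j := by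
        change bform g x (WithLp.toLp 2 X) (WithLp.toLp 2 X) = _
        rw [bform_eq_sum]
        simp only [baseMatrix, Matrix.of_apply]
        exact Finset.sum_congr rfl fun i _ => Finset.sum_congr rfl fun j _ => by ring
      rw [h2] at h1
      refine le_of_eq_of_le ?_ h1
      simp only [bakryEmery, Ric, Hess, formAt, components, Matrix.add_apply, add_mul,
        Finset.sum_add_distrib]
  have hs : ∑ i, ∑ j, (baseMatrix g x)⁻¹ i j * (ricciAt g x + hessAt g f x) i j
      = scalarCurvature g x + laplacian g f x := by
    simp only [scalarCurvature, laplacian, invCoeffAt, coeff_self, Matrix.add_apply, mul_add,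
      Finset.sum_add_distrib]
  have hm : ((m : ℝ) + 1) ≠ 0 := by positivity
  rw [hs] at h
  push_cast at h
  have h3 : (κ + scalarCurvature g x / ((m : ℝ) + 1)) * ((m : ℝ) + 1)
      = κ * ((m : ℝ) + 1) + scalarCurvature g x := by
    field_simp
  rw [h3] at h
  linarith

variable [T2Space M] [CompactSpace M]

/-- A supremum over the compact M of a jointly continuous function is continuous. Consequently p̄
and p̄² have differentiable primitives, and p̄ is bounded on [t₀,t₁]. -/
theorem continuousOn_pbar (hp : TimeSmooth (m + 1) t₀ t₁ p) :
    ContinuousOn (pbar p) (Icc t₀ t₁) := by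
  rw [continuousOn_iff_continuous_domRestrict]
  have h := (isCompact_univ (X := M)).continuous_sSup
    (f := fun (t : Icc t₀ t₁) x => p t x) ?_
  · refine h.congr fun t => ?_
    simp [pbar, sSup_range]
  · exact hp.continuousOn.comp_continuous
      ((continuous_subtype_val.comp continuous_fst).prodMk continuous_snd)
      fun q => ⟨q.1.2, mem_univ _⟩

theorem pbar_le_sSup (hp : TimeSmooth (m + 1) t₀ t₁ p) (ht : t ∈ Icc t₀ t₁) :
    pbar p t ≤ sSup (pbar p '' Icc t₀ t₁) :=
  le_csSup (isCompact_Icc.image_of_continuousOn (continuousOn_pbar hp)).bddAbove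
    (mem_image_of_mem _ ht)

variable [MeasurableSpace M] [BorelSpace M] [ConnectedSpace M]

theorem volumeMeasure_real_pos {g : SmoothMetric (m + 1) M} (hg : HasSmoothCoeff g) :
    0 < (volumeMeasure g).real univ := by
  have := hg.isFiniteMeasure
  have := hg.isOpenPosMeasure
  exact ENNReal.toReal_pos (isOpen_univ.measure_ne_zero _ univ_nonempty) (measure_ne_top _ _)

/-- The Laplacian integrates to zero, so the pressure equation gives (m+1)∫p dμ = (1/m)∫|Ric + mg|²
dμ ≥ 0. Since the volume is positive, the maximum of p cannot be negative. -/
theorem pbar_nonneg (hflow : IsConformalRicciFlow g p t₀ t₁) (ht : t ∈ Icc t₀ t₁) :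
    0 ≤ pbar p t := by
  have hg := hflow.hasSmoothCoeff ht
  have hp := (timeSmooth_of_smoothOn hflow.smooth_pressure).chartSmooth ht
  have := hg.isFiniteMeasure
  have hInt : ∀ {u : M → ℝ}, ChartSmooth (m + 1) u → Integrable u (volumeMeasure (g t)) :=
    fun hu => hg.integrable hu.continuous
  have h1 : 0 ≤ ∫ x, (-laplacian (g t) (p t) x + ((m : ℝ) + 1) * p t x) ∂(volumeMeasure (g t)) :=
    integral_nonneg fun x => by
      rw [hflow.pressure t ht x]
      exact mul_nonneg (by positivity) (ricAddNormSq_nonneg _ _ _)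
  have hneg : Integrable (fun x => -laplacian (g t) (p t) x) (volumeMeasure (g t)) :=
    (hInt (hg.chartSmooth_laplacian hp)).neg
  rw [integral_add hneg (hInt ((chartSmooth_const _).mul hp)), integral_neg, hg.integral_laplacian hp,
    integral_const_mul, neg_zero, zero_add] at h1
  have h2 : ∫ x, p t x ∂(volumeMeasure (g t)) ≤ ∫ _, pbar p t ∂(volumeMeasure (g t)) :=
    integral_mono (hInt hp) (integrable_const _)
      fun x => le_pbar (timeSmooth_of_smoothOn hflow.smooth_pressure) ht x
  rw [integral_const, smul_eq_mul] at h2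
  have h3 : 0 ≤ ∫ x, p t x ∂(volumeMeasure (g t)) :=
    nonneg_of_mul_nonneg_right h1 (by positivity)
  exact nonneg_of_mul_nonneg_right (h3.trans h2) (volumeMeasure_real_pos hg)

/-- Integrating Δf ≤ (m+1)κ over a closed manifold gives 0 ≤ (m+1)κ times the volume. With κ =
k/(2h) this is the sign of k. -/
theorem nonneg_of_bakryEmery_le {g : SmoothMetric (m + 1) M} (hg : HasSmoothCoeff g) {f : M → ℝ}
    (hf : ChartSmooth (m + 1) f) {κ : ℝ}
    (hRic : ∀ (x : M) (X : TangentSpace (𝓡 (m + 1)) x), bakryEmery g f x X X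
      ≤ (κ + scalarCurvature g x / ((m : ℝ) + 1)) * g.inner x X X) : 0 ≤ κ := by
  have := hg.isFiniteMeasure
  have h : ∫ x, laplacian g f x ∂(volumeMeasure g)
      ≤ ∫ _, κ * ((m : ℝ) + 1) ∂(volumeMeasure g) :=
    integral_mono (hg.integrable (hg.chartSmooth_laplacian hf).continuous) (integrable_const _)
      fun x => laplacian_le g f x (hRic x)
  rw [hg.integral_laplacian hf, integral_const, smul_eq_mul] at h
  have := nonneg_of_mul_nonneg_right h (volumeMeasure_real_pos hg)
  exact nonneg_of_mul_nonneg_left this (by positivity)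

end Signs

/-! ### The differential inequalities for the energies -/

section EnergyInequalities

set_option linter.unusedSectionVars false

open MeasureTheory Matrix Set

/-- Cauchy–Schwarz, from the discriminant of the nonnegative quadratic s ↦ ∫(sv + a)²H. -/
theorem sq_integral_le {X : Type*} [TopologicalSpace X] [MeasurableSpace X] {μ : Measure X}
    (hInt : ∀ {F : X → ℝ}, Continuous F → Integrable F μ) {H v a : X → ℝ} (hH : Continuous H)
    (hH0 : ∀ x, 0 < H x) (hv : Continuous v) (ha : Continuous a) :
    (∫ x, v x * a x * H x ∂μ) ^ 2 ≤ (∫ x, v x ^ 2 * H x ∂μ) * ∫ x, a x ^ 2 * H x ∂μ := by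
  have h : ∀ s : ℝ, 0 ≤ (∫ x, v x ^ 2 * H x ∂μ) * (s * s) + (2 * ∫ x, v x * a x * H x ∂μ) * s
      + ∫ x, a x ^ 2 * H x ∂μ := by
    intro s
    have h0 : 0 ≤ ∫ x, (s * v x + a x) ^ 2 * H x ∂μ :=
      integral_nonneg fun x => mul_nonneg (sq_nonneg _) (hH0 x).le
    have e : ∀ x, (s * v x + a x) ^ 2 * H x
        = (s * s) * (v x ^ 2 * H x) + (2 * s) * (v x * a x * H x) + a x ^ 2 * H x :=
      fun x => by ring
    simp only [e] at h0
    rw [integral_add (hInt (by fun_prop)) (hInt (by fun_prop)),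
      integral_add (hInt (by fun_prop)) (hInt (by fun_prop)), integral_const_mul,
      integral_const_mul] at h0
    linarith
  have := discrim_le_zero h
  rw [discrim] at this
  linarith

/-- The two inequalities of the frequency argument, for `φ = (∂_t - ∇f·∇) v`,
`ψ = (Δ - ∇f·∇) v` and `γ = |∇v|²`. -/
theorem energy_inequalities {X : Type*} [TopologicalSpace X] [MeasurableSpace X] {μ : Measure X}
    (hInt : ∀ {F : X → ℝ}, Continuous F → Integrable F μ) {H v φ ψ γ : X → ℝ} (hH : Continuous H)
    (hH0 : ∀ x, 0 < H x) (hv : Continuous v) (hφ : Continuous φ) (hψ : Continuous ψ)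
    (hγ : Continuous γ) (hγ0 : ∀ x, 0 ≤ γ x) {q c I D D' : ℝ} (hq : 0 ≤ q)
    (hw : ∀ x, |φ x - ψ x| ≤ q * (|v x| + Real.sqrt (γ x)))
    (hI : I = ∫ x, v x ^ 2 * H x ∂μ) (hD : D = ∫ x, γ x * H x ∂μ)
    (hgreen : D = -∫ x, v x * ψ x * H x ∂μ)
    (hD' : D' ≤ c * D - 2 * ∫ x, φ x * ψ x * H x ∂μ) :
    -(2 + q) * D - 3 * q * I ≤ 2 * ∫ x, v x * φ x * H x ∂μ ∧
      D' * I - D * (2 * ∫ x, v x * φ x * H x ∂μ) ≤ (c * D + q ^ 2 * (I + D)) * I := by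
  -- Passing to the mean a and the difference w turns the products into differences of squares: φψ =
  -- a² - w²/4, and (∫vψH)(2∫vφH) = 2A² - Y²/2. Cauchy–Schwarz is needed only for A.
  set a : X → ℝ := fun x => (φ x + ψ x) / 2 with ha
  set w : X → ℝ := fun x => φ x - ψ x with hw'
  have hac : Continuous a := by fun_prop
  have hwc : Continuous w := by fun_prop
  have hCS := sq_integral_le hInt hH hH0 hv hac
  set A := ∫ x, v x * a x * H x ∂μ
  set Y := ∫ x, v x * w x * H x ∂μ with hY
  set W := ∫ x, w x ^ 2 * H x ∂μ with hW
  set N := ∫ x, a x ^ 2 * H x ∂μ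
  have e1 : ∫ x, v x * φ x * H x ∂μ = A + 1 / 2 * Y := by
    rw [← integral_const_mul, ← integral_add (hInt (by fun_prop)) (hInt (by fun_prop))]
    exact integral_congr_ae (Filter.Eventually.of_forall fun x => by simp only [ha, hw']; ring)
  have e2 : ∫ x, v x * ψ x * H x ∂μ = A - 1 / 2 * Y := by
    rw [← integral_const_mul, ← integral_sub (hInt (by fun_prop)) (hInt (by fun_prop))]
    exact integral_congr_ae (Filter.Eventually.of_forall fun x => by simp only [ha, hw']; ring)
  have e3 : ∫ x, φ x * ψ x * H x ∂μ = N - 1 / 4 * W := by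
    rw [← integral_const_mul, ← integral_sub (hInt (by fun_prop)) (hInt (by fun_prop))]
    exact integral_congr_ae (Filter.Eventually.of_forall fun x => by simp only [ha, hw']; ring)
  have hWle : W ≤ 2 * q ^ 2 * (I + D) := by
    rw [hI, hD, ← integral_add (hInt (by fun_prop)) (hInt (by fun_prop)), ← integral_const_mul]
    refine integral_mono (hInt (by fun_prop)) (hInt (by fun_prop)) fun x => ?_
    have h1 : w x ^ 2 ≤ (q * (|v x| + Real.sqrt (γ x))) ^ 2 := by
      rw [← sq_abs]
      exact pow_le_pow_left₀ (abs_nonneg _) (hw x) 2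
    have h2 : (|v x| + Real.sqrt (γ x)) ^ 2 ≤ 2 * (v x ^ 2 + γ x) := by
      have := sq_nonneg (|v x| - Real.sqrt (γ x))
      nlinarith [Real.sq_sqrt (hγ0 x), sq_abs (v x)]
    have h3 : w x ^ 2 ≤ 2 * q ^ 2 * (v x ^ 2 + γ x) := by
      rw [mul_pow] at h1
      exact h1.trans ((mul_le_mul_of_nonneg_left h2 (sq_nonneg q)).trans_eq (by ring))
    have h4 := mul_le_mul_of_nonneg_right h3 (hH0 x).le
    simp only
    linarith
  -- The constants come from |v|(|v| + |∇v|) ≤ v² + ½(v² + |∇v|²).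
  have hYge : -(q * (3 / 2 * I + 1 / 2 * D)) ≤ Y := by
    rw [hI, hD, ← integral_const_mul, ← integral_const_mul,
      ← integral_add (hInt (by fun_prop)) (hInt (by fun_prop)), ← integral_const_mul,
      ← integral_neg]
    refine integral_mono (hInt (by fun_prop)) (hInt (by fun_prop)) fun x => ?_
    have h1 : |v x * w x| ≤ q * (3 / 2 * v x ^ 2 + 1 / 2 * γ x) := by
      rw [abs_mul]
      refine (mul_le_mul_of_nonneg_left (hw x) (abs_nonneg (v x))).trans ?_
      rw [mul_left_comm]
      refine mul_le_mul_of_nonneg_left ?_ hq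
      have := sq_nonneg (|v x| - Real.sqrt (γ x))
      nlinarith [Real.sq_sqrt (hγ0 x), sq_abs (v x)]
    have h2 := mul_le_mul_of_nonneg_right (neg_le_of_neg_le (neg_le_abs (v x * w x) |>.trans h1))
      (hH0 x).le
    simp only
    linarith
  have hI0 : 0 ≤ I := by
    rw [hI]
    exact integral_nonneg fun x => mul_nonneg (sq_nonneg _) (hH0 x).le
  rw [e1]
  rw [e2] at hgreen
  rw [e3] at hD'
  rw [← hI] at hCS
  constructor
  -- Since D = -(A - Y/2), the quantity 2A + Y equals -2D + 2Y, and the lower bound for Y applies.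
  · linarith
  · have h1 := mul_le_mul_of_nonneg_right hD' hI0
    have h2 := mul_le_mul_of_nonneg_right hWle hI0
    have h3 : D * (2 * (A + 1 / 2 * Y)) = Y ^ 2 / 2 - 2 * A ^ 2 := by
      rw [hgreen]
      ring
    -- In D'I - DI' the terms -2NI + 2A² are nonpositive by Cauchy–Schwarz and -Y²/2 is discarded.
    -- The error WI/2 is at most q²(I + D)I.
    have h4 := sq_nonneg Y
    linarith

variable {m : ℕ} {t₀ t₁ T t : ℝ} {M : Type*} [TopologicalSpace M]
  [ChartedSpace (EuclideanSpace ℝ (Fin (m + 1))) M] [IsManifold (𝓡 (m + 1)) ∞ M]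
  {g : ℝ → SmoothMetric (m + 1) M} {p f v : ℝ → M → ℝ} {h k : ℝ → ℝ}
  [T2Space M] [CompactSpace M] [MeasurableSpace M] [BorelSpace M]

/-- `∫ |∇v|² dV`. -/
def dirichletEnergy (g : ℝ → SmoothMetric (m + 1) M) (T : ℝ) (f v : ℝ → M → ℝ) (t : ℝ) : ℝ :=
  ∫ x, gradInner (g t) (v t) (v t) x * weight m T f t x ∂(volumeMeasure (g t))

theorem energyE_eq (g : ℝ → SmoothMetric (m + 1) M) (T : ℝ) (f v : ℝ → M → ℝ) (h : ℝ → ℝ) (t : ℝ) :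
    energyE g T f v h t = h t * dirichletEnergy g T f v t := by
  rw [energyE, dirichletEnergy, gradSq_eq_gradInner]

theorem energyI_nonneg (hT : t < T) : 0 ≤ energyI g T f v t :=
  integral_nonneg fun x => mul_nonneg (sq_nonneg _) (weight_pos hT f x).le

theorem dirichletEnergy_nonneg (hT : t < T) : 0 ≤ dirichletEnergy g T f v t :=
  integral_nonneg fun x => mul_nonneg (gradInner_self_nonneg _ _ x) (weight_pos hT f x).le

theorem eq_zero_of_energyI_eq_zero (hT : t < T) (hg : HasSmoothCoeff (g t))
    (hf : ChartSmooth (m + 1) (f t)) (hv : ChartSmooth (m + 1) (v t))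
    (hI : energyI g T f v t = 0) (x : M) : v t x = 0 := by
  have := hg.isOpenPosMeasure
  have hc : Continuous fun x => v t x ^ 2 * weight m T f t x :=
    (hv.continuous.pow 2).mul (continuous_const.mul hf.continuous.neg.rexp)
  have h0 := (integral_eq_zero_iff_of_nonneg
    (fun x => mul_nonneg (sq_nonneg _) (weight_pos hT f x).le) (hg.integrable hc)).1 hI
  have h1 := congrFun ((hc.ae_eq_iff_eq (volumeMeasure (g t)) continuous_zero).1 h0) x
  have h2 := weight_pos hT f x (m := m)
  simpa [h2.ne'] using h1

theorem frequencyData [ConnectedSpace M] (ht : t₀ < t₁) (hT : t₁ < T)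
    (hflow : IsConformalRicciFlow g p t₀ t₁)
    (hf : TimeSmooth (m + 1) t₀ t₁ f) (hH : IsConjugateHeatSolution g p T f t₀ t₁)
    (hh : ContDiffOn ℝ ∞ h (Icc t₀ t₁)) (hk : ContDiffOn ℝ ∞ k (Icc t₀ t₁))
    (hpos : ∀ t ∈ Icc t₀ t₁, 0 < h t)
    (hRic : ∀ t ∈ Icc t₀ t₁, ∀ (x : M) (X : TangentSpace (𝓡 (m + 1)) x),
      bakryEmery (g t) (f t) x X X
        ≤ (k t / (2 * h t) + scalarCurvature (g t) x / ((m : ℝ) + 1)) * (g t).inner x X X)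
    (hv : TimeSmooth (m + 1) t₀ t₁ v)
    (hineq : ∀ t ∈ Icc t₀ t₁, ∀ x : M,
      |timeDeriv t₀ t₁ v t x - laplacian (g t) (v t) x|
        ≤ pbar p t * (|v t x| + Real.sqrt (gradSq (g t) (v t) x))) :
    FrequencyData t₀ t₁ (sSup (pbar p '' Icc t₀ t₁)) (energyI g T f v) (dirichletEnergy g T f v)
      h k (pbar p) (exponent p h k t₀ t₁) (fun t => ∫ s in t₀..t, pbar p s ^ 2)
      (fun t => ∫ s in t₀..t, 1 / h s * Real.exp (exponent p h k t₀ t₁ s)) := by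
  have hp := timeSmooth_of_smoothOn hflow.smooth_pressure
  have hpc := continuousOn_pbar hp
  have hW := timeSmooth_weight hT hf
  have hθ : ContinuousOn (fun s => 2 * pbar p s + (derivWithin h (Icc t₀ t₁) s + k s) / h s)
      (Icc t₀ t₁) :=
    (continuousOn_const.mul hpc).add (((hh.continuousOn_derivWithin (uniqueDiffOn_Icc ht)
      (by simp)).add hk.continuousOn).div hh.continuousOn fun t ht => (hpos t ht).ne')
  have hθc : ContinuousOn (exponent p h k t₀ t₁) (Icc t₀ t₁) := continuousOn_primitive ht.le hθ
  have hB : ContinuousOn (fun s => 1 / h s * Real.exp (exponent p h k t₀ t₁ s)) (Icc t₀ t₁) :=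
    (continuousOn_const.div hh.continuousOn fun t ht => (hpos t ht).ne').mul hθc.rexp
  refine
    { contI := ?_
      contD := hflow.isSmoothFamily.continuousOn_integral ht
        ((hflow.isSmoothFamily.timeSmooth_gradInner ht hv hv).mul hW)
      conth := hh.continuousOn
      contθ := hθc
      contA := continuousOn_primitive ht.le (hpc.pow 2)
      contB := continuousOn_primitive ht.le hB
      I_nonneg := fun t ht => energyI_nonneg (ht.2.trans_lt hT)
      D_nonneg := fun t ht => dirichletEnergy_nonneg (ht.2.trans_lt hT)
      h_pos := hpos
      k_nonneg := fun t ht => ?_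
      q_nonneg := fun t ht => pbar_nonneg hflow ht
      q_le := fun t ht => pbar_le_sSup hp ht
      deriv_h := fun t ht => ?_
      deriv_A := fun t ht => hasDerivAt_primitive (hpc.pow 2) ht
      deriv_B := fun t ht => hasDerivAt_primitive hB ht
      deriv_I := fun t ht' => ?_ }
  · refine (hflow.isSmoothFamily.continuousOn_integral ht ((hv.mul hv).mul hW)).congr
      fun t _ => ?_
    simp only [energyI, sq]
  · have h1 := nonneg_of_bakryEmery_le (hflow.hasSmoothCoeff ht) (hf.chartSmooth ht) (hRic t ht)
    have h2 := hpos t ht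
    have h3 : k t = k t / (2 * h t) * (2 * h t) := by field_simp
    rw [h3]
    positivity
  · exact ⟨_, ((hh.differentiableOn (by simp)) t
      (Ioo_subset_Icc_self ht)).hasDerivWithinAt.hasDerivAt (Icc_mem_nhds ht.1 ht.2),
      hasDerivAt_primitive hθ ht⟩
  · have htm := Ioo_subset_Icc_self ht'
    have hg := hflow.hasSmoothCoeff htm
    have hvt := hv.chartSmooth htm
    have hft := hf.chartSmooth htm
    have hWt := hW.chartSmooth htm
    have hfv := hg.chartSmooth_gradInner hft hvt
    have hht := hpos t htm
    obtain ⟨D', hD', hle⟩ := exists_hasDerivAt_integral_gradSq ht hT hflow hf hH hv ht'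
      (hRic t htm)
    have hc : 2 * (k t / (2 * h t)) = k t / h t := by field_simp
    rw [hc] at hle
    refine ⟨_, D', hasDerivAt_energyI ht hT hflow hf hH hv ht', hD', ?_⟩
    -- Here φ - ψ = ∂_tv - Δv because the drift terms cancel, so the hypothesis on v is the required
    -- bound with q = p̄.
    refine energy_inequalities (fun hF => hg.integrable hF) hWt.continuous
      (fun x => weight_pos (htm.2.trans_lt hT) f x) hvt.continuous
      (((hv.timeDeriv ht).chartSmooth htm).sub hfv).continuous
      ((hg.chartSmooth_laplacian hvt).sub hfv).continuous
      (hg.chartSmooth_gradInner hvt hvt).continuous (gradInner_self_nonneg (g t) (v t))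
      (pbar_nonneg hflow htm) (fun x => ?_) rfl rfl
      (integral_gradInner_mul_weight hg hft hWt hvt hvt) hle
    have h1 := hineq t htm x
    rw [gradSq_eq_gradInner] at h1
    simpa using h1

end EnergyInequalities

end ConformalRicci

end

/-! ### The main theorem -/

open ConformalRicci in
theorem theorem4p1 {m : ℕ} (hm : 2 ≤ m) {M : Type*} [TopologicalSpace M]
    [ChartedSpace (EuclideanSpace ℝ (Fin (m + 1))) M] [IsManifold (𝓡 (m + 1)) ∞ M]
    [CompactSpace M] [T2Space M] [ConnectedSpace M] [MeasurableSpace M] [BorelSpace M]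
    {t₀ t₁ T : ℝ} (ht : t₀ < t₁) (hT : t₁ < T)
    (g : ℝ → SmoothMetric (m + 1) M) (p f v : ℝ → M → ℝ) (h k : ℝ → ℝ)
    (hflow : IsConformalRicciFlow g p t₀ t₁)
    (hf : SmoothOn m t₀ t₁ f) (hH : IsConjugateHeatSolution g p T f t₀ t₁)
    (hh : ContDiffOn ℝ ∞ h (Set.Icc t₀ t₁)) (hk : ContDiffOn ℝ ∞ k (Set.Icc t₀ t₁))
    (hpos : ∀ t ∈ Set.Icc t₀ t₁, 0 < h t)
    (hRic : ∀ t ∈ Set.Icc t₀ t₁, ∀ (x : M) (X : TangentSpace (𝓡 (m + 1)) x),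
      bakryEmery (g t) (f t) x X X
        ≤ (k t / (2 * h t) + scalarCurvature (g t) x / ((m : ℝ) + 1)) * (g t).inner x X X)
    (hv : SmoothOn m t₀ t₁ v)
    (hineq : ∀ t ∈ Set.Icc t₀ t₁, ∀ x : M,
      |timeDeriv t₀ t₁ v t x - laplacian (g t) (v t) x|
        ≤ pbar p t * (|v t x| + Real.sqrt (gradSq (g t) (v t) x))) :
    energyI g T f v t₀ * Real.exp
        (-3 * (t₁ - t₀) * sSup (pbar p '' Set.Icc t₀ t₁)
          - (2 + sSup (pbar p '' Set.Icc t₀ t₁))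
            * (frequency g p T f v h k t₀ t₁ t₀ + h t₀)
            * Real.exp (∫ t in t₀..t₁, pbar p t ^ 2)
            * ∫ t in t₀..t₁, 1 / h t * Real.exp (exponent p h k t₀ t₁ t))
      ≤ energyI g T f v t₁ ∧
    ((∀ x, v t₁ x = 0) → ∀ t ∈ Set.Icc t₀ t₁, ∀ x, v t x = 0) := by
  have hf' := timeSmooth_of_smoothOn hf
  have hv' := timeSmooth_of_smoothOn hv
  have hd := frequencyData ht hT hflow hf' hH hh hk hpos hRic hv' hineq
  have h0 : t₀ ∈ Set.Icc t₀ t₁ := Set.left_mem_Icc.2 ht.le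
  have h1 : t₁ ∈ Set.Icc t₀ t₁ := Set.right_mem_Icc.2 ht.le
  refine ⟨?_, fun hzero t htm x => ?_⟩
  · rcases (hd.I_nonneg t₀ h0).eq_or_lt with hI | hI
    -- If I(t₀) = 0 the left-hand side is zero whatever value the quotient in the frequency takes.
    · rw [← hI, zero_mul]
      exact hd.I_nonneg t₁ h1
    · refine le_of_eq_of_le ?_ (hd.lower_bound h0 hI)
      congr 2
      -- At a = t₀ the exponent θ and both primitives vanish, so E/I is the frequency itself and the
      -- loss exponent is the stated one.
      have hθ : exponent p h k t₀ t₁ t₀ = 0 := intervalIntegral.integral_same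
      simp only [FrequencyData.lossExponent, frequency, energyE_eq, hθ,
        intervalIntegral.integral_same, neg_zero, Real.exp_zero, mul_one, sub_zero]
      ring
  · have hI1 : energyI g T f v t₁ = 0 := by simp [energyI, hzero]
    refine eq_zero_of_energyI_eq_zero (htm.2.trans_lt hT) (hflow.hasSmoothCoeff htm)
      (hf'.chartSmooth htm) (hv'.chartSmooth htm) ?_ x
    refine le_antisymm ?_ (hd.I_nonneg t htm)
    -- Positivity of I at time t would propagate forward to t₁, where I vanishes.
    by_contra! hcon
    exact (hd.pos_of_pos htm hcon t₁ (Set.right_mem_Icc.2 htm.2)).ne' hI1
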